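/- Let $\mathbb K$ be an algebraically closed field that is complete with respect to a non-trivial absolute value, and write $\mathbb K\{\cdot\}$ for rings of convergent power series. Let $\ell_1,\dots,\ell_n\ge 1$ be integers with $\gcd(\ell_1,\dots,\ell_n)=1$, let $\Gamma=\langle \ell_1,\dots,\ell_n\rangle\subset\mathbb N$, and let $f_1,\dots,f_m\in\mathbb K[x]=\mathbb K[x_1,\dots,x_n]$ be binomials, homogeneous of degrees $d_1,\dots,d_m$ for the weights $\deg x_j=\ell_j$, that generate the kernel of $\mathbb K[x]\to\mathbb K[t]$, $x_j\mapsto t^{\ell_j}$. Let $\Delta\ell_j\in\{1,2,\dots\}\cup\{\infty\}$, $\delta=\min_j\Delta\ell_j$, and let $$\xi_j=t^{\ell_j}+\sum_{i\ge \ell_j+\Delta\ell_j}\xi_{j,i}\,t^i s^{i-\ell_j}\in\mathbb K[t,s],\qquad j=1,\dots,n.$$ Put $\xi'_j=\xi_j(t,1)$, let $\mathcal O=\mathbb K\{\xi'_1,\dots,\xi'_n\}\subset\mathbb K\{t\}$ be the ring of all $h(\xi')$ with $h\in\mathbb K\{x\}$, and let $\Gamma'=\{\operatorname{ord}_t g\mid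 0\ne g\in\mathcal O\}$ be its value semigroup. Give $\mathbb K\{x,s\}$ the weights $\deg x_j=\ell_j$, $\deg s=-1$, and let $\operatorname{ord}$ denote the weighted order on $\mathbb K\{x\}$. Then $\Gamma'=\Gamma$ if and only if there are homogeneous $f'_1,\dots,f'_m\in\mathbb K\{x,s\}$ such that, for all $i$, $$f_i(\xi)=f'_i(\xi,s)\,s\qquad\text{and}\qquad \operatorname{ord}\bigl(f'_i(x,1)\bigr)\ge d_i+\delta .\tag{$*$}$$ Moreover, let $A=\bigoplus_{i\in\mathbb Z}(F_i\cap\mathcal O)s^{-i}\subset\mathbb K\{t'\}[s^{\pm1}]$ be the Rees algebra of $\mathcal O$ (here $\mathcal O\subset\mathbb K\{t'\}$ with the parameter called $t'$, and $F_i$ is the set of all series of order at least $i$), regarded as a subring of $\mathbb K\{t,s\}$ by $t'=st$. Let $\mathcal O_S$ be the local ring of its analytic spectrum at the maximal ideal $A\cap\mathfrak m_{\mathcal O}[s^{\pm1}]+As$; that is, $\mathcal O_S=\mathcal O\{X\}/\mathcal O\{X\}I$ for a presentation $A=\mathcal O[X]/I$, $X=X_1,\dots,X_N$, in which the $X_k$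 map to that maximal ideal, where $\mathcal O\{X\}=\mathcal O\mathbin{\widehat\otimes}\mathbb K\{X\}$. If $f'_1,\dots,f'_m$ are homogeneous and satisfy $(*)$, then such presentations exist, and for each of them the inclusion $A\subset\mathbb K\{t,s\}$ extends to an isomorphism of $\mathcal O_S$ with the ring $\mathbb K\{\xi,s\}\subset\mathbb K\{t,s\}$ of all $h(\xi,s)$, $h\in\mathbb K\{x,s\}$; the substitution $x_j\mapsto\xi_j$, $s\mapsto s$ induces an isomorphism $$\mathbb K\{x,s\}/\langle F_1,\dots,F_m\rangle\cong\mathbb K\{\xi,s\}=\mathcal O_S,\qquad F_i=f_i-f'_i s;$$ and this ring is flat over $\mathbb K\{s\}$. -/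

import Mathlib

noncomputable section

namespace CurveDeformation

/-! ### Convergent power series -/

section Convergent

variable {σ τ K : Type*} [NontriviallyNormedField K]

/-- A power series converges in some polydisc of positive radius around the origin. -/
def IsConvergent (f : MvPowerSeries σ K) : Prop :=
  ∃ r : ℝ, 0 < r ∧ ∃ C : ℝ, ∀ α : σ →₀ ℕ, ‖MvPowerSeries.coeff α f‖ * r ^ α.degree ≤ C

theorem isConvergent_of_le {f : MvPowerSeries σ K} {r C : ℝ}
    (h : ∀ α : σ →₀ ℕ, ‖MvPowerSeries.coeff α f‖ * r ^ α.degree ≤ C) {q : ℝ} (hq : 0 < q)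
    (hqr : q ≤ r) (α : σ →₀ ℕ) : ‖MvPowerSeries.coeff α f‖ * q ^ α.degree ≤ C :=
  (mul_le_mul_of_nonneg_left (pow_le_pow_left₀ hq.le hqr _) (norm_nonneg _)).trans (h α)

theorem isConvergent_monomial (β : σ →₀ ℕ) (c : K) :
    IsConvergent (MvPowerSeries.monomial β c) := by
  classical
  refine ⟨1, one_pos, ‖c‖, fun α => ?_⟩
  rw [MvPowerSeries.coeff_monomial]
  split_ifs <;> simp

theorem IsConvergent.add {f g : MvPowerSeries σ K} (hf : IsConvergent f) (hg : IsConvergent g) :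
    IsConvergent (f + g) := by
  obtain ⟨r, hr, C, hC⟩ := hf
  obtain ⟨q, hq, D, hD⟩ := hg
  have hm : 0 < min r q := lt_min hr hq
  refine ⟨min r q, hm, C + D, fun α => ?_⟩
  have h1 := isConvergent_of_le hC hm (min_le_left _ _) α
  have h2 := isConvergent_of_le hD hm (min_le_right _ _) α
  have h3 : 0 ≤ (min r q) ^ α.degree := by positivity
  rw [map_add]
  nlinarith [norm_add_le (MvPowerSeries.coeff α f) (MvPowerSeries.coeff α g)]

theorem card_antidiagonal_le [DecidableEq σ] (α : σ →₀ ℕ) :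
    (Finset.HasAntidiagonal.antidiagonal α).card ≤ 2 ^ α.degree := by
  have h1 : (Finset.HasAntidiagonal.antidiagonal α).card ≤ (Finset.Iic α).card := by
    refine Finset.card_le_card_of_injOn Prod.fst (fun p hp => ?_) (fun p hp q hq h => ?_)
    · have := Finset.HasAntidiagonal.mem_antidiagonal.1 (Finset.mem_coe.1 hp)
      simp only [Finset.coe_Iic, Set.mem_Iic]
      exact this ▸ le_self_add
    · have e1 := Finset.HasAntidiagonal.mem_antidiagonal.1 (Finset.mem_coe.1 hp)
      have e2 := Finset.HasAntidiagonal.mem_antidiagonal.1 (Finset.mem_coe.1 hq)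
      refine Prod.ext h ?_
      rw [← e2, h] at e1
      exact add_left_cancel e1
  refine h1.trans ?_
  rw [Finsupp.card_Iic, Finsupp.degree_apply, ← Finset.prod_pow_eq_pow_sum]
  refine Finset.prod_le_prod' fun i _ => ?_
  rw [Nat.card_Iic]
  exact Nat.lt_two_pow_self

theorem IsConvergent.mul {f g : MvPowerSeries σ K} (hf : IsConvergent f) (hg : IsConvergent g) :
    IsConvergent (f * g) := by
  classical
  obtain ⟨r, hr, C, hC⟩ := hf
  obtain ⟨q, hq, D, hD⟩ := hg
  have hm : 0 < min r q := lt_min hr hq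
  have hC0 : 0 ≤ C := le_trans (by positivity) (hC 0)
  refine ⟨min r q / 2, by positivity, C * D, fun α => ?_⟩
  set ρ := min r q with hρ
  have key : ‖MvPowerSeries.coeff α (f * g)‖ * ρ ^ α.degree
      ≤ (Finset.HasAntidiagonal.antidiagonal α).card * (C * D) := by
    rw [MvPowerSeries.coeff_mul]
    calc _ ≤ (∑ p ∈ Finset.HasAntidiagonal.antidiagonal α,
            ‖MvPowerSeries.coeff p.1 f * MvPowerSeries.coeff p.2 g‖) * ρ ^ α.degree :=
          mul_le_mul_of_nonneg_right (norm_sum_le _ _) (by positivity)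
      _ = ∑ p ∈ Finset.HasAntidiagonal.antidiagonal α, (‖MvPowerSeries.coeff p.1 f‖ * ρ ^ p.1.degree) *
            (‖MvPowerSeries.coeff p.2 g‖ * ρ ^ p.2.degree) := by
          rw [Finset.sum_mul]
          refine Finset.sum_congr rfl fun p hp => ?_
          rw [← Finset.HasAntidiagonal.mem_antidiagonal.1 hp, map_add, pow_add, norm_mul]
          ring
      _ ≤ ∑ _p ∈ Finset.HasAntidiagonal.antidiagonal α, C * D := by
          refine Finset.sum_le_sum fun p _ => ?_
          exact mul_le_mul (isConvergent_of_le hC hm (min_le_left _ _) _)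
            (isConvergent_of_le hD hm (min_le_right _ _) _) (by positivity) hC0
      _ = _ := by rw [Finset.sum_const, nsmul_eq_mul]
  have hCD : 0 ≤ C * D := mul_nonneg hC0 (le_trans (by positivity) (hD 0))
  have hcard : ((Finset.HasAntidiagonal.antidiagonal α).card : ℝ) ≤ 2 ^ α.degree := by
    exact_mod_cast card_antidiagonal_le α
  rw [div_pow, ← mul_div_assoc, div_le_iff₀ (by positivity)]
  calc _ ≤ _ := key
    _ ≤ 2 ^ α.degree * (C * D) := mul_le_mul_of_nonneg_right hcard hCD
    _ = _ := mul_comm _ _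

theorem IsConvergent.rename {f : MvPowerSeries σ K} (hf : IsConvergent f) (e : σ ↪ τ) :
    IsConvergent (MvPowerSeries.rename e f) := by
  classical
  obtain ⟨r, hr, C, hC⟩ := hf
  have hC0 : 0 ≤ C := le_trans (by positivity) (hC 0)
  refine ⟨r, hr, C, fun α => ?_⟩
  by_cases h : α ∈ Set.range (Finsupp.mapDomain e)
  · obtain ⟨β, rfl⟩ := h
    rw [← Finsupp.embDomain_eq_mapDomain, MvPowerSeries.coeff_embDomain_rename,
      Finsupp.embDomain_eq_mapDomain, Finsupp.degree_mapDomain]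
    exact hC β
  · rw [MvPowerSeries.coeff_rename_eq_zero _ _ h]
    simpa using hC0

variable (σ K) in
/-- The ring `K{σ}` of convergent power series, as a subalgebra of the formal power series. -/
def convergentSeries : Subalgebra K (MvPowerSeries σ K) where
  carrier := {f | IsConvergent f}
  mul_mem' := IsConvergent.mul
  add_mem' := IsConvergent.add
  algebraMap_mem' c := isConvergent_monomial 0 c

/-- The inclusion `K{σ} → K{τ}` induced by an injection of the variables. -/
def convergentRename (e : σ ↪ τ) : convergentSeries σ K →ₐ[K] convergentSeries τ K :=
  ((MvPowerSeries.rename e).comp (convergentSeries σ K).val).codRestrict _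
    fun f => IsConvergent.rename f.2 e

/-- A variable as a convergent power series. -/
def convergentX (i : σ) : convergentSeries σ K :=
  ⟨MvPowerSeries.X i, isConvergent_monomial _ _⟩

theorem IsConvergent.coe (p : MvPolynomial σ K) : IsConvergent (p : MvPowerSeries σ K) := by
  induction p using MvPolynomial.induction_on' with
  | monomial u a => rw [MvPolynomial.coe_monomial]; exact isConvergent_monomial u a
  | add p q hp hq => rw [MvPolynomial.coe_add]; exact hp.add hq

/-- A polynomial as a convergent power series. -/
def convergentOfPoly (p : MvPolynomial σ K) : convergentSeries σ K :=
  ⟨p, IsConvergent.coe p⟩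

/-- The algebra `K{a}` of all `h(a)`, with `h` a convergent power series in as many variables
as there are members of the family `a`. -/
def analyticAlgebra (a : σ → MvPowerSeries τ K) (ha : MvPowerSeries.HasSubst a) :
    Subalgebra K (MvPowerSeries τ K) :=
  (convergentSeries σ K).map (MvPowerSeries.substAlgHom ha)

end Convergent

/-! ### The Rees algebra of an algebra `O ⊆ K⟦t'⟧` with respect to the order in `t'` -/

section Rees

variable {K : Type*} [Field K]

theorem order_sum_ge {ι : Type*} (S : Finset ι) (g : ι → PowerSeries K) (k : ℕ∞)
    (h : ∀ i ∈ S, k ≤ (g i).order) : k ≤ (∑ i ∈ S, g i).order := by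
  classical
  induction S using Finset.induction_on with
  | empty => simp
  | insert a S ha ih =>
    rw [Finset.sum_insert ha]
    exact (le_min (h a (Finset.mem_insert_self a S))
      (ih fun i hi => h i (Finset.mem_insert_of_mem hi))).trans
        (PowerSeries.min_order_le_order_add _ _)

/-- `⨁ (F_i ∩ O) s^(-i)` in `K⟦t'⟧[s, s⁻¹]`, where `F_i` consists of the power series of order at
least `i` (all of them if `i ≤ 0`). -/
def orderRees (O : Subalgebra K (PowerSeries K)) :
    Subalgebra K (LaurentPolynomial (PowerSeries K)) where
  carrier := {p | ∀ i : ℤ, p.coeff i ∈ O ∧ ((-i).toNat : ℕ∞) ≤ (p.coeff i).order}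
  mul_mem' {p q} hp hq i := by
    classical
    rw [AddMonoidAlgebra.coeff_mul]
    refine ⟨sum_mem fun a _ => sum_mem fun b _ => ?_,
      order_sum_ge _ _ _ fun a _ => order_sum_ge _ _ _ fun b _ => ?_⟩
    · dsimp only
      split_ifs
      · exact mul_mem (hp a).1 (hq b).1
      · exact zero_mem _
    · dsimp only
      split_ifs with h
      · refine le_trans ?_ ((add_le_add (hp a).2 (hq b).2).trans (PowerSeries.le_order_mul _ _))
        have : (-i).toNat ≤ (-a).toNat + (-b).toNat := by omega
        exact_mod_cast this
      · simp
  add_mem' {p q} hp hq i :=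
    ⟨add_mem (hp i).1 (hq i).1,
      (le_min (hp i).2 (hq i).2).trans (PowerSeries.min_order_le_order_add _ _)⟩
  algebraMap_mem' c i := by
    rw [LaurentPolynomial.algebraMap_apply, LaurentPolynomial.C_apply]
    split_ifs with h
    · subst h
      exact ⟨O.algebraMap_mem c, by simp⟩
    · exact ⟨zero_mem _, by simp⟩

/-- The element `s` of the Rees algebra. -/
def reesS (O : Subalgebra K (PowerSeries K)) : orderRees O :=
  ⟨LaurentPolynomial.T 1, fun i => by
    rw [LaurentPolynomial.T_apply]
    split_ifs with h
    · subst h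
      exact ⟨one_mem _, by simp⟩
    · exact ⟨zero_mem _, by simp⟩⟩

/-- The inclusion of `O` as part of degree zero of the Rees algebra. -/
def toRees (O : Subalgebra K (PowerSeries K)) : O →+* orderRees O :=
  ((LaurentPolynomial.C : PowerSeries K →+* _).comp O.val.toRingHom).codRestrict _ fun g i => by
    change (LaurentPolynomial.C (g : PowerSeries K)).coeff i ∈ O ∧
      _ ≤ ((LaurentPolynomial.C (g : PowerSeries K)).coeff i).order
    rw [LaurentPolynomial.C_apply]
    split_ifs with h
    · subst h
      exact ⟨g.2, by simp⟩
    · exact ⟨zero_mem _, by simp⟩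

/-- The maximal ideal `A ∩ 𝔪[s, s⁻¹] + A s` of the Rees algebra `A` of `O`, where `𝔪` consists of
the members of `O` without constant term. -/
def vertexIdeal (O : Subalgebra K (PowerSeries K)) : Ideal (orderRees O) :=
  Ideal.span ({p | ∀ i : ℤ, PowerSeries.constantCoeff (p.1.coeff i) = 0} ∪ {reesS O})

/-- The inclusion of the Rees algebra in `K⟦t, s⟧` by `t' = s t`: the term `c t'^a s^i` becomes
`c t^a s^(a + i)`. The variables `0` and `1` stand for `t` and `s`. -/
def reesToSeries (O : Subalgebra K (PowerSeries K)) (p : orderRees O) :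
    MvPowerSeries (Fin 2) K :=
  fun e => PowerSeries.coeff (e 0) (p.1.coeff ((e 1 : ℤ) - (e 0 : ℤ)))

end Rees

/-! ### The deformation of the parametrization of a monomial curve -/

/-- Elements `ξ_j = t^(ℓ_j) + ∑ ξ_{j,i} t^i s^(i - ℓ_j)` of `K[t, s]`, where the (finite) sum
runs over `i ≥ ℓ_j + Δℓ_j`. -/
structure Deformation (K : Type*) [Field K] (n : ℕ) where
  /-- the exponents `ℓ_j` -/
  ell : Fin n → ℕ
  ell_pos : ∀ j, 0 < ell j
  /-- the numbers `Δℓ_j` -/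
  gap : Fin n → ℕ∞
  gap_ne_zero : ∀ j, gap j ≠ 0
  /-- the coefficients `ξ_{j,i}` -/
  tail : Fin n → ℕ →₀ K
  le_of_tail_ne_zero : ∀ j i, tail j i ≠ 0 → (ell j : ℕ∞) + gap j ≤ (i : ℕ∞)

namespace Deformation

section Algebraic

variable {K : Type*} [Field K] {n : ℕ} (D : Deformation K n)

/-- The semigroup `Γ` generated by the `ℓ_j`. -/
def semigroup : AddSubmonoid ℕ := AddSubmonoid.closure (Set.range D.ell)

/-- The kernel of `K[x] → K[t]`, `x_j ↦ t^(ℓ_j)`. -/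
def monomialIdeal : Ideal (MvPolynomial (Fin n) K) :=
  RingHom.ker (MvPolynomial.aeval (R := K) fun j => (Polynomial.X : Polynomial K) ^ D.ell j)

/-- `δ = min Δℓ_j`. -/
def delta : ℕ∞ := ⨅ j, D.gap j

/-- `ξ_j ∈ K[t, s]`. The variables `0` and `1` stand for `t` and `s`. -/
def xi (j : Fin n) : MvPolynomial (Fin 2) K :=
  MvPolynomial.X 0 ^ D.ell j + (D.tail j).sum fun i c =>
    MvPolynomial.C c * MvPolynomial.X 0 ^ i * MvPolynomial.X 1 ^ (i - D.ell j)

/-- `ξ'_j = ξ_j(t, 1)`. -/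
def xiOne (j : Fin n) : PowerSeries K :=
  MvPolynomial.aeval ![PowerSeries.X, 1] (D.xi j)

/-- The family `ξ_1, …, ξ_n, s`. -/
def xiS : Fin n ⊕ Unit → MvPowerSeries (Fin 2) K :=
  Sum.elim (fun j => (D.xi j : MvPowerSeries (Fin 2) K)) fun _ => MvPowerSeries.X 1

theorem pos_of_mem_tail {j : Fin n} {i : ℕ} (h : i ∈ (D.tail j).support) : 0 < i := by
  have h1 := D.le_of_tail_ne_zero j i (Finsupp.mem_support_iff.1 h)
  have h2 : (D.ell j : ℕ∞) ≤ (i : ℕ∞) := le_self_add.trans h1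
  exact (D.ell_pos j).trans_le (by exact_mod_cast h2)

theorem hasSubst_xiS : MvPowerSeries.HasSubst D.xiS := by
  refine MvPowerSeries.hasSubst_of_constantCoeff_zero fun a => ?_
  rcases a with j | _
  · have h : MvPolynomial.constantCoeff (D.xi j) = 0 := by
      rw [xi, map_add, Finsupp.sum, map_sum, Finset.sum_eq_zero]
      · simp [(D.ell_pos j).ne']
      · intro i hi
        simp [(D.pos_of_mem_tail hi).ne']
    simpa [xiS, ← MvPowerSeries.coeff_zero_eq_constantCoeff_apply, MvPolynomial.coeff_coe,
      ← MvPolynomial.constantCoeff_eq] using h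
  · simp [xiS]

theorem hasSubst_xiOne :
    MvPowerSeries.HasSubst (D.xiOne : Fin n → MvPowerSeries Unit K) := by
  refine MvPowerSeries.hasSubst_of_constantCoeff_zero fun j => ?_
  change PowerSeries.constantCoeff (D.xiOne j) = 0
  rw [xiOne, xi, map_add, map_add, Finsupp.sum, map_sum, map_sum, Finset.sum_eq_zero]
  · simp [(D.ell_pos j).ne']
  · intro i hi
    simp [(D.pos_of_mem_tail hi).ne']

/-- Homogeneity of degree `e` in `K⟦x, s⟧` for the weights `deg x_j = ℓ_j`, `deg s = -1`. -/
def IsHomogeneous (e : ℤ) (g : MvPowerSeries (Fin n ⊕ Unit) K) : Prop :=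
  ∀ α : (Fin n ⊕ Unit) →₀ ℕ, MvPowerSeries.coeff α g ≠ 0 →
    Finsupp.weight (Sum.elim (fun j => (D.ell j : ℤ)) fun _ => -1) α = e

end Algebraic

/-- `g(x, 1)` for a series `g(x, s)` in which every monomial in `x` occurs with finitely many
powers of `s`, such as a homogeneous one. -/
def atOne {K : Type*} [Field K] {n : ℕ} (g : MvPowerSeries (Fin n ⊕ Unit) K) :
    MvPowerSeries (Fin n) K :=
  fun α => ∑ᶠ k : ℕ, MvPowerSeries.coeff (Finsupp.sumElim α (Finsupp.single () k)) g

section Analytic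

variable {K : Type*} [NontriviallyNormedField K] {n : ℕ} (D : Deformation K n)

/-- The ring `O = K{ξ'} ⊆ K{t}` of the curve germ `C`. -/
def curveRing : Subalgebra K (PowerSeries K) :=
  analyticAlgebra (D.xiOne : Fin n → MvPowerSeries Unit K) D.hasSubst_xiOne

/-- The value semigroup `Γ'` of the curve germ `C`. -/
def valueSemigroup : Set ℕ := {k | ∃ g ∈ D.curveRing, PowerSeries.order g = k}

/-- The ring `K{ξ, s} ⊆ K{t, s}`. -/
def totalRing : Subalgebra K (MvPowerSeries (Fin 2) K) :=
  analyticAlgebra D.xiS D.hasSubst_xiS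

/-- The surjection `K{y} → O`, `y_j ↦ ξ'_j`. -/
def toCurveRing : convergentSeries (Fin n) K →+* D.curveRing :=
  ((MvPowerSeries.substAlgHom D.hasSubst_xiOne).comp
    (convergentSeries (Fin n) K).val).toRingHom.codRestrict _ fun h => ⟨h, h.2, rfl⟩

/-- The homomorphism `K{y}[X] → O[X] → A` to the Rees algebra `A` of `O` that sends `y_j` to `ξ'_j`
and `X_i` to `a_i`. -/
def presentation {N : ℕ} (a : Fin N → orderRees D.curveRing) :
    MvPolynomial (Fin N) (convergentSeries (Fin n) K) →+* orderRees D.curveRing :=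
  MvPolynomial.eval₂Hom ((toRees D.curveRing).comp D.toCurveRing) a

/-- The elements `a_i` lie in the maximal ideal of the vertex and generate the Rees algebra as an
`O`-algebra. -/
def IsPresentation {N : ℕ} (a : Fin N → orderRees D.curveRing) : Prop :=
  (∀ i, a i ∈ vertexIdeal D.curveRing) ∧ Function.Surjective (D.presentation a)

/-- The inclusion `K{y}[X] → K{y, X}`. -/
def polyToSeries (K : Type*) [NontriviallyNormedField K] (n N : ℕ) :
    MvPolynomial (Fin N) (convergentSeries (Fin n) K) →+* convergentSeries (Fin n ⊕ Fin N) K :=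
  MvPolynomial.eval₂Hom (convergentRename Function.Embedding.inl).toRingHom
    fun i => convergentX (Sum.inr i)

/-- The local ring `O_S = O{X} / O{X} I` at the vertex of the analytic spectrum of the Rees algebra
`A = O[X] / I` of `O`. As `O = K{y} / J`, the ring `O{X}`, the analytic tensor product of `O`
and `K{X}`, is `K{y, X} / J K{y, X}`; hence `O_S` is the quotient of `K{y, X}` by the ideal
generated by the kernel of `K{y}[X] → A`. -/
abbrev AnalyticStalk {N : ℕ} (a : Fin N → orderRees D.curveRing) : Type _ :=
  convergentSeries (Fin n ⊕ Fin N) K ⧸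
    (RingHom.ker (D.presentation a)).map (polyToSeries K n N)

/-- The series `f'_i ∈ K{x, s}` are homogeneous, `f_i(ξ) = f'_i(ξ, s) s`, and
`ord f'_i(x, 1) ≥ d_i + δ` for the weighted order. -/
structure IsLifting {m : ℕ} (f : Fin m → MvPolynomial (Fin n) K) (d : Fin m → ℕ)
    (f' : Fin m → convergentSeries (Fin n ⊕ Unit) K) : Prop where
  homogeneous : ∀ i, ∃ e : ℤ, D.IsHomogeneous e (f' i)
  eq_mul : ∀ i,
    ((MvPolynomial.aeval D.xi (f i) : MvPolynomial (Fin 2) K) : MvPowerSeries (Fin 2) K) =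
    MvPowerSeries.subst D.xiS (f' i : MvPowerSeries (Fin n ⊕ Unit) K) * MvPowerSeries.X 1
  le_order : ∀ i, (d i : ℕ∞) + D.delta ≤ (atOne (f' i).1).weightedOrder D.ell

/-- The ideal of `K{x, s}` generated by the `F_i = f_i - f'_i s`. -/
def totalIdeal {m : ℕ} (f : Fin m → MvPolynomial (Fin n) K)
    (f' : Fin m → convergentSeries (Fin n ⊕ Unit) K) :
    Ideal (convergentSeries (Fin n ⊕ Unit) K) :=
  Ideal.span (Set.range fun i =>
    convergentOfPoly (MvPolynomial.rename Sum.inl (f i)) - f' i * convergentX (Sum.inr ()))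

/-- The structure map `K{s} → K{x, s} / (F)`. -/
def structureMap {m : ℕ} (f : Fin m → MvPolynomial (Fin n) K)
    (f' : Fin m → convergentSeries (Fin n ⊕ Unit) K) :
    convergentSeries Unit K →+* convergentSeries (Fin n ⊕ Unit) K ⧸ totalIdeal f f' :=
  (Ideal.Quotient.mk (totalIdeal f f')).comp
    (convergentRename Function.Embedding.inr).toRingHom

end Analytic

end Deformation

end CurveDeformation

end

/-! Everything rests on one dictionary. Replacing t by ts turns ξ'_j into s^(ℓ_j) ξ_j
(`diag_xiOne`), so a homogeneous series G of degree a - b satisfies s^a G(ξ, s) = s^b g(ts), where g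
is the value of G(x, 1) at ξ' (`IsHomogeneous.X_pow_mul_subst_eq`). A lifting f'_i therefore amounts
to another expression f_i(ξ') = f'_i(ξ', 1) of larger weighted order.

Suppose liftings exist and g = h(ξ') has order k. If the part p of h of least weight v contributes
nothing to the coefficient of t^v, then its coefficients add up to zero, so p is a relation among
the t^(ℓ_j) and a combination of the f_i. Exchanging f_i for f'_i(x, 1) keeps the value g and raises
the weighted order. This can be repeated until the order of g is reached, which forces k into Γ
(`IsLifting.valueSemigroup_eq`).

Conversely, let Γ' = Γ. The leading terms of the two monomials of f_i cancel at ξ', so f_i(ξ') has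
order at least d_i + δ. A member of the curve ring of order at least k is h(ξ') with h convergent of
weighted order at least k (`exists_lift_of_le_order`): leading terms are removed by monomials in ξ'
until the order passes the conductor, and the rest is treated at once, because the convergent series
in t form a finite module over those in a single ξ'_j. Homogenizing h gives f'_i
(`exists_isLifting_homogenize`).

Finiteness comes from a Weierstrass-type division (`exists_division`), a contraction argument for
weighted ℓ¹ norms with adapted radii, followed by Nakayama's lemma (`span_eq_top_of_division`).
Applied to K{x, s} modulo the F_i, it shows that Apéry monomials with respect to ℓ_(j₀) generate
over K{x_(j₀), s}. Their images in K{ξ, s} are independent, since at s = 0 they are powers of t in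
distinct residue classes modulo ℓ_(j₀) (`coeff_eq_zero_of_combination`). Hence the F_i generate the
whole kernel of x ↦ ξ (`IsLifting.ker_toTotal`), and flatness is torsion-freeness over a discrete
valuation ring.

The Rees algebra embeds in K⟦t, s⟧ (`reesHom`), and the lifting of orders shows that it is generated
over the curve ring by ξ'_j s^(-ℓ_j) and s (`polyToRees_surjective`). An arbitrary presentation is
compared with this one by expressing each set of generators through the other. The resulting
substitutions of convergent series are inverse to each other modulo the relevant ideals
(`exists_stalk_algEquiv`). -/

noncomputable section

namespace CurveDeformation

open MvPowerSeries
open scoped ENNReal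

/-! ### Weighted `ℓ¹` norms of power series -/

section Norm

variable {σ τ K : Type*} [NontriviallyNormedField K]

/-- The value of the monomial with exponent `α` at `w`. -/
def monoVal (w : σ → ℝ≥0∞) (α : σ →₀ ℕ) : ℝ≥0∞ := α.prod fun i k => w i ^ k

theorem monoVal_zero (w : σ → ℝ≥0∞) : monoVal w 0 = 1 := Finsupp.prod_zero_index

theorem monoVal_add (w : σ → ℝ≥0∞) (α β : σ →₀ ℕ) :
    monoVal w (α + β) = monoVal w α * monoVal w β :=
  Finsupp.prod_add_index' (fun _ => pow_zero _) fun _ _ _ => pow_add _ _ _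

theorem monoVal_single (w : σ → ℝ≥0∞) (i : σ) (k : ℕ) :
    monoVal w (Finsupp.single i k) = w i ^ k :=
  Finsupp.prod_single_index (pow_zero _)

theorem monoVal_mono {w v : σ → ℝ≥0∞} (h : ∀ i, w i ≤ v i) (α : σ →₀ ℕ) :
    monoVal w α ≤ monoVal v α :=
  Finset.prod_le_prod' fun i _ => pow_le_pow_left' (h i) _

theorem monoVal_const (r : ℝ≥0∞) (α : σ →₀ ℕ) : monoVal (fun _ => r) α = r ^ α.degree := by
  rw [monoVal, Finsupp.prod, Finset.prod_pow_eq_pow_sum, Finsupp.degree_apply]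

theorem monoVal_ne_zero {w : σ → ℝ≥0∞} (h : ∀ i, w i ≠ 0) (α : σ →₀ ℕ) : monoVal w α ≠ 0 :=
  Finset.prod_ne_zero_iff.2 fun i _ => pow_ne_zero _ (h i)

theorem monoVal_mul (v w : σ → ℝ≥0∞) (α : σ →₀ ℕ) :
    monoVal (fun i => v i * w i) α = monoVal v α * monoVal w α := by
  simp only [monoVal, mul_pow, Finsupp.prod, Finset.prod_mul_distrib]

theorem monoVal_le_of_le_one {v : σ → ℝ≥0∞} (hv : ∀ i, v i ≤ 1) {α : σ →₀ ℕ} {i : σ}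
    (hi : α i ≠ 0) : monoVal v α ≤ v i := by
  classical
  have h1 : α = Finsupp.single i (α i) + α.erase i := (Finsupp.single_add_erase i α).symm
  have h2 : monoVal v (α.erase i) ≤ 1 := Finset.prod_le_one' fun j _ => pow_le_one' (hv j) _
  rw [h1, monoVal_add, monoVal_single]
  exact (mul_le_of_le_one_right' h2).trans (pow_le_of_le_one zero_le (hv i) hi)

/-- The weighted `ℓ¹` norm `∑ |f_α| w^α`. -/
def wnorm (w : σ → ℝ≥0∞) (f : MvPowerSeries σ K) : ℝ≥0∞ :=
  ∑' α : σ →₀ ℕ, ‖coeff α f‖ₑ * monoVal w α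

theorem coeff_le_wnorm (w : σ → ℝ≥0∞) (f : MvPowerSeries σ K) (α : σ →₀ ℕ) :
    ‖coeff α f‖ₑ * monoVal w α ≤ wnorm w f :=
  ENNReal.le_tsum α

theorem wnorm_zero (w : σ → ℝ≥0∞) : wnorm w (0 : MvPowerSeries σ K) = 0 := by
  simp [wnorm]

theorem wnorm_add_le (w : σ → ℝ≥0∞) (f g : MvPowerSeries σ K) :
    wnorm w (f + g) ≤ wnorm w f + wnorm w g := by
  rw [wnorm, wnorm, wnorm, ← ENNReal.tsum_add]
  refine ENNReal.tsum_le_tsum fun α => ?_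
  rw [← add_mul, map_add]
  gcongr
  exact enorm_add_le _ _

theorem wnorm_neg (w : σ → ℝ≥0∞) (f : MvPowerSeries σ K) : wnorm w (-f) = wnorm w f := by
  simp [wnorm]

theorem wnorm_sub_le (w : σ → ℝ≥0∞) (f g : MvPowerSeries σ K) :
    wnorm w (f - g) ≤ wnorm w f + wnorm w g := by
  rw [sub_eq_add_neg, ← wnorm_neg w g]
  exact wnorm_add_le w f (-g)

theorem wnorm_sum_le {ι : Type*} (w : σ → ℝ≥0∞) (S : Finset ι) (f : ι → MvPowerSeries σ K) :
    wnorm w (∑ i ∈ S, f i) ≤ ∑ i ∈ S, wnorm w (f i) := by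
  classical
  induction S using Finset.induction_on with
  | empty => simp [wnorm_zero]
  | insert a S ha ih =>
    rw [Finset.sum_insert ha, Finset.sum_insert ha]
    exact (wnorm_add_le _ _ _).trans (by gcongr)

theorem wnorm_mono {w v : σ → ℝ≥0∞} (h : ∀ i, w i ≤ v i) (f : MvPowerSeries σ K) :
    wnorm w f ≤ wnorm v f :=
  ENNReal.tsum_le_tsum fun α => by gcongr; exact monoVal_mono h α

theorem wnorm_monomial (w : σ → ℝ≥0∞) (β : σ →₀ ℕ) (c : K) :
    wnorm w (monomial β c) = ‖c‖ₑ * monoVal w β := by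
  classical
  rw [wnorm, tsum_eq_single β fun α hα => by rw [coeff_monomial, if_neg hα]; simp]
  simp

/-- Monomial values are multiplicative, so summing over antidiagonals gives the Cauchy product.
Values in [0, ∞] make every rearrangement legitimate. -/
theorem wnorm_mul_le (w : σ → ℝ≥0∞) (f g : MvPowerSeries σ K) :
    wnorm w (f * g) ≤ wnorm w f * wnorm w g := by
  classical
  calc wnorm w (f * g)
      ≤ ∑' α : σ →₀ ℕ, ∑ p ∈ Finset.HasAntidiagonal.antidiagonal α,
          (‖coeff p.1 f‖ₑ * monoVal w p.1) * (‖coeff p.2 g‖ₑ * monoVal w p.2) := by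
        refine ENNReal.tsum_le_tsum fun α => ?_
        rw [coeff_mul]
        calc _ ≤ (∑ p ∈ Finset.HasAntidiagonal.antidiagonal α,
                ‖coeff p.1 f * coeff p.2 g‖ₑ) * monoVal w α := by
              gcongr; exact enorm_sum_le _ _
          _ = _ := by
              rw [Finset.sum_mul]
              refine Finset.sum_congr rfl fun p hp => ?_
              rw [← Finset.HasAntidiagonal.mem_antidiagonal.1 hp, monoVal_add, enorm_mul]
              ring
    _ = ∑' p : (σ →₀ ℕ) × (σ →₀ ℕ),
          (‖coeff p.1 f‖ₑ * monoVal w p.1) * (‖coeff p.2 g‖ₑ * monoVal w p.2) := by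
        rw [← (Finset.HasAntidiagonal.sigmaAntidiagonalEquivProd
          (A := σ →₀ ℕ)).tsum_eq, ENNReal.tsum_sigma']
        refine tsum_congr fun α => ?_
        rw [tsum_fintype]
        exact (Finset.sum_coe_sort (Finset.HasAntidiagonal.antidiagonal α) (fun p =>
          (‖coeff p.1 f‖ₑ * monoVal w p.1) * (‖coeff p.2 g‖ₑ * monoVal w p.2))).symm
    _ = _ := by
        rw [ENNReal.tsum_prod', wnorm, wnorm, ← ENNReal.tsum_mul_right]
        refine tsum_congr fun α => ?_
        dsimp only
        rw [ENNReal.tsum_mul_left]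

theorem wnorm_one (w : σ → ℝ≥0∞) : wnorm w (1 : MvPowerSeries σ K) = 1 := by
  have := wnorm_monomial w 0 (1 : K)
  rw [monoVal_zero] at this
  simpa using this

theorem wnorm_pow_le (w : σ → ℝ≥0∞) (f : MvPowerSeries σ K) (k : ℕ) :
    wnorm w (f ^ k) ≤ wnorm w f ^ k := by
  induction k with
  | zero => simp [wnorm_one]
  | succ k ih =>
    rw [pow_succ, pow_succ]
    exact (wnorm_mul_le _ _ _).trans (by gcongr)

theorem wnorm_finsuppProd_le (w : τ → ℝ≥0∞) (b : σ → MvPowerSeries τ K) (α : σ →₀ ℕ) :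
    wnorm w (α.prod fun i k => b i ^ k) ≤ monoVal (fun i => wnorm w (b i)) α := by
  classical
  rw [monoVal, Finsupp.prod, Finsupp.prod]
  induction α.support using Finset.induction_on with
  | empty => simp [wnorm_one]
  | insert a S ha ih =>
    rw [Finset.prod_insert ha, Finset.prod_insert ha]
    refine (wnorm_mul_le _ _ _).trans ?_
    gcongr
    exact wnorm_pow_le _ _ _

theorem eq_zero_of_wnorm_eq_zero {w : σ → ℝ≥0∞} (hw : ∀ i, w i ≠ 0) {f : MvPowerSeries σ K}
    (h : wnorm w f = 0) : f = 0 := by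
  ext α
  have := ENNReal.tsum_eq_zero.1 h α
  rcases mul_eq_zero.1 this with h | h
  · simpa using h
  · exact absurd h (monoVal_ne_zero hw α)

theorem isConvergent_of_wnorm [Finite σ] {w : σ → ℝ≥0∞} (hw : ∀ i, w i ≠ 0)
    {f : MvPowerSeries σ K} (h : wnorm w f ≠ ⊤) : IsConvergent f := by
  classical
  cases nonempty_fintype σ
  obtain ⟨r, hr0, hr1, hr⟩ : ∃ r : ℝ≥0∞, r ≠ 0 ∧ r ≠ ⊤ ∧ ∀ i, r ≤ w i := by
    -- The meet with 1 keeps the radius finite when there are no variables or all weights are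
    -- infinite.
    refine ⟨(Finset.univ.inf w) ⊓ 1, ?_, ?_, fun i => ?_⟩
    · have h1 : 0 < Finset.univ.inf w :=
        (Finset.lt_inf_iff ENNReal.zero_lt_top).2 fun i _ => pos_iff_ne_zero.2 (hw i)
      exact (lt_min h1 one_pos).ne'
    · exact ne_top_of_le_ne_top ENNReal.one_ne_top inf_le_right
    · exact inf_le_left.trans (Finset.inf_le (Finset.mem_univ i))
  refine ⟨r.toReal, ENNReal.toReal_pos hr0 hr1, (wnorm w f).toReal, fun α => ?_⟩
  have h1 : ‖coeff α f‖ₑ * r ^ α.degree ≤ wnorm w f := by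
    rw [← monoVal_const r α]
    refine le_trans ?_ (coeff_le_wnorm w f α)
    gcongr
    exact monoVal_mono hr α
  have h2 := ENNReal.toReal_mono h h1
  rwa [ENNReal.toReal_mul, ENNReal.toReal_pow, toReal_enorm] at h2

/-- The sum is a product of geometric series, one for each variable; the induction over finite types
proves this factorization. -/
theorem monoVal_tsum_ne_top [Finite σ] :
    ∑' α : σ →₀ ℕ, monoVal (fun _ => (2⁻¹ : ℝ≥0∞)) α ≠ ⊤ := by
  classical
  cases nonempty_fintype σ
  have h : ∑' α : σ →₀ ℕ, monoVal (fun _ => (2⁻¹ : ℝ≥0∞)) α = ∏ _i : σ, ∑' k : ℕ, 2⁻¹ ^ k := by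
    rw [← Finsupp.equivFunOnFinite.symm.tsum_eq]
    have key : ∀ (ι : Type _) [Fintype ι], ∑' a : ι → ℕ, ∏ i, (2⁻¹ : ℝ≥0∞) ^ a i =
        ∏ _i : ι, ∑' k : ℕ, (2⁻¹ : ℝ≥0∞) ^ k := by
      refine fun ι _ => Fintype.induction_empty_option
        (P := fun ι _ => ∑' a : ι → ℕ, ∏ i, (2⁻¹ : ℝ≥0∞) ^ a i =
          ∏ _i : ι, ∑' k : ℕ, (2⁻¹ : ℝ≥0∞) ^ k) ?_ ?_ ?_ ι
      · intro α β _ e ih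
        let _ := Fintype.ofEquiv β e.symm
        rw [← (e.arrowCongr (Equiv.refl ℕ)).tsum_eq]
        simp only [Finset.prod_const, Finset.card_univ] at ih ⊢
        rw [← Fintype.card_congr e, ← ih]
        refine tsum_congr fun a => ?_
        rw [← e.prod_comp]
        simp
      · simp
      · intro α _ ih
        rw [← (Equiv.piOptionEquivProd (β := fun _ => ℕ)).symm.tsum_eq, ENNReal.tsum_prod']
        simp only [Fintype.prod_option]
        rw [← ih, ← ENNReal.tsum_mul_right]
        refine tsum_congr fun k => ?_
        rw [← ENNReal.tsum_mul_left]
        rfl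
    rw [← key]
    refine tsum_congr fun a => ?_
    rw [monoVal, Finsupp.prod_fintype _ _ fun _ => pow_zero _]
    rfl
  rw [h]
  refine ENNReal.prod_ne_top fun i _ => ?_
  rw [ENNReal.tsum_geometric, ENNReal.one_sub_inv_two, inv_inv]
  exact ENNReal.ofNat_ne_top

/-- Halving the radius turns the uniform bound on the terms into a summable one. -/
theorem IsConvergent.exists_wnorm [Finite σ] {f : MvPowerSeries σ K} (hf : IsConvergent f) :
    ∃ r : ℝ≥0∞, r ≠ 0 ∧ r ≠ ⊤ ∧ wnorm (fun _ => r) f ≠ ⊤ := by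
  obtain ⟨r, hr, C, hC⟩ := hf
  refine ⟨2⁻¹ * ENNReal.ofReal r, by simpa using hr, by finiteness, ?_⟩
  have h : wnorm (fun _ => 2⁻¹ * ENNReal.ofReal r) f ≤
      ∑' α : σ →₀ ℕ, ENNReal.ofReal C * monoVal (fun _ => (2⁻¹ : ℝ≥0∞)) α := by
    refine ENNReal.tsum_le_tsum fun α => ?_
    rw [monoVal_const, monoVal_const, mul_pow, mul_left_comm, mul_comm (_ ^ _)]
    gcongr
    rw [← ofReal_norm, ← ENNReal.ofReal_pow hr.le, ← ENNReal.ofReal_mul (norm_nonneg _)]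
    exact ENNReal.ofReal_le_ofReal (hC α)
  rw [ENNReal.tsum_mul_left] at h
  exact ne_top_of_le_ne_top (ENNReal.mul_ne_top ENNReal.ofReal_ne_top monoVal_tsum_ne_top) h

/-- Every monomial that occurs has positive degree and so gains at least one factor c. -/
theorem wnorm_const_mul_le {r c : ℝ≥0∞} (hc : c ≤ 1) {f : MvPowerSeries σ K}
    (hf : constantCoeff f = 0) : wnorm (fun _ => c * r) f ≤ c * wnorm (fun _ => r) f := by
  rw [wnorm, wnorm, ← ENNReal.tsum_mul_left]
  refine ENNReal.tsum_le_tsum fun α => ?_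
  rw [monoVal_const, monoVal_const, mul_pow, mul_left_comm]
  rcases eq_or_ne α 0 with rfl | hα
  · simp [hf]
  · gcongr
    exact pow_le_of_le_one zero_le hc (by rwa [Ne, Finsupp.degree_eq_zero_iff])

/-- A convergent series without constant term has small norms. -/
theorem IsConvergent.exists_wnorm_le [Finite σ] {f : MvPowerSeries σ K} (hf : IsConvergent f)
    (h0 : constantCoeff f = 0) {ε : ℝ≥0∞} (hε : ε ≠ 0) :
    ∃ r : ℝ≥0∞, r ≠ 0 ∧ r ≠ ⊤ ∧ wnorm (fun _ => r) f ≤ ε := by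
  obtain ⟨r, hr0, hr1, hr⟩ := hf.exists_wnorm
  obtain ⟨c, hc0, hc⟩ := ENNReal.exists_pos_mul_lt hr hε
  refine ⟨min c 1 * r, mul_ne_zero (lt_min hc0 one_pos).ne' hr0,
    ENNReal.mul_ne_top (ne_top_of_le_ne_top ENNReal.one_ne_top (min_le_right _ _)) hr1, ?_⟩
  refine (wnorm_const_mul_le (min_le_right _ _) h0).trans (le_trans ?_ hc.le)
  gcongr
  exact min_le_left _ _

/-- A linear contraction for a weighted norm has a resolvent. -/
theorem exists_eq_add_of_contraction [CompleteSpace K] {w : σ → ℝ≥0∞} (hw : ∀ i, w i ≠ 0)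
    (T : MvPowerSeries σ K →ₗ[K] MvPowerSeries σ K) (hT : ∀ h, wnorm w (T h) ≤ 2⁻¹ * wnorm w h)
    (h : MvPowerSeries σ K) (hh : wnorm w h ≠ ⊤) :
    ∃ H, wnorm w H ≠ ⊤ ∧ H = h + T H := by
  have hpow : ∀ k, wnorm w ((T ^ k) h) ≤ 2⁻¹ ^ k * wnorm w h := by
    intro k
    induction k with
    | zero => simp
    | succ k ih =>
      rw [pow_succ', pow_succ', Module.End.mul_apply, mul_assoc]
      exact (hT _).trans (by gcongr)
  have hgeo : ∀ N, ∑' k, (2⁻¹ : ℝ≥0∞) ^ (k + N) * wnorm w h = 2⁻¹ ^ N * (2 * wnorm w h) := by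
    intro N
    have : ∀ k, (2⁻¹ : ℝ≥0∞) ^ (k + N) * wnorm w h = (2⁻¹ ^ N * wnorm w h) * 2⁻¹ ^ k := by
      intro k; rw [pow_add]; ring
    simp_rw [this]
    rw [ENNReal.tsum_mul_left, ENNReal.tsum_geometric, ENNReal.one_sub_inv_two, inv_inv]
    ring
  have hsumm : ∀ α, Summable fun k => coeff α ((T ^ k) h) := by
    intro α
    refine Summable.of_enorm ?_
    have h1 : ∑' k, ‖coeff α ((T ^ k) h)‖ₑ * monoVal w α ≤ 2 * wnorm w h := by
      have := hgeo 0
      simp only [add_zero, pow_zero, one_mul] at this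
      rw [← this]
      exact ENNReal.tsum_le_tsum fun k => (coeff_le_wnorm w _ α).trans (hpow k)
    rw [ENNReal.tsum_mul_right] at h1
    intro htop
    rw [htop, ENNReal.top_mul (monoVal_ne_zero hw α)] at h1
    exact (ENNReal.mul_ne_top ENNReal.ofNat_ne_top hh) (top_le_iff.1 h1)
  -- `R N` is a tail of the Neumann series, summed coefficientwise. T is never interchanged with an
  -- infinite sum: the error of the sought equation equals `R (N + 1) - T (R N)` for every N, and
  -- its norm tends to zero.
  let R : ℕ → MvPowerSeries σ K := fun N α => ∑' k, coeff α ((T ^ (k + N)) h)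
  have hR : ∀ N, wnorm w (R N) ≤ 2⁻¹ ^ N * (2 * wnorm w h) := by
    intro N
    calc wnorm w (R N) ≤ ∑' α, ∑' k, ‖coeff α ((T ^ (k + N)) h)‖ₑ * monoVal w α := by
          refine ENNReal.tsum_le_tsum fun α => ?_
          rw [ENNReal.tsum_mul_right]
          gcongr
          exact enorm_tsum_le_tsum_enorm
      _ = ∑' k, wnorm w ((T ^ (k + N)) h) := ENNReal.tsum_comm
      _ ≤ ∑' k, (2⁻¹ : ℝ≥0∞) ^ (k + N) * wnorm w h := ENNReal.tsum_le_tsum fun k => hpow _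
      _ = _ := hgeo N
  have hsplit : ∀ N, R 0 = ∑ k ∈ Finset.range N, (T ^ k) h + R N := by
    intro N
    ext α
    rw [map_add, map_sum]
    exact ((hsumm α).sum_add_tsum_nat_add N).symm
  have hR0 : wnorm w (R 0) ≠ ⊤ := by
    refine ne_top_of_le_ne_top ?_ (hR 0)
    finiteness
  refine ⟨R 0, hR0, ?_⟩
  rw [← sub_eq_zero]
  refine eq_zero_of_wnorm_eq_zero hw ?_
  have hdiff : ∀ N, R 0 - (h + T (R 0)) = R (N + 1) - T (R N) := by
    intro N
    conv_lhs => rw [hsplit (N + 1)]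
    have : T (∑ k ∈ Finset.range (N + 1), (T ^ k) h + R (N + 1)) =
        T (∑ k ∈ Finset.range N, (T ^ k) h + R N) := by rw [← hsplit, ← hsplit]
    rw [this, map_add, map_sum, Finset.sum_range_succ']
    simp only [pow_succ', Module.End.mul_apply, pow_zero, Module.End.one_apply]
    abel
  have hle : ∀ N, wnorm w (R 0 - (h + T (R 0))) ≤ 2⁻¹ ^ N * (2 * wnorm w h) := by
    intro N
    rw [hdiff N]
    refine (wnorm_sub_le _ _ _).trans ?_
    calc _ ≤ 2⁻¹ ^ (N + 1) * (2 * wnorm w h) + 2⁻¹ * (2⁻¹ ^ N * (2 * wnorm w h)) :=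
          add_le_add (hR _) ((hT _).trans (by gcongr; exact hR N))
      _ = (2⁻¹ + 2⁻¹) * (2⁻¹ ^ N * (2 * wnorm w h)) := by ring
      _ = _ := by rw [ENNReal.inv_two_add_inv_two, one_mul]
  have hlim : Filter.Tendsto (fun N : ℕ => (2⁻¹ : ℝ≥0∞) ^ N * (2 * wnorm w h)) Filter.atTop
      (nhds 0) := by
    have := ENNReal.Tendsto.mul_const (b := 2 * wnorm w h)
      (ENNReal.tendsto_pow_atTop_nhds_zero_of_lt_one (r := 2⁻¹) (by simp)) (Or.inr (by finiteness))
    simpa using this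
  exact le_antisymm (ge_of_tendsto' hlim hle) zero_le

/-- Norm estimate for a substitution. -/
theorem wnorm_subst_le {w : τ → ℝ≥0∞} {v : σ → ℝ≥0∞} {b : σ → MvPowerSeries τ K}
    (hb : HasSubst b) (hv : ∀ i, wnorm w (b i) ≤ v i) (h : MvPowerSeries σ K) :
    wnorm w (subst b h) ≤ wnorm v h := by
  calc wnorm w (subst b h)
      ≤ ∑' e : τ →₀ ℕ, ∑' d : σ →₀ ℕ,
          ‖coeff d h‖ₑ * (‖coeff e (d.prod fun i k => b i ^ k)‖ₑ * monoVal w e) := by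
        refine ENNReal.tsum_le_tsum fun e => ?_
        simp_rw [← mul_assoc]
        rw [ENNReal.tsum_mul_right]
        gcongr
        have hfin := coeff_subst_finite hb h e
        rw [coeff_subst hb, finsum_eq_sum _ hfin]
        refine (enorm_sum_le _ _).trans ?_
        simp_rw [smul_eq_mul, enorm_mul]
        exact ENNReal.sum_le_tsum _
    _ = ∑' d : σ →₀ ℕ, ‖coeff d h‖ₑ * wnorm w (d.prod fun i k => b i ^ k) := by
        rw [ENNReal.tsum_comm]
        refine tsum_congr fun d => ?_
        rw [ENNReal.tsum_mul_left]
        rfl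
    _ ≤ wnorm v h := by
        refine ENNReal.tsum_le_tsum fun d => ?_
        gcongr
        exact (wnorm_finsuppProd_le _ _ _).trans (monoVal_mono hv d)

/-- Without constant terms, the norms of the b_i drop below a radius of convergence of h once the
radii in the new variables are small. -/
theorem IsConvergent.subst [Finite σ] [Finite τ] {b : σ → MvPowerSeries τ K}
    (hb : ∀ i, IsConvergent (b i)) (hb0 : ∀ i, constantCoeff (b i) = 0) {h : MvPowerSeries σ K}
    (hh : IsConvergent h) : IsConvergent (subst b h) := by
  cases nonempty_fintype σ
  obtain ⟨r, hr0, hr1, hr⟩ := hh.exists_wnorm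
  choose ρ hρ0 hρ1 hρ using fun i => (hb i).exists_wnorm_le (hb0 i) hr0
  have hq : Finset.univ.inf ρ ⊓ 1 ≠ 0 := (lt_min ((Finset.lt_inf_iff ENNReal.zero_lt_top).2
    fun i _ => pos_iff_ne_zero.2 (hρ0 i)) one_pos).ne'
  refine isConvergent_of_wnorm (w := fun _ => Finset.univ.inf ρ ⊓ 1) (fun _ => hq)
    (ne_top_of_le_ne_top hr (wnorm_subst_le (hasSubst_of_constantCoeff_zero hb0)
      (fun i => (wnorm_mono (fun _ => ?_) _).trans (hρ i)) h))
  exact inf_le_left.trans (Finset.inf_le (Finset.mem_univ i))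

end Norm

end CurveDeformation

end

noncomputable section

namespace CurveDeformation

open MvPowerSeries
open scoped ENNReal

/-! ### Splitting power series -/

section Split

variable {σ τ K : Type*} [NontriviallyNormedField K]

open Classical in
/-- The quotient by the monomial with exponent `e` of the part of a series with exponents in `S`. -/
def divPart (e : σ →₀ ℕ) (S : Set (σ →₀ ℕ)) : MvPowerSeries σ K →ₗ[K] MvPowerSeries σ K where
  toFun h := fun α => if α + e ∈ S then coeff (α + e) h else 0
  map_add' f g := by
    ext α
    change (if α + e ∈ S then coeff (α + e) (f + g) else 0) =
      (if α + e ∈ S then coeff (α + e) f else 0) + if α + e ∈ S then coeff (α + e) g else 0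
    split_ifs <;> simp
  map_smul' c f := by
    ext α
    change (if α + e ∈ S then coeff (α + e) (c • f) else 0) =
      c * if α + e ∈ S then coeff (α + e) f else 0
    split_ifs <;> simp

theorem coeff_divPart (e : σ →₀ ℕ) (S : Set (σ →₀ ℕ)) [DecidablePred (· ∈ S)]
    (h : MvPowerSeries σ K) (α : σ →₀ ℕ) :
    coeff α (divPart e S h) = if α + e ∈ S then coeff (α + e) h else 0 := by
  have h1 : coeff α (divPart e S h) =
      @ite _ (α + e ∈ S) (Classical.propDecidable _) (coeff (α + e) h) 0 := rfl
  rw [h1]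
  congr

theorem coeff_monomial_mul_divPart {e : σ →₀ ℕ} {S : Set (σ →₀ ℕ)} [DecidablePred (· ∈ S)] (hS : ∀ α ∈ S, e ≤ α)
    (h : MvPowerSeries σ K) (α : σ →₀ ℕ) :
    coeff α (monomial e 1 * divPart e S h) = if α ∈ S then coeff α h else 0 := by
  classical
  rw [coeff_monomial_mul]
  by_cases he : e ≤ α
  · rw [if_pos he, one_mul, coeff_divPart, tsub_add_cancel_of_le he]
  · rw [if_neg he, if_neg fun h' => he (hS α h')]

theorem wnorm_divPart_le (w : σ → ℝ≥0∞) (e : σ →₀ ℕ) (S : Set (σ →₀ ℕ)) (h : MvPowerSeries σ K) :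
    wnorm w (divPart e S h) * monoVal w e ≤ wnorm w h := by
  classical
  rw [wnorm, ← ENNReal.tsum_mul_right]
  refine le_trans (ENNReal.tsum_le_tsum fun α => ?_) (ENNReal.tsum_comp_le_tsum_of_injective
    (add_left_injective e) fun α => ‖coeff α h‖ₑ * monoVal w α)
  rw [coeff_divPart, mul_assoc, ← monoVal_add]
  split_ifs
  · exact le_rfl
  · simp

theorem IsConvergent.divPart [Finite σ] {h : MvPowerSeries σ K} (hh : IsConvergent h)
    (e : σ →₀ ℕ) (S : Set (σ →₀ ℕ)) : IsConvergent (divPart e S h) := by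
  obtain ⟨r, hr0, hr1, hr⟩ := hh.exists_wnorm
  refine isConvergent_of_wnorm (fun _ => hr0) fun htop => ?_
  have := wnorm_divPart_le (fun _ => r) e S h
  rw [htop, ENNReal.top_mul (monoVal_ne_zero (fun _ => hr0) e)] at this
  exact hr (top_le_iff.1 this)

theorem coeff_eq_sum_ite {ι : Type*} [Fintype ι] [DecidableEq ι] (c : (σ →₀ ℕ) → ι)
    (h : MvPowerSeries σ K) (α : σ →₀ ℕ) :
    coeff α h = ∑ i, if c α = i then coeff α h else 0 := by
  rw [Finset.sum_ite_eq]
  simp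

/-- A series is the sum of the parts given by a finite partition of the exponents. -/
theorem eq_sum_monomial_mul_divPart {ι : Type*} [Fintype ι] (c : (σ →₀ ℕ) → ι) (e : ι → σ →₀ ℕ)
    (he : ∀ α, e (c α) ≤ α) (h : MvPowerSeries σ K) :
    h = ∑ i, monomial (e i) 1 * divPart (e i) {α | c α = i} h := by
  classical
  ext α
  rw [map_sum, coeff_eq_sum_ite c h α]
  refine Finset.sum_congr rfl fun i _ => ?_
  rw [coeff_monomial_mul_divPart]
  · simp only [Set.mem_ofPred_eq]
  · rintro β rfl
    exact he β

/-- A convergent series in the variables of a set comes from the ring of convergent series in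
these variables. -/
theorem exists_convergentRename_eq (e : τ ↪ σ) (h : convergentSeries σ K)
    (hs : ∀ α, coeff α h.1 ≠ 0 → ∀ i, α i ≠ 0 → i ∈ Set.range e) :
    ∃ g : convergentSeries τ K, convergentRename e g = h := by
  classical
  refine ⟨⟨fun β => coeff (β.embDomain e) h.1, ?_⟩, Subtype.ext ?_⟩
  · obtain ⟨r, hr, C, hC⟩ := h.2
    refine ⟨r, hr, C, fun β => ?_⟩
    have := hC (β.embDomain e)
    rwa [Finsupp.embDomain_eq_mapDomain, Finsupp.degree_mapDomain,
      ← Finsupp.embDomain_eq_mapDomain] at this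
  · ext α
    change coeff α (MvPowerSeries.rename e _) = _
    by_cases hα : α ∈ Set.range (Finsupp.mapDomain e)
    · obtain ⟨β, rfl⟩ := hα
      rw [← Finsupp.embDomain_eq_mapDomain, MvPowerSeries.coeff_embDomain_rename]
      rfl
    · rw [MvPowerSeries.coeff_rename_eq_zero _ _ hα]
      by_contra hne
      refine hα ?_
      have hr := hs α (Ne.symm hne)
      refine ⟨α.comapDomain e e.injective.injOn, ?_⟩
      exact Finsupp.mapDomain_comapDomain e e.injective α fun i hi =>
        hr i (Finsupp.mem_support_iff.1 hi)

end Split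

/-! ### Substitution of convergent series -/

section Substitution

variable {σ τ υ K : Type*} [Finite σ] [Finite τ] [NontriviallyNormedField K]

/-- Substitution of convergent series without constant term in a convergent series. -/
def convergentSubst (b : σ → convergentSeries τ K) (hb : ∀ i, constantCoeff (b i).1 = 0) :
    convergentSeries σ K →ₐ[K] convergentSeries τ K :=
  ((substAlgHom (hasSubst_of_constantCoeff_zero hb)).comp (convergentSeries σ K).val).codRestrict _
    fun f => by
      change IsConvergent (substAlgHom (hasSubst_of_constantCoeff_zero hb) f.1)
      rw [substAlgHom_apply]
      exact IsConvergent.subst (fun i => (b i).2) hb f.2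

theorem coe_convergentSubst (b : σ → convergentSeries τ K) (hb : ∀ i, constantCoeff (b i).1 = 0)
    (h : convergentSeries σ K) : (convergentSubst b hb h).1 = subst (fun i => (b i).1) h.1 := by
  rw [← substAlgHom_apply (hasSubst_of_constantCoeff_zero hb)]
  rfl

theorem convergentSubst_X (b : σ → convergentSeries τ K) (hb : ∀ i, constantCoeff (b i).1 = 0)
    (i : σ) : convergentSubst b hb (convergentX i) = b i := by
  apply Subtype.ext
  rw [coe_convergentSubst]
  exact subst_X (hasSubst_of_constantCoeff_zero hb) i

theorem constantCoeff_subst_eq {σ τ K : Type*} [Finite σ] [Field K] {b : σ → MvPowerSeries τ K}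
    (hb : ∀ i, constantCoeff (b i) = 0) (h : MvPowerSeries σ K) :
    constantCoeff (subst b h) = constantCoeff h := by
  have hs := hasSubst_of_constantCoeff_zero hb
  have h1 : subst b (h - C (constantCoeff h)) = subst b h - C (constantCoeff h) := by
    rw [subst_sub hs, subst_C]
  have h2 : constantCoeff (subst b (h - C (constantCoeff h))) = 0 :=
    constantCoeff_subst_eq_zero hs hb (by simp)
  rw [h1, map_sub, constantCoeff_C, sub_eq_zero] at h2
  exact h2

end Substitution

/-! ### The ring of convergent series is local -/

section Local

variable {σ K : Type*} [Finite σ] [NontriviallyNormedField K] [CompleteSpace K]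

/-- After scaling, f = 1 - g with g small in norm, and the resolvent of multiplication by g inverts
1 - g. -/
theorem isUnit_convergentSeries {f : convergentSeries σ K} (hf : constantCoeff f.1 ≠ 0) :
    IsUnit f := by
  set c := constantCoeff f.1 with hc
  let g : convergentSeries σ K := 1 - algebraMap K _ c⁻¹ * f
  have hg0 : constantCoeff g.1 = 0 := by
    change constantCoeff (1 - C c⁻¹ * f.1) = 0
    simp [← hc, hf]
  obtain ⟨r, hr0, hr1, hr⟩ := IsConvergent.exists_wnorm_le (ε := 2⁻¹) g.2 hg0 (by simp)
  obtain ⟨H, hH, hH'⟩ := exists_eq_add_of_contraction (w := fun _ : σ => r) (fun _ => hr0)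
    (LinearMap.mulLeft K g.1)
    (fun h => (wnorm_mul_le _ _ _).trans (by gcongr)) 1 (by rw [wnorm_one]; simp)
  let H1 : convergentSeries σ K := ⟨H, isConvergent_of_wnorm (fun _ => hr0) hH⟩
  have h1 : H1 = 1 + g * H1 := Subtype.ext hH'
  refine IsUnit.of_mul_eq_one (algebraMap K _ c⁻¹ * H1) ?_
  have h2 : g = 1 - algebraMap K _ c⁻¹ * f := rfl
  rw [h2] at h1
  linear_combination h1

theorem isUnit_convergentSeries_iff {f : convergentSeries σ K} :
    IsUnit f ↔ constantCoeff f.1 ≠ 0 :=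
  ⟨fun h => ((h.map (convergentSeries σ K).val).map (constantCoeff (σ := σ) (R := K))).ne_zero,
    isUnit_convergentSeries⟩

instance : IsDomain (convergentSeries σ K) :=
  have : IsDomain (MvPowerSeries σ K) := NoZeroDivisors.to_isDomain _
  inferInstance

instance : IsLocalRing (convergentSeries σ K) := by
  refine IsLocalRing.of_nonunits_add fun a b ha hb => ?_
  rw [mem_nonunits_iff, isUnit_convergentSeries_iff, not_not] at *
  change constantCoeff (a.1 + b.1) = 0
  rw [map_add, ha, hb, add_zero]

theorem mem_jacobson_convergentSeries {f : convergentSeries σ K} (hf : constantCoeff f.1 = 0) :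
    f ∈ Ideal.jacobson (⊥ : Ideal (convergentSeries σ K)) := by
  rw [IsLocalRing.jacobson_eq_maximalIdeal _ bot_ne_top, IsLocalRing.mem_maximalIdeal,
    mem_nonunits_iff, isUnit_convergentSeries_iff, not_not]
  exact hf

/-- A convergent series in one variable that vanishes to order `k` is divisible by the `k`-th
power of the variable. -/
theorem exists_eq_X_pow_mul {K : Type*} [NontriviallyNormedField K] {f : convergentSeries Unit K} {k : ℕ}
    (h : ∀ i < k, PowerSeries.coeff i f.1 = 0) :
    ∃ g : convergentSeries Unit K, f = convergentX () ^ k * g ∧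
      ∀ i, PowerSeries.coeff i g.1 = PowerSeries.coeff (i + k) f.1 := by
  refine ⟨⟨divPart (Finsupp.single () k) Set.univ f.1, f.2.divPart _ _⟩, Subtype.ext ?_,
    fun i => ?_⟩
  · change f.1 = MvPowerSeries.X () ^ k * divPart (Finsupp.single () k) Set.univ f.1
    rw [X_pow_eq]
    refine MvPowerSeries.ext fun α => ?_
    rw [coeff_monomial_mul]
    split_ifs with hα
    · rw [coeff_divPart, if_pos (Set.mem_univ _), tsub_add_cancel_of_le hα, one_mul]
    · have h1 : α = Finsupp.single () (α ()) := by ext; simp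
      rw [h1]
      refine h _ ?_
      by_contra hlt
      apply hα
      rw [h1]
      simpa using hlt
  · rw [PowerSeries.coeff, PowerSeries.coeff, coeff_divPart, if_pos (Set.mem_univ _), ← Finsupp.single_add]

theorem convergentX_ne_zero {σ K : Type*} [NontriviallyNormedField K] (i : σ) : (convergentX i : convergentSeries σ K) ≠ 0 := by
  intro h
  have h1 : (X i : MvPowerSeries σ K) = 0 := congrArg Subtype.val h
  have := congrArg (coeff (Finsupp.single i 1)) h1
  simp at this

/-- A nonzero series is a power of the variable times a unit. The instance reduces flatness over
K{s} to torsion-freeness. -/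
instance : IsDiscreteValuationRing (convergentSeries Unit K) := by
  refine IsDiscreteValuationRing.ofHasUnitMulPowIrreducibleFactorization
    ⟨convergentX (), ?_, fun {f} hf => ?_⟩
  · refine ⟨?_, fun {a b} hab => ?_⟩
    · rw [isUnit_convergentSeries_iff, not_not]
      exact constantCoeff_X _
    · by_contra! hcon
      simp only [isUnit_convergentSeries_iff, not_not] at hcon
      have h1 : (PowerSeries.X : PowerSeries K) = a.1 * b.1 := congrArg Subtype.val hab
      have h2 := congrArg (PowerSeries.coeff 1) h1
      rw [PowerSeries.coeff_one_X, PowerSeries.coeff_mul] at h2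
      have h3 : PowerSeries.coeff 0 a.1 = 0 := by
        rw [PowerSeries.coeff_zero_eq_constantCoeff]; exact hcon.1
      have h4 : PowerSeries.coeff 0 b.1 = 0 := by
        rw [PowerSeries.coeff_zero_eq_constantCoeff]; exact hcon.2
      rw [Finset.Nat.antidiagonal_succ] at h2
      simp [h3, h4] at h2
  · have hne : (f.1 : PowerSeries K) ≠ 0 := fun h => hf (Subtype.ext h)
    obtain ⟨g, hg, hg'⟩ := exists_eq_X_pow_mul (f := f) (k := (PowerSeries.order f.1).toNat)
      fun i hi => PowerSeries.coeff_of_lt_order_toNat i hi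
    refine ⟨(PowerSeries.order f.1).toNat, ?_⟩
    have hu : IsUnit g := by
      rw [isUnit_convergentSeries_iff]
      have := hg' 0
      rw [zero_add] at this
      change PowerSeries.constantCoeff g.1 ≠ 0
      rw [← PowerSeries.coeff_zero_eq_constantCoeff_apply, this]
      exact PowerSeries.coeff_order hne
    obtain ⟨u, rfl⟩ := hu
    exact ⟨u, hg.symm⟩

end Local

end CurveDeformation

end

noncomputable section

namespace CurveDeformation

open MvPowerSeries
open scoped ENNReal

/-! ### A finiteness theorem -/

section Finiteness

variable {σ τ K : Type*} [Finite σ] [NontriviallyNormedField K]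

theorem exists_common_radius {ι : Type*} [Finite ι] (E : ι → MvPowerSeries σ K)
    (hE : ∀ j, IsConvergent (E j)) :
    ∃ r : ℝ≥0∞, r ≠ 0 ∧ r ≠ ⊤ ∧ ∀ j, wnorm (fun _ => r) (E j) ≠ ⊤ := by
  cases nonempty_fintype ι
  choose ρ h0 h1 h2 using fun j => (hE j).exists_wnorm
  refine ⟨Finset.univ.inf ρ ⊓ 1, (lt_min ((Finset.lt_inf_iff ENNReal.zero_lt_top).2
    fun i _ => pos_iff_ne_zero.2 (h0 i)) one_pos).ne',
    ne_top_of_le_ne_top ENNReal.one_ne_top inf_le_right, fun j => ?_⟩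
  exact ne_top_of_le_ne_top (h2 j) (wnorm_mono (fun _ => inf_le_left.trans
    (Finset.inf_le (Finset.mem_univ j))) _)

/-- Radii for which finitely many series, every monomial of which involves a variable from `Y` or
has degree greater than `p`, are small against the `p`-th power of the radii outside `Y`. -/
theorem exists_adapted_radii {ι : Type*} [Finite ι] (Y : Set σ) {p : ℕ}
    (E : ι → MvPowerSeries σ K) (hE : ∀ j, IsConvergent (E j))
    (hE' : ∀ j α, coeff α (E j) ≠ 0 → (∃ i ∈ Y, α i ≠ 0) ∨ p < α.degree)
    (h : MvPowerSeries σ K) (hh : IsConvergent h) {κ : ℝ≥0∞} (hκ : κ ≠ 0) :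
    ∃ w : σ → ℝ≥0∞, (∀ i, w i ≠ 0) ∧ wnorm w h ≠ ⊤ ∧
      ∀ j, ∀ i ∉ Y, wnorm w (E j) ≤ κ * w i ^ p := by
  classical
  cases nonempty_fintype ι
  obtain ⟨r, hr0, hr1, hr⟩ := exists_common_radius (fun o : Option ι => o.elim h E)
    (by rintro (_ | j) <;> simp [hh, hE])
  set S := ∑ j, wnorm (fun _ => r) (E j) with hS
  have hStop : S ≠ ⊤ := ENNReal.sum_ne_top.2 fun j _ => hr (some j)
  obtain ⟨c', hc'0, hc'⟩ := ENNReal.exists_pos_mul_lt hStop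
    (mul_ne_zero hκ (pow_ne_zero p hr0))
  set c := min c' 1 with hc
  have hc0 : c ≠ 0 := (lt_min hc'0 one_pos).ne'
  have hc1 : c ≤ 1 := min_le_right _ _
  have hcS : c * S ≤ κ * r ^ p := le_trans (by gcongr; exact min_le_left _ _) hc'.le
  -- Each monomial of `E j` shrinks by at least c^(p+1), through one variable of Y or through its
  -- degree, whereas the p-th power of a radius outside Y shrinks only by c^p. The spare factor c
  -- absorbs the norms of all `E j`.
  let v : σ → ℝ≥0∞ := fun i => if i ∈ Y then c ^ (p + 1) else c
  have hv1 : ∀ i, v i ≤ c := fun i => by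
    simp only [v]
    split_ifs
    · exact pow_le_of_le_one zero_le hc1 (Nat.succ_ne_zero p)
    · exact le_rfl
  have hv0 : ∀ i, v i ≠ 0 := fun i => by
    simp only [v]
    split_ifs
    · exact pow_ne_zero _ hc0
    · exact hc0
  refine ⟨fun i => v i * r, fun i => mul_ne_zero (hv0 i) hr0, ?_, fun j i hi => ?_⟩
  · exact ne_top_of_le_ne_top (hr none)
      (wnorm_mono (fun i => mul_le_of_le_one_left' ((hv1 i).trans hc1)) _)
  · have h1 : wnorm (fun i => v i * r) (E j) ≤ c ^ (p + 1) * wnorm (fun _ => r) (E j) := by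
      rw [wnorm, wnorm, ← ENNReal.tsum_mul_left]
      refine ENNReal.tsum_le_tsum fun α => ?_
      rw [monoVal_mul v fun _ => r, mul_left_comm]
      by_cases hα : coeff α (E j) = 0
      · simp [hα]
      gcongr
      rcases hE' j α hα with ⟨i, hi, hαi⟩ | hlt
      · refine (monoVal_le_of_le_one (fun i => (hv1 i).trans hc1) hαi).trans ?_
        simp [v, hi]
      · refine (monoVal_mono hv1 α).trans ?_
        rw [monoVal_const]
        exact pow_le_pow_right_of_le_one' hc1 hlt
    refine h1.trans ?_
    have h2 : wnorm (fun _ => r) (E j) ≤ S :=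
      Finset.single_le_sum (f := fun j => wnorm (fun _ => r) (E j)) (fun _ _ => zero_le)
        (Finset.mem_univ j)
    calc c ^ (p + 1) * wnorm (fun _ => r) (E j) ≤ c ^ p * (c * S) := by
          rw [pow_succ, mul_assoc]; gcongr
      _ ≤ c ^ p * (κ * r ^ p) := by gcongr
      _ = κ * (v i * r) ^ p := by simp only [v, if_neg hi]; ring

variable [CompleteSpace K]

/-- Simultaneous division by the series `z_j ^ p - E_j`, where `z_j` runs through the variables
outside the range of `e`. -/
theorem exists_division (e : τ ↪ σ) {p : ℕ} (E : σ → convergentSeries σ K)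
    (hE : ∀ j ∉ Set.range e, ∀ α, coeff α (E j).1 ≠ 0 →
      (∃ i ∈ Set.range e, α i ≠ 0) ∨ p < α.degree) (h : convergentSeries σ K) :
    ∃ (B L : convergentSeries σ K),
      B ∈ Ideal.span {x | ∃ j ∉ Set.range e, x = convergentX j ^ p - E j} ∧
      (∀ α, coeff α L.1 ≠ 0 → ∀ j ∉ Set.range e, α j < p) ∧ h = L + B := by
  classical
  let Z := {j : σ // j ∉ Set.range e}
  have : Fintype Z := Fintype.ofFinite Z
  -- The summands of T, one for each member of Z, then have total norm at most 1/2; the added 1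
  -- covers empty Z.
  set κ : ℝ≥0∞ := 2⁻¹ * (Fintype.card Z + 1 : ℝ≥0∞)⁻¹ with hκ
  have hκ0 : κ ≠ 0 := mul_ne_zero (by simp) (by simp)
  obtain ⟨w, hw0, hwh, hwE⟩ := exists_adapted_radii (p := p) (Set.range e)
    (fun j : Z => (E j.1).1) (fun j => (E j.1).2) (fun j => hE j.1 j.2) h.1 h.2 hκ0
  -- Each exponent is assigned to one variable whose p-th power divides the monomial; the class
  -- `none` holds the reduced monomials.
  let c : (σ →₀ ℕ) → Option Z := fun α =>
    if hα : ∃ j : Z, p ≤ α j.1 then some hα.choose else none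
  have hc : ∀ α j, c α = some j → p ≤ α j.1 := by
    intro α j hj
    simp only [c] at hj
    split_ifs at hj with hα
    cases hj
    exact hα.choose_spec
  have hcn : ∀ α, c α = none → ∀ j : Z, α j.1 < p := by
    intro α hα j
    simp only [c] at hα
    split_ifs at hα with h'
    push Not at h'
    exact h' j
  let D : Z → MvPowerSeries σ K →ₗ[K] MvPowerSeries σ K := fun j =>
    divPart (Finsupp.single j.1 p) {α | c α = some j}
  -- T rewrites z_j^p as E_j in every reducible monomial. If H = h + T H and L is the reduced part
  -- of H, then h = L + ∑ D_j(H) (z_j^p - E_j).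
  let T : MvPowerSeries σ K →ₗ[K] MvPowerSeries σ K :=
    ∑ j : Z, (LinearMap.mulRight K (E j.1).1) ∘ₗ D j
  have hTapp : ∀ g, T g = ∑ j : Z, D j g * (E j.1).1 := fun g => by
    simp [T, LinearMap.sum_apply]
  have hT : ∀ g, wnorm w (T g) ≤ 2⁻¹ * wnorm w g := by
    intro g
    rw [hTapp]
    refine (wnorm_sum_le _ _ _).trans ?_
    calc ∑ j : Z, wnorm w (D j g * (E j.1).1) ≤ ∑ _j : Z, κ * wnorm w g := by
          refine Finset.sum_le_sum fun j _ => (wnorm_mul_le _ _ _).trans ?_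
          calc _ ≤ wnorm w (D j g) * (κ * w j.1 ^ p) := by gcongr; exact hwE j j.1 j.2
            _ = κ * (wnorm w (D j g) * monoVal w (Finsupp.single j.1 p)) := by
              rw [monoVal_single]; ring
            _ ≤ κ * wnorm w g := by gcongr; exact wnorm_divPart_le _ _ _ _
      _ = (Fintype.card Z * κ) * wnorm w g := by
          rw [Finset.sum_const, nsmul_eq_mul, Finset.card_univ, ← mul_assoc]
      _ ≤ 2⁻¹ * wnorm w g := by
          gcongr
          rw [hκ, mul_left_comm]
          refine mul_le_of_le_one_right' ?_
          rw [← div_eq_mul_inv]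
          exact ENNReal.div_le_of_le_mul (by rw [one_mul]; exact le_self_add)
  obtain ⟨H, hH, hHT⟩ := exists_eq_add_of_contraction hw0 T hT h.1 hwh
  have hHc : IsConvergent H := isConvergent_of_wnorm hw0 hH
  let H1 : convergentSeries σ K := ⟨H, hHc⟩
  let L : convergentSeries σ K := ⟨divPart 0 {α | c α = none} H, hHc.divPart _ _⟩
  let D1 : Z → convergentSeries σ K := fun j => ⟨D j H, hHc.divPart _ _⟩
  refine ⟨∑ j : Z, D1 j * (convergentX j.1 ^ p - E j.1), L, ?_, ?_, ?_⟩
  · exact sum_mem fun j _ => Ideal.mul_mem_left _ _ (Ideal.subset_span ⟨j.1, j.2, rfl⟩)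
  · intro α hα j hj
    have h1 : coeff α L.1 = if α + 0 ∈ {α | c α = none} then coeff (α + 0) H else 0 :=
      coeff_divPart _ _ _ _
    rw [h1, add_zero] at hα
    split_ifs at hα with h2
    · exact hcn α h2 ⟨j, hj⟩
    · exact absurd rfl hα
  · have h1 := eq_sum_monomial_mul_divPart c
      (fun o => o.elim 0 fun j => Finsupp.single j.1 p) (fun α => ?_) H
    · rw [Fintype.sum_option] at h1
      have h2 : H1 = L + ∑ j : Z, convergentX j.1 ^ p * D1 j := by
        apply Subtype.ext
        have h4 : ∀ j : Z, (monomial (Finsupp.single j.1 p) (1 : K)) = X j.1 ^ p := fun j => by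
          rw [X_pow_eq]
        have h3 : (L + ∑ j : Z, convergentX j.1 ^ p * D1 j).1 =
            L.1 + ∑ j : Z, X j.1 ^ p * D j H := by
          simp [L, D1, convergentX, AddSubmonoidClass.coe_finsetSum]
        rw [h3]
        refine h1.trans ?_
        congr 1
        · exact one_mul _
        · exact Finset.sum_congr rfl fun j _ => congrArg (· * D j H) (h4 j)
      have h3 : H1 = h + ∑ j : Z, D1 j * E j.1 := by
        apply Subtype.ext
        refine hHT.trans ?_
        rw [hTapp]
        simp [D1, AddSubmonoidClass.coe_finsetSum]
      have h4 : h = H1 - ∑ j : Z, D1 j * E j.1 := by rw [h3]; ring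
      rw [h4, h2]
      simp only [mul_sub, Finset.sum_sub_distrib]
      rw [add_sub_assoc]
      congr 2
      exact Finset.sum_congr rfl fun j _ => mul_comm _ _
    · match hα : c α with
      | none => exact zero_le
      | some j => exact Finsupp.single_le_iff.2 (hc α j hα)

/-- A series of bounded degree in the variables outside the range of `e` is a combination of
finitely many monomials with coefficients in the other variables. -/
theorem exists_eq_sum_rename_mul {σ τ K : Type*} [Finite σ] [NontriviallyNormedField K] (e : τ ↪ σ) (p : ℕ) :
    ∃ S : Finset (σ →₀ ℕ), (∀ β ∈ S, ∀ i ∈ Set.range e, β i = 0) ∧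
      ∀ L : convergentSeries σ K,
        (∀ α, coeff α L.1 ≠ 0 → ∀ j ∉ Set.range e, α j < p) →
        ∃ H : (σ →₀ ℕ) → convergentSeries τ K,
          L = ∑ β ∈ S,
            convergentRename e (H β) * convergentOfPoly (MvPolynomial.monomial β 1) := by
  classical
  -- The terms of L are collected by their exponents outside the range of e, of which only finitely
  -- many occur.
  let q : (σ →₀ ℕ) → (σ →₀ ℕ) := fun α => α.filter fun j => j ∉ Set.range e
  let S : Finset (σ →₀ ℕ) := {β ∈ Finset.Iic (Finsupp.equivFunOnFinite.symm fun _ => p) |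
    ∀ i ∈ Set.range e, β i = 0}
  refine ⟨S, fun β hβ => (Finset.mem_filter.1 hβ).2, fun L hL => ?_⟩
  let P : (σ →₀ ℕ) → convergentSeries σ K := fun β =>
    ⟨divPart β {α | q α = β} L.1, L.2.divPart _ _⟩
  have hP : ∀ β, ∃ g : convergentSeries τ K, convergentRename e g = P β := by
    intro β
    refine exists_convergentRename_eq e (P β) fun α hα i hi => ?_
    by_contra hie
    have h1 : coeff α (P β).1 = if α + β ∈ {α | q α = β} then coeff (α + β) L.1 else 0 :=
      coeff_divPart _ _ _ _
    rw [h1] at hα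
    split_ifs at hα with h2
    · have h3 : (q (α + β)) i = β i := by rw [show q (α + β) = β from h2]
      simp only [q, Finsupp.filter_apply, if_pos hie, Finsupp.add_apply] at h3
      omega
    · exact hα rfl
  choose H hH using hP
  refine ⟨H, Subtype.ext ?_⟩
  have hcoe : (∑ β ∈ S, convergentRename e (H β) *
      convergentOfPoly (MvPolynomial.monomial β (1 : K))).1 =
      ∑ β ∈ S, divPart β {α | q α = β} L.1 * monomial β 1 := by
    simp [hH, P, convergentOfPoly, AddSubmonoidClass.coe_finsetSum]
  rw [hcoe]
  ext α
  rw [map_sum]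
  have hterm : ∀ β ∈ S, coeff α (divPart β {α | q α = β} L.1 * monomial β 1) =
      if q α = β then coeff α L.1 else 0 := by
    intro β _
    rw [mul_comm, coeff_monomial_mul_divPart]
    · rfl
    · rintro γ rfl
      intro i
      simp only [q, Finsupp.filter_apply]
      split_ifs <;> simp
  rw [Finset.sum_congr rfl hterm, Finset.sum_ite_eq]
  split_ifs with hS
  · rfl
  · by_contra hne
    apply hS
    refine Finset.mem_filter.2 ⟨Finset.mem_Iic.2 fun i => ?_, fun i hi => ?_⟩
    · simp only [q, Finsupp.filter_apply]
      split_ifs with hi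
      · exact Nat.zero_le _
      · exact (hL α hne i hi).le
    · simp only [q, Finsupp.filter_apply]
      rw [if_neg (not_not.2 hi)]

/-- If `B` is a quotient of a ring of convergent series in which every variable outside the range
of `e` satisfies `z ^ p = E`, then a set that generates `B` modulo the maximal ideal of the
ring of convergent series in the variables from the range of `e` generates `B`. -/
theorem span_eq_top_of_division [Finite τ] {B : Type*} [CommRing B] [Algebra (convergentSeries τ K) B]
    (e : τ ↪ σ) (φ : convergentSeries σ K →+* B) (hφ : Function.Surjective φ)
    (hφe : ∀ g, φ (convergentRename e g) = algebraMap _ B g) {p : ℕ}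
    (E : σ → convergentSeries σ K)
    (hE : ∀ j ∉ Set.range e, ∀ α, coeff α (E j).1 ≠ 0 →
      (∃ i ∈ Set.range e, α i ≠ 0) ∨ p < α.degree)
    (hφE : ∀ j ∉ Set.range e, φ (convergentX j) ^ p = φ (E j)) (S : Set B)
    (hS : ∀ β : σ →₀ ℕ, (∀ i ∈ Set.range e, β i = 0) →
      φ (convergentOfPoly (MvPolynomial.monomial β 1)) ∈ Submodule.span (convergentSeries τ K) S ⊔
        Ideal.jacobson (⊥ : Ideal (convergentSeries τ K)) •
          (⊤ : Submodule (convergentSeries τ K) B)) :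
    Submodule.span (convergentSeries τ K) S = ⊤ := by
  classical
  have hrep : ∀ b : B, ∃ L : convergentSeries σ K,
      (∀ α, coeff α L.1 ≠ 0 → ∀ j ∉ Set.range e, α j < p) ∧ b = φ L := by
    intro b
    obtain ⟨h, rfl⟩ := hφ b
    obtain ⟨A, L, hA, hL, rfl⟩ := exists_division e E hE h
    refine ⟨L, hL, ?_⟩
    have : φ A = 0 := by
      have hle : Ideal.span {x | ∃ j ∉ Set.range e, x = convergentX j ^ p - E j} ≤
          RingHom.ker φ := by
        rw [Ideal.span_le]
        rintro _ ⟨j, hj, rfl⟩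
        change φ _ = 0
        rw [map_sub, map_pow, hφE j hj, sub_self]
      exact hle hA
    rw [map_add, this, add_zero]
  obtain ⟨S', hS', hsum⟩ := exists_eq_sum_rename_mul (K := K) e p
  have hmem : ∀ (N : Submodule (convergentSeries τ K) B),
      (∀ β ∈ S', φ (convergentOfPoly (MvPolynomial.monomial β 1)) ∈ N) → ⊤ ≤ N := by
    rintro N hN b -
    obtain ⟨L, hL, rfl⟩ := hrep b
    obtain ⟨H, hH⟩ := hsum L hL
    rw [hH, map_sum]
    refine sum_mem fun β hβ => ?_
    rw [map_mul, hφe, ← Algebra.smul_def]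
    exact N.smul_mem _ (hN β hβ)
  -- Division gives finite generation by the reduced monomials; only then does Nakayama's lemma
  -- allow the passage to S.
  have hfg : (⊤ : Submodule (convergentSeries τ K) B).FG := by
    refine ⟨S'.image fun β => φ (convergentOfPoly (MvPolynomial.monomial β 1)), ?_⟩
    rw [eq_top_iff]
    exact hmem _ fun β hβ => Submodule.subset_span
      (Finset.mem_coe.2 (Finset.mem_image_of_mem _ hβ))
  rw [eq_top_iff]
  exact Submodule.le_of_le_smul_of_le_jacobson_bot hfg le_rfl
    (hmem _ fun β hβ => hS β (hS' β hβ))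

/-- The statement of `span_eq_top_of_division` in terms of a finite family of elements. -/
theorem exists_eq_sum_of_division [Finite τ] {B ι : Type*} [CommRing B] [Fintype ι]
    (e : τ ↪ σ) (φ : convergentSeries σ K →+* B) (hφ : Function.Surjective φ) {p : ℕ}
    (E : σ → convergentSeries σ K)
    (hE : ∀ j ∉ Set.range e, ∀ α, coeff α (E j).1 ≠ 0 →
      (∃ i ∈ Set.range e, α i ≠ 0) ∨ p < α.degree)
    (hφE : ∀ j ∉ Set.range e, φ (convergentX j) ^ p = φ (E j)) (y : ι → B)
    (hy : ∀ β : σ →₀ ℕ, (∀ i ∈ Set.range e, β i = 0) →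
      ∃ (H : ι → convergentSeries τ K) (g : convergentSeries τ K) (b : B),
        constantCoeff g.1 = 0 ∧ φ (convergentOfPoly (MvPolynomial.monomial β 1)) =
          ∑ i, φ (convergentRename e (H i)) * y i + φ (convergentRename e g) * b) (b : B) :
    ∃ H : ι → convergentSeries τ K, b = ∑ i, φ (convergentRename e (H i)) * y i := by
  let _ : Algebra (convergentSeries τ K) B := (φ.comp (convergentRename e).toRingHom).toAlgebra
  have hsmul : ∀ (g : convergentSeries τ K) (b : B), φ (convergentRename e g) * b = g • b :=
    fun g b => (Algebra.smul_def g b).symm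
  have htop := span_eq_top_of_division e φ hφ (fun _ => rfl) E hE hφE (Set.range y)
    fun β hβ => by
      obtain ⟨H, g, b, hg, h⟩ := hy β hβ
      rw [h]
      refine Submodule.add_mem_sup (sum_mem fun i _ => ?_) ?_
      · rw [hsmul]
        exact Submodule.smul_mem _ _ (Submodule.subset_span ⟨i, rfl⟩)
      · rw [hsmul]
        exact Submodule.smul_mem_smul (mem_jacobson_convergentSeries hg) trivial
  obtain ⟨H, hH⟩ := (Submodule.mem_span_range_iff_exists_fun _).1
    (show b ∈ Submodule.span (convergentSeries τ K) (Set.range y) by rw [htop]; trivial)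
  refine ⟨H, ?_⟩
  rw [← hH]
  exact Finset.sum_congr rfl fun i _ => (hsmul _ _).symm

end Finiteness

/-- A homomorphism from a Dedekind domain for which the target is torsion free is flat. -/
theorem flat_of_isTorsionFree {R B : Type*} [CommRing R] [IsDedekindDomain R] [CommRing B]
    (g : R →+* B) (hg : ∀ r ≠ 0, ∀ x y, g r * x = g r * y → x = y) : g.Flat := by
  let _ : Algebra R B := g.toAlgebra
  have : Module.IsTorsionFree R B :=
    ⟨fun r hr x y hxy => hg r hr.ne_zero x y
      (((Algebra.smul_def r x).symm.trans hxy).trans (Algebra.smul_def r y))⟩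
  change Module.Flat R B
  infer_instance

end CurveDeformation

end

noncomputable section

namespace CurveDeformation

open MvPowerSeries
open scoped ENNReal

/-! ### Substitution, renaming of variables, and polynomials as convergent series -/

section Rename

variable {σ τ υ K : Type*} [NontriviallyNormedField K]

theorem convergentSubst_rename [Finite σ] [Finite τ] [Finite υ] (b : σ → convergentSeries τ K)
    (hb : ∀ i, constantCoeff (b i).1 = 0) (e : υ ↪ σ) (h : convergentSeries υ K) :
    convergentSubst b hb (convergentRename e h) =
      convergentSubst (fun i => b (e i)) (fun i => hb (e i)) h := by
  apply Subtype.ext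
  rw [coe_convergentSubst, coe_convergentSubst]
  change subst _ (MvPowerSeries.rename e h.1) = _
  rw [rename_eq_subst, subst_comp_subst_apply (HasSubst.X_comp _)
    (hasSubst_of_constantCoeff_zero hb)]
  congr 1
  funext i
  exact subst_X (hasSubst_of_constantCoeff_zero hb) _

theorem constantCoeff_convergentX (i : σ) :
    constantCoeff (convergentX i : convergentSeries σ K).1 = 0 :=
  constantCoeff_X i

theorem convergentSubst_X_eq [Finite σ] (h : convergentSeries σ K) :
    convergentSubst convergentX constantCoeff_convergentX h = h := by
  apply Subtype.ext
  rw [coe_convergentSubst]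
  exact congrFun subst_self h.1

theorem convergentOfPoly_eq_aeval (p : MvPolynomial σ K) : convergentOfPoly p =
    MvPolynomial.aeval (fun i => (convergentX i : convergentSeries σ K)) p := by
  induction p using MvPolynomial.induction_on with
  | C a => rw [MvPolynomial.aeval_C]; exact Subtype.ext (MvPolynomial.coe_C a)
  | add p q hp hq =>
    rw [map_add, ← hp, ← hq]
    exact Subtype.ext (MvPolynomial.coe_add p q)
  | mul_X p i hp =>
    rw [map_mul, ← hp, MvPolynomial.aeval_X]
    exact Subtype.ext ((MvPolynomial.coe_mul p (MvPolynomial.X i)).trans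
      (congrArg _ (MvPolynomial.coe_X i)))

end Rename

namespace Deformation

/-! ### Orders of monomials in ξ' and the semigroup Γ -/

section Basic

variable {K : Type*} [Field K] {n : ℕ} (D : Deformation K n)

/-- The monomial `ξ'^α`. -/
def xiOneMonomial (α : Fin n →₀ ℕ) : PowerSeries K := α.prod fun j k => D.xiOne j ^ k

theorem xiOne_eq (j : Fin n) : D.xiOne j = PowerSeries.X ^ D.ell j +
    (D.tail j).sum fun i c => PowerSeries.C c * PowerSeries.X ^ i := by
  rw [xiOne, xi, map_add, map_pow, MvPolynomial.aeval_X, map_finsuppSum]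
  congr 1
  refine Finsupp.sum_congr fun i _ => ?_
  simp

/-- Allowing every natural k below the gap, instead of the gap itself, covers infinite gaps as well.
-/
theorem xiOne_eq_mul (j : Fin n) {k : ℕ} (hk : (k : ℕ∞) ≤ D.gap j) :
    ∃ v : PowerSeries K, D.xiOne j = PowerSeries.X ^ D.ell j * (1 + PowerSeries.X ^ k * v) := by
  refine ⟨(D.tail j).sum fun i c => PowerSeries.C c * PowerSeries.X ^ (i - (D.ell j + k)), ?_⟩
  rw [xiOne_eq, mul_add, mul_one, ← mul_assoc, ← pow_add, Finsupp.mul_sum]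
  congr 1
  refine Finsupp.sum_congr fun i hi => ?_
  have h1 : D.ell j + k ≤ i := by
    have := (add_le_add_right hk _).trans (D.le_of_tail_ne_zero j i (Finsupp.mem_support_iff.1 hi))
    exact_mod_cast this
  rw [mul_left_comm, ← pow_add, Nat.add_sub_cancel' h1]

theorem one_le_gap (j : Fin n) : ((1 : ℕ) : ℕ∞) ≤ D.gap j := by
  rw [Nat.cast_one]
  exact Order.one_le_iff_ne_zero.2 (D.gap_ne_zero j)

/-- The series in 1 + t^k K⟦t⟧ are closed under products. With k = 1 this gives the leading term of
ξ'^α, with k up to δ the cancellation in a binomial. -/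
theorem xiOneMonomial_eq_mul (α : Fin n →₀ ℕ) {k : ℕ} (hk : ∀ j, (k : ℕ∞) ≤ D.gap j) :
    ∃ v : PowerSeries K, D.xiOneMonomial α =
      PowerSeries.X ^ Finsupp.weight D.ell α * (1 + PowerSeries.X ^ k * v) := by
  induction α using Finsupp.induction_linear with
  | zero => exact ⟨0, by simp [xiOneMonomial]⟩
  | add f g hf hg =>
    obtain ⟨v, hv⟩ := hf
    obtain ⟨u, hu⟩ := hg
    refine ⟨v + u + PowerSeries.X ^ k * v * u, ?_⟩
    rw [xiOneMonomial, Finsupp.prod_add_index' (fun _ => pow_zero _) fun _ _ _ => pow_add _ _ _]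
    rw [xiOneMonomial] at hv hu
    rw [hv, hu, map_add, pow_add]
    ring
  | single j a =>
    rw [xiOneMonomial, Finsupp.prod_single_index (h := fun j k => D.xiOne j ^ k) (pow_zero _)]
    obtain ⟨v, hv⟩ := D.xiOne_eq_mul j (hk j)
    have h1 : ∀ a : ℕ, ∃ w, (1 + PowerSeries.X ^ k * v) ^ a = 1 + PowerSeries.X ^ k * w := by
      intro a
      induction a with
      | zero => exact ⟨0, by simp⟩
      | succ a ih =>
        obtain ⟨w, hw⟩ := ih
        exact ⟨w + v + PowerSeries.X ^ k * w * v, by rw [pow_succ, hw]; ring⟩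
    obtain ⟨w, hw⟩ := h1 a
    refine ⟨w, ?_⟩
    rw [hv, mul_pow, hw, ← pow_mul, Finsupp.weight_single, smul_eq_mul, mul_comm a]

theorem coeff_xiOneMonomial_self (α : Fin n →₀ ℕ) :
    PowerSeries.coeff (Finsupp.weight D.ell α) (D.xiOneMonomial α) = 1 := by
  obtain ⟨v, hv⟩ := D.xiOneMonomial_eq_mul α D.one_le_gap
  rw [hv, PowerSeries.coeff_X_pow_mul', if_pos le_rfl]
  simp

theorem coeff_xiOneMonomial_of_lt (α : Fin n →₀ ℕ) {i : ℕ} (hi : i < Finsupp.weight D.ell α) :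
    PowerSeries.coeff i (D.xiOneMonomial α) = 0 := by
  obtain ⟨v, hv⟩ := D.xiOneMonomial_eq_mul α D.one_le_gap
  rw [hv, PowerSeries.coeff_X_pow_mul', if_neg (not_le.2 hi)]

theorem order_xiOneMonomial (α : Fin n →₀ ℕ) :
    (D.xiOneMonomial α).order = Finsupp.weight D.ell α := by
  rw [PowerSeries.order_eq_nat]
  exact ⟨by simp [D.coeff_xiOneMonomial_self α], fun i hi => D.coeff_xiOneMonomial_of_lt α hi⟩

theorem mem_semigroup_iff {k : ℕ} :
    k ∈ D.semigroup ↔ ∃ α : Fin n →₀ ℕ, Finsupp.weight D.ell α = k := by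
  constructor
  · intro hk
    induction hk using AddSubmonoid.closure_induction with
    | mem x hx =>
      obtain ⟨j, rfl⟩ := hx
      exact ⟨Finsupp.single j 1, by simp [Finsupp.weight_single]⟩
    | zero => exact ⟨0, map_zero _⟩
    | add x y _ _ hx hy =>
      obtain ⟨α, rfl⟩ := hx
      obtain ⟨β, rfl⟩ := hy
      exact ⟨α + β, map_add _ _ _⟩
  · rintro ⟨α, rfl⟩
    rw [Finsupp.weight_apply]
    exact sum_mem fun j _ => AddSubmonoid.nsmul_mem _
      (AddSubmonoid.subset_closure (Set.mem_range_self j)) _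

/-- Existence of a conductor: a numerical semigroup with coprime generators contains all large
integers. -/
theorem exists_weight_eq_of_ge (hgcd : Finset.univ.gcd D.ell = 1) :
    ∃ c, ∀ k ≥ c, ∃ α : Fin n →₀ ℕ, Finsupp.weight D.ell α = k := by
  obtain ⟨c, hc⟩ := Nat.exists_mem_closure_of_ge (Set.range D.ell)
  refine ⟨c, fun k hk => D.mem_semigroup_iff.1 (hc k hk ?_)⟩
  have h1 : Nat.setGcd (Set.range D.ell) ∣ Finset.univ.gcd D.ell :=
    Finset.dvd_gcd fun j _ => Nat.setGcd_dvd_of_mem (Set.mem_range_self j)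
  rw [hgcd] at h1
  exact h1.trans (one_dvd _)

theorem xiOne_constantCoeff (j : Fin n) :
    constantCoeff (D.xiOne j : MvPowerSeries Unit K) = 0 := by
  obtain ⟨v, hv⟩ := D.xiOne_eq_mul j (D.one_le_gap j)
  change PowerSeries.constantCoeff (D.xiOne j) = 0
  rw [hv]
  simp [(D.ell_pos j).ne']

end Basic

/-! ### Lifting members of the curve ring with control of the weighted order -/

section Values

variable {K : Type*} [NontriviallyNormedField K] {n : ℕ} (D : Deformation K n)

theorem isConvergent_xiOne (j : Fin n) : IsConvergent (D.xiOne j : MvPowerSeries Unit K) := by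
  rw [xiOne_eq]
  change _ ∈ convergentSeries Unit K
  have hX : (PowerSeries.X : PowerSeries K) ∈ convergentSeries Unit K := isConvergent_monomial _ _
  have hC : ∀ c : K, (PowerSeries.C c : PowerSeries K) ∈ convergentSeries Unit K :=
    fun c => isConvergent_monomial _ _
  exact add_mem (pow_mem hX _) (sum_mem fun i _ => mul_mem (hC _) (pow_mem hX _))

/-- `ξ'_j` as a convergent series. -/
def xiOneC (j : Fin n) : convergentSeries Unit K := ⟨D.xiOne j, D.isConvergent_xiOne j⟩

theorem constantCoeff_xiOneC (j : Fin n) : constantCoeff (D.xiOneC j).1 = 0 :=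
  D.xiOne_constantCoeff j

/-- The substitution `x_j ↦ ξ'_j`. -/
def substOne : convergentSeries (Fin n) K →ₐ[K] convergentSeries Unit K :=
  convergentSubst D.xiOneC D.constantCoeff_xiOneC

theorem coe_substOne (h : convergentSeries (Fin n) K) :
    (D.substOne h).1 = subst (D.xiOne : Fin n → MvPowerSeries Unit K) h.1 :=
  coe_convergentSubst _ _ _

theorem mem_curveRing {g : PowerSeries K} :
    g ∈ D.curveRing ↔ ∃ h : convergentSeries (Fin n) K, (D.substOne h).1 = g := by
  constructor
  · rintro ⟨h, hh, rfl⟩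
    refine ⟨⟨h, hh⟩, ?_⟩
    rw [coe_substOne]
    exact (substAlgHom_apply D.hasSubst_xiOne h).symm
  · rintro ⟨h, rfl⟩
    exact ⟨h.1, h.2, by rw [coe_substOne]; exact substAlgHom_apply D.hasSubst_xiOne h.1⟩

theorem substOne_monomial (α : Fin n →₀ ℕ) :
    (D.substOne (convergentOfPoly (MvPolynomial.monomial α 1))).1 = D.xiOneMonomial α := by
  rw [coe_substOne]
  change subst _ ((MvPolynomial.monomial α (1 : K) : MvPolynomial (Fin n) K) :
    MvPowerSeries (Fin n) K) = _
  rw [MvPolynomial.coe_monomial, subst_monomial D.hasSubst_xiOne, map_one]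
  exact one_mul _

theorem coeff_mul_monomial_ne_zero {σ : Type*} {f : MvPowerSeries σ K} {α β : σ →₀ ℕ}
    (h : coeff β (f * monomial α 1) ≠ 0) : α ≤ β := by
  classical
  by_contra hle
  rw [coeff_mul_monomial, if_neg hle] at h
  exact h rfl

variable [CompleteSpace K]

/-- A convergent series of large order is `h(ξ')` for a convergent series `h` of large weighted
order. -/
theorem exists_lift_of_large (j₀ : Fin n) (c : ℕ) (α : ℕ → Fin n →₀ ℕ)
    (hα : ∀ i, Finsupp.weight D.ell (α i) = c + i) (g : convergentSeries Unit K)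
    (hg : ∀ i < c, PowerSeries.coeff i g.1 = 0) :
    ∃ h : convergentSeries (Fin n) K, D.substOne h = g ∧
      ∀ β, coeff β h.1 ≠ 0 → c ≤ Finsupp.weight D.ell β := by
  classical
  set ℓ := D.ell j₀ with hℓ
  have hb0 : ∀ i : Fin 1 ⊕ Unit, constantCoeff
      (Sum.elim (fun _ => D.xiOneC j₀) (fun _ => convergentX ()) i :
        convergentSeries Unit K).1 = 0 := by
    rintro (_ | _)
    · exact D.xiOne_constantCoeff j₀
    · exact constantCoeff_X _
  -- The series in t are presented as a quotient of K{z, t} by z ↦ ξ'_(j₀), and the finiteness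
  -- theorem is applied over K{z}.
  let φ : convergentSeries (Fin 1 ⊕ Unit) K →ₐ[K] convergentSeries Unit K :=
    convergentSubst _ hb0
  let e : Fin 1 ↪ Fin 1 ⊕ Unit := Function.Embedding.inl
  let _ : Algebra (convergentSeries (Fin 1) K) (convergentSeries Unit K) :=
    (φ.comp (convergentRename e)).toRingHom.toAlgebra
  have hφr : ∀ g, φ (convergentRename Function.Embedding.inr g) = g := fun g => by
    simp only [φ]
    rw [convergentSubst_rename]
    exact convergentSubst_X_eq g
  have hφs : Function.Surjective φ := fun g => ⟨_, hφr g⟩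
  -- The equation t^ℓ = z - (ξ'_(j₀) - t^ℓ) has the form needed for division, because the bracket
  -- has order greater than ℓ.
  let E : Fin 1 ⊕ Unit → convergentSeries (Fin 1 ⊕ Unit) K := fun _ =>
    convergentX (Sum.inl 0) -
      convergentRename Function.Embedding.inr (D.xiOneC j₀ - convergentX () ^ ℓ)
  obtain ⟨v, hv⟩ := D.xiOne_eq_mul j₀ (D.one_le_gap j₀)
  have hunit : ∃ u : convergentSeries Unit K, IsUnit u ∧
      D.xiOneC j₀ = convergentX () ^ ℓ * u := by
    obtain ⟨u, hu, hu'⟩ := exists_eq_X_pow_mul (f := D.xiOneC j₀) (k := ℓ) fun i hi => by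
      change PowerSeries.coeff i (D.xiOne j₀) = 0
      rw [hv, PowerSeries.coeff_X_pow_mul', if_neg (not_le.2 hi)]
    refine ⟨u, isUnit_convergentSeries ?_, hu⟩
    change PowerSeries.constantCoeff u.1 ≠ 0
    rw [← PowerSeries.coeff_zero_eq_constantCoeff_apply, hu']
    change PowerSeries.coeff _ (D.xiOne j₀) ≠ 0
    rw [hv, zero_add, PowerSeries.coeff_X_pow_mul', if_pos le_rfl, hℓ]
    simp
  obtain ⟨u, hu, hxu⟩ := hunit
  let b : ℕ → convergentSeries Unit K := fun i =>
    D.substOne (convergentOfPoly (MvPolynomial.monomial (α i) 1))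
  have hb : ∀ i, (b i).1 = D.xiOneMonomial (α i) := fun i => D.substOne_monomial (α i)
  have hb' : ∀ i, ∃ q : convergentSeries Unit K, b i = convergentX () ^ c * q ∧
      ∀ k, PowerSeries.coeff k q.1 = PowerSeries.coeff (k + c) (b i).1 := fun i =>
    exists_eq_X_pow_mul fun k hk => by
      rw [hb]
      exact D.coeff_xiOneMonomial_of_lt _ (by rw [hα]; omega)
  -- The monomial ξ'^(α i) is t^c times `q i`, and `q i` has leading term t^i. So the first ℓ of the
  -- `q i` form a basis modulo t^ℓ, that is, modulo ξ'_(j₀).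
  choose q hq hqc using hb'
  have hq1 : ∀ i, PowerSeries.coeff i (q i).1 = 1 := fun i => by
    rw [hqc, hb, show i + c = Finsupp.weight D.ell (α i) by rw [hα, add_comm]]
    exact D.coeff_xiOneMonomial_self _
  have hq0 : ∀ i, ∀ k < i, PowerSeries.coeff k (q i).1 = 0 := fun i k hk => by
    rw [hqc, hb]
    exact D.coeff_xiOneMonomial_of_lt _ (by rw [hα]; omega)
  have hC : ∀ (a : K) (y : convergentSeries Unit K), a • y =
      (algebraMap K (convergentSeries (Fin 1) K) a) • y := fun a y => by
    rw [Algebra.smul_def, Algebra.smul_def]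
    congr 1
    change _ = (φ.comp (convergentRename e)) (algebraMap _ _ a)
    rw [AlgHom.commutes]
  let N := Submodule.span (convergentSeries (Fin 1) K) (Set.range fun i : Fin ℓ => q i)
  -- Triangular elimination: the coefficient at t^k is removed by a multiple of `q k` without
  -- disturbing earlier ones.
  have helim : ∀ k ≤ ℓ, ∀ y : convergentSeries Unit K, ∃ z ∈ N,
      ∀ i < k, PowerSeries.coeff i (y - z).1 = 0 := by
    intro k
    induction k with
    | zero => exact fun _ y => ⟨0, zero_mem _, by simp⟩
    | succ k ih =>
      intro hk y
      obtain ⟨z, hz, hyz⟩ := ih (Nat.le_of_succ_le hk) y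
      refine ⟨z + PowerSeries.coeff k (y - z).1 • q k, add_mem hz ?_, fun i hi => ?_⟩
      · rw [hC]
        exact N.smul_mem _ (Submodule.subset_span ⟨⟨k, hk⟩, rfl⟩)
      · have h1 : (y - (z + PowerSeries.coeff k (y - z).1 • q k)).1 =
            (y - z).1 - PowerSeries.coeff k (y - z).1 • (q k).1 := by
          rw [← sub_sub]; rfl
        rw [h1, map_sub]
        have h2 : PowerSeries.coeff i (PowerSeries.coeff k (y - z).1 • (q k).1) =
            PowerSeries.coeff k (y - z).1 * PowerSeries.coeff i (q k).1 := rfl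
        rw [h2]
        rcases Nat.lt_succ_iff_lt_or_eq.1 hi with hi | rfl
        · rw [hyz i hi, hq0 k i hi]; simp
        · rw [hq1]; simp
  have hX1 : ∀ y : convergentSeries Unit K,
      (convergentX 0 : convergentSeries (Fin 1) K) • y = D.xiOneC j₀ * y := fun y => by
    rw [Algebra.smul_def]
    congr 1
    change φ (convergentRename e (convergentX 0)) = _
    have : convergentRename e (convergentX 0 : convergentSeries (Fin 1) K) =
        convergentX (Sum.inl 0) := Subtype.ext (rename_X _ _)
    rw [this]
    exact convergentSubst_X _ _ _
  have htop : N = ⊤ := by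
    refine span_eq_top_of_division e φ.toRingHom hφs (fun _ => rfl) (p := ℓ) E ?_ ?_ _ ?_
    · intro j _ β hβ
      by_cases h1 : β = Finsupp.single (Sum.inl 0) 1
      · left
        exact ⟨Sum.inl 0, ⟨0, rfl⟩, by simp [h1]⟩
      · right
        have h2 : coeff β (E j).1 = coeff β (X (Sum.inl 0)) - coeff β (MvPowerSeries.rename
          Function.Embedding.inr (D.xiOneC j₀ - convergentX () ^ ℓ).1) := rfl
        rw [h2, coeff_X, if_neg h1, zero_sub, neg_ne_zero] at hβ
        by_cases h3 : β ∈ Set.range (Finsupp.mapDomain (Function.Embedding.inr : Unit ↪ Fin 1 ⊕ Unit))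
        · obtain ⟨γ, rfl⟩ := h3
          rw [← Finsupp.embDomain_eq_mapDomain, coeff_embDomain_rename] at hβ
          rw [Finsupp.degree_mapDomain]
          have h4 : γ = Finsupp.single () (γ ()) := by ext; simp
          rw [h4, Finsupp.degree_single]
          rw [h4] at hβ
          change PowerSeries.coeff (γ ()) (D.xiOne j₀ - PowerSeries.X ^ ℓ) ≠ 0 at hβ
          by_contra hle
          apply hβ
          rw [hv, show (PowerSeries.X ^ D.ell j₀ * (1 + PowerSeries.X ^ 1 * v) -
            PowerSeries.X ^ ℓ : PowerSeries K) = PowerSeries.X ^ (ℓ + 1) * v by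
              rw [← hℓ]; ring, PowerSeries.coeff_X_pow_mul', if_neg (by omega)]
        · exact absurd (coeff_rename_eq_zero _ _ h3) hβ
    · rintro (j | j) hj
      · exact absurd ⟨j, rfl⟩ hj
      · change φ (convergentX (Sum.inr j)) ^ ℓ = φ (E (Sum.inr j))
        simp only [E]
        rw [map_sub, hφr]
        simp only [φ]
        rw [convergentSubst_X, convergentSubst_X]
        simp
    · intro β _
      obtain ⟨z, hz, hyz⟩ := helim ℓ le_rfl
        (φ (convergentOfPoly (MvPolynomial.monomial β 1)))
      obtain ⟨y, hy, -⟩ := exists_eq_X_pow_mul hyz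
      refine Submodule.mem_sup.2 ⟨z, hz, _, ?_, add_sub_cancel z _⟩
      obtain ⟨u', rfl⟩ := hu
      have : (φ.toRingHom (convergentOfPoly (MvPolynomial.monomial β 1)) - z) =
          (convergentX 0 : convergentSeries (Fin 1) K) • (((u'⁻¹ : (convergentSeries Unit K)ˣ) :
            convergentSeries Unit K) * y) := by
        rw [hX1, hxu]
        refine hy.trans ?_
        rw [mul_assoc, ← mul_assoc u'.1, Units.mul_inv, one_mul]
      rw [this]
      exact Submodule.smul_mem_smul (mem_jacobson_convergentSeries (constantCoeff_X _)) trivial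
  -- With g = t^c g' and g' = ∑ H_i(ξ'_(j₀)) q_i, the power t^c turns each q_i back into ξ'^(α i);
  -- the lift ∑ H_i(x_(j₀)) x^(α i) can be read off.
  obtain ⟨g', hg', -⟩ := exists_eq_X_pow_mul hg
  obtain ⟨H, hH⟩ := (Submodule.mem_span_range_iff_exists_fun _).1
    (show g' ∈ N by rw [htop]; trivial)
  let e₀ : Fin 1 ↪ Fin n := ⟨fun _ => j₀, fun _ _ _ => Subsingleton.elim _ _⟩
  refine ⟨∑ i : Fin ℓ, convergentRename e₀ (H i) *
    convergentOfPoly (MvPolynomial.monomial (α i) 1), ?_, ?_⟩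
  · rw [map_sum, hg', ← hH, Finset.mul_sum]
    refine Finset.sum_congr rfl fun i _ => ?_
    rw [map_mul, Algebra.smul_def]
    change _ * b i = _ * (φ (convergentRename e (H i)) * q i)
    rw [hq, mul_left_comm]
    congr 2
    rw [substOne, convergentSubst_rename]
    simp only [φ]
    rw [convergentSubst_rename]
    rfl
  · intro β hβ
    have h1 : (∑ i : Fin ℓ, convergentRename e₀ (H i) *
        convergentOfPoly (MvPolynomial.monomial (α i) 1)).1 =
        ∑ i : Fin ℓ, (convergentRename e₀ (H i)).1 * monomial (α i) 1 := by
      simp [AddSubmonoidClass.coe_finsetSum, convergentOfPoly]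
    rw [h1, map_sum] at hβ
    obtain ⟨i, -, hi⟩ := Finset.exists_ne_zero_of_sum_ne_zero hβ
    have h2 := coeff_mul_monomial_ne_zero hi
    calc c ≤ c + i := Nat.le_add_right _ _
      _ = Finsupp.weight D.ell (α i) := (hα i).symm
      _ ≤ Finsupp.weight D.ell β := by
        rw [← add_tsub_cancel_of_le h2, map_add]
        exact Nat.le_add_right _ _

/-- If the value semigroup is generated by the `ℓ_j`, a member of `O` of order at least `k` is
`h(ξ')` for a convergent series `h` of weighted order at least `k`. -/
theorem exists_lift_of_le_order (hgcd : Finset.univ.gcd D.ell = 1)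
    (hΓ : D.valueSemigroup = (D.semigroup : Set ℕ)) (k : ℕ) (g : PowerSeries K)
    (hg : g ∈ D.curveRing) (hk : ∀ i < k, PowerSeries.coeff i g = 0) :
    ∃ h : convergentSeries (Fin n) K, (D.substOne h).1 = g ∧
      ∀ β, coeff β h.1 ≠ 0 → k ≤ Finsupp.weight D.ell β := by
  have hn : Nonempty (Fin n) := by
    by_contra hn
    rw [not_nonempty_iff] at hn
    rw [Finset.univ_eq_empty, Finset.gcd_empty] at hgcd
    exact zero_ne_one hgcd
  obtain ⟨j₀⟩ := hn
  obtain ⟨c, hc⟩ := D.exists_weight_eq_of_ge hgcd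
  -- m bounds the number of leading terms to be removed before the order reaches the conductor.
  obtain ⟨m, hm⟩ : ∃ m, c ≤ k + m := ⟨c, Nat.le_add_left _ _⟩
  induction m generalizing k g with
  | zero =>
    choose α hα using fun i : ℕ => hc (k + i) (by omega)
    obtain ⟨h₀, rfl⟩ := D.mem_curveRing.1 hg
    obtain ⟨h, hh, hh'⟩ := D.exists_lift_of_large j₀ k α hα (D.substOne h₀) hk
    exact ⟨h, congrArg _ hh, hh'⟩
  | succ m ih =>
    by_cases h0 : PowerSeries.coeff k g = 0
    · obtain ⟨h, hh, hh'⟩ := ih (k + 1) g hg (fun i hi => by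
        rcases Nat.lt_succ_iff_lt_or_eq.1 hi with hi | rfl
        · exact hk i hi
        · exact h0) (by omega)
      exact ⟨h, hh, fun β hβ => (Nat.le_succ k).trans (hh' β hβ)⟩
    · have hkΓ : k ∈ D.valueSemigroup := ⟨g, hg, (PowerSeries.order_eq_nat).2 ⟨h0, hk⟩⟩
      rw [hΓ] at hkΓ
      obtain ⟨α, hα⟩ := D.mem_semigroup_iff.1 hkΓ
      have hmon : D.xiOneMonomial α ∈ D.curveRing :=
        D.mem_curveRing.2 ⟨_, D.substOne_monomial α⟩
      obtain ⟨h, hh, hh'⟩ := ih (k + 1) (g - PowerSeries.coeff k g • D.xiOneMonomial α)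
        (sub_mem hg (Subalgebra.smul_mem _ hmon _)) (fun i hi => by
        rw [map_sub, PowerSeries.coeff_smul]
        rcases Nat.lt_succ_iff_lt_or_eq.1 hi with hi | rfl
        · rw [hk i hi, D.coeff_xiOneMonomial_of_lt α (by omega)]; simp
        · rw [← hα, D.coeff_xiOneMonomial_self]; simp) (by omega)
      refine ⟨h + PowerSeries.coeff k g • convergentOfPoly (MvPolynomial.monomial α 1), ?_,
        fun β hβ => ?_⟩
      · rw [map_add, map_smul]
        change (D.substOne h).1 + PowerSeries.coeff k g • (D.substOne _).1 = g
        rw [hh, D.substOne_monomial, sub_add_cancel]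
      · by_contra hlt
        have h1 : coeff β h.1 = 0 := by
          by_contra hne
          have := hh' β hne
          omega
        apply hβ
        change coeff β (h.1 + PowerSeries.coeff k g •
          ((MvPolynomial.monomial α (1 : K) : MvPolynomial _ K) : MvPowerSeries _ K)) = 0
        classical
        rw [map_add, h1, zero_add, map_smul, MvPolynomial.coe_monomial, coeff_monomial, if_neg]
        · simp
        · rintro rfl
          omega

end Values

end Deformation

end CurveDeformation

end

noncomputable section

namespace CurveDeformation

open MvPowerSeries

namespace Deformation

/-! ### Homogeneous series -/

section Homogeneous

variable {K : Type*} [Field K]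

theorem hasSubst_diag : HasSubst (fun _ : Unit => (X 0 * X 1 : MvPowerSeries (Fin 2) K)) :=
  hasSubst_of_constantCoeff_zero fun _ => by simp

/-- The substitution `t ↦ t s`. -/
def diag : PowerSeries K →ₐ[K] MvPowerSeries (Fin 2) K :=
  substAlgHom (hasSubst_diag (K := K))

theorem diag_apply (g : PowerSeries K) :
    diag g = subst (fun _ : Unit => (X 0 * X 1 : MvPowerSeries (Fin 2) K)) g :=
  substAlgHom_apply _ g

theorem diag_X : diag (PowerSeries.X : PowerSeries K) = X 0 * X 1 :=
  substAlgHom_X _ ()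

theorem coeff_diag (g : PowerSeries K) (e : Fin 2 →₀ ℕ) :
    coeff e (diag g) = if e 0 = e 1 then PowerSeries.coeff (e 0) g else 0 := by
  classical
  have hmon : ∀ k : ℕ, (X 0 * X 1 : MvPowerSeries (Fin 2) K) ^ k =
      monomial (Finsupp.single 0 k + Finsupp.single 1 k) 1 := fun k => by
    rw [mul_pow, X_pow_eq, X_pow_eq, monomial_mul_monomial, one_mul]
  rw [diag_apply, coeff_subst hasSubst_diag, finsum_eq_single _ (Finsupp.single () (e 0))]
  · rw [Finsupp.prod_single_index (h := fun _ k => (X 0 * X 1 : MvPowerSeries (Fin 2) K) ^ k)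
      (pow_zero _), hmon, coeff_monomial]
    have : e = Finsupp.single 0 (e 0) + Finsupp.single 1 (e 0) ↔ e 0 = e 1 := by
      constructor
      · intro h
        have h1 := DFunLike.congr_fun h 1
        simpa using h1.symm
      · intro h
        ext i
        fin_cases i <;> simp [h]
    simp only [this]
    split_ifs
    · simp [PowerSeries.coeff]
    · simp
  · intro d hd
    have h1 : d = Finsupp.single () (d ()) := by ext; simp
    rw [h1, Finsupp.prod_single_index (h := fun _ k => (X 0 * X 1 : MvPowerSeries (Fin 2) K) ^ k)
      (pow_zero _), hmon, coeff_monomial, if_neg, smul_zero]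
    intro h2
    apply hd
    rw [h1, h2]
    simp

theorem coeff_X_one_pow_mul_diag (a : ℕ) (g : PowerSeries K) (k l : ℕ) :
    coeff (Finsupp.single 0 k + Finsupp.single 1 l) (X 1 ^ a * diag g) =
      if l = k + a then PowerSeries.coeff k g else 0 := by
  classical
  rw [X_pow_eq, coeff_monomial_mul]
  by_cases h : a ≤ l
  · rw [if_pos (by
      intro i
      fin_cases i <;> simp [h]), one_mul, coeff_diag]
    have h0 : ((Finsupp.single 0 k + Finsupp.single 1 l - Finsupp.single 1 a :
        Fin 2 →₀ ℕ)) 0 = k := by simp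
    have h1 : ((Finsupp.single 0 k + Finsupp.single 1 l - Finsupp.single 1 a :
        Fin 2 →₀ ℕ)) 1 = l - a := by simp
    rw [h0, h1]
    by_cases h2 : l = k + a
    · rw [if_pos (by omega), if_pos h2]
    · rw [if_neg (by omega), if_neg h2]
  · rw [if_neg, if_neg (by omega)]
    intro h'
    have := h' 1
    simp at this
    omega

/-- The support of s^a f(ts) lies on the line l = k + a. Different a and b give disjoint supports,
and then both series vanish. -/
theorem eq_of_X_one_pow_mul_diag_eq {a b : ℕ} {f g : PowerSeries K}
    (h : (X 1 ^ a * diag f : MvPowerSeries (Fin 2) K) = X 1 ^ b * diag g) : f = g := by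
  have h1 : ∀ k l : ℕ, (if l = k + a then PowerSeries.coeff k f else 0) =
      if l = k + b then PowerSeries.coeff k g else 0 := fun k l => by
    rw [← coeff_X_one_pow_mul_diag, ← coeff_X_one_pow_mul_diag, h]
  ext k
  have h2 := h1 k (k + a)
  have h3 := h1 k (k + b)
  rw [if_pos rfl] at h2 h3
  by_cases hab : a = b
  · subst hab
    rw [h2, if_pos rfl]
  · rw [if_neg (by omega)] at h2 h3
    rw [h2, ← h3]

theorem X_one_pow_ne_zero (a : ℕ) : (X 1 ^ a : MvPowerSeries (Fin 2) K) ≠ 0 := by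
  intro h
  have := congrArg (coeff (Finsupp.single 1 a)) h
  rw [coeff_X_pow] at this
  simp at this

variable {n : ℕ} (D : Deformation K n)

/-- Each ξ_j is homogeneous of degree ℓ_j for deg t = 1 and deg s = -1, so ξ_j is recovered from
ξ'_j by t ↦ ts up to a power of s. -/
theorem diag_xiOne (j : Fin n) :
    diag (D.xiOne j) = X 1 ^ D.ell j * (D.xi j : MvPowerSeries (Fin 2) K) := by
  have h1 : (X 1 ^ D.ell j * (D.xi j : MvPowerSeries (Fin 2) K)) =
      (((MvPolynomial.X 1 ^ D.ell j * D.xi j : MvPolynomial (Fin 2) K)) :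
        MvPowerSeries (Fin 2) K) := by
    simp
  have hcoe : ∀ p : MvPolynomial (Fin 2) K, (p : MvPowerSeries (Fin 2) K) =
      MvPolynomial.coeToMvPowerSeries.algHom K p := fun p => by
    simp [MvPolynomial.coeToMvPowerSeries.algHom_apply]
  have hC : ∀ c : K, diag (PowerSeries.C c) = C c := fun c => diag.commutes c
  rw [h1, xi, mul_add, xiOne_eq, map_add, map_pow, diag_X, hcoe, map_add, ← hcoe, ← hcoe]
  congr 1
  · simp [mul_pow, mul_comm]
  · rw [Finsupp.mul_sum, map_finsuppSum, hcoe, map_finsuppSum]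
    refine Finsupp.sum_congr fun i hi => ?_
    have h2 : D.ell j ≤ i := by
      have := le_self_add.trans (D.le_of_tail_ne_zero j i (Finsupp.mem_support_iff.1 hi))
      exact_mod_cast this
    rw [← hcoe]
    simp only [map_mul, map_pow, diag_X, MvPolynomial.coe_mul, MvPolynomial.coe_pow,
      MvPolynomial.coe_X, MvPolynomial.coe_C, hC]
    rw [mul_pow]
    have h3 : (X 1 : MvPowerSeries (Fin 2) K) ^ i = X 1 ^ D.ell j * X 1 ^ (i - D.ell j) := by
      rw [← pow_add, Nat.add_sub_cancel' h2]
    rw [h3]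
    ring

/-- The family `s^(ℓ_j) x_j`. -/
def scaledX (j : Fin n) : MvPowerSeries (Fin n ⊕ Unit) K :=
  X (Sum.inr ()) ^ D.ell j * X (Sum.inl j)

theorem constantCoeff_scaledX (j : Fin n) : constantCoeff (D.scaledX j) = 0 := by
  simp [scaledX]

theorem hasSubst_scaledX : HasSubst D.scaledX :=
  hasSubst_of_constantCoeff_zero D.constantCoeff_scaledX

theorem eq_sumElim (α : (Fin n ⊕ Unit) →₀ ℕ) : ∃ (β : Fin n →₀ ℕ) (k : ℕ),
    α = Finsupp.sumElim β (Finsupp.single () k) := by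
  refine ⟨α.comapDomain Sum.inl Sum.inl_injective.injOn, α (Sum.inr ()), ?_⟩
  ext (i | i) <;> simp [Finsupp.sumElim_inl, Finsupp.sumElim_inr]

theorem sumElim_inj {β β' : Fin n →₀ ℕ} {k k' : ℕ} :
    Finsupp.sumElim β (Finsupp.single () k) = Finsupp.sumElim β' (Finsupp.single () k') ↔
      β = β' ∧ k = k' := by
  constructor
  · intro h
    constructor
    · ext i
      have := DFunLike.congr_fun h (Sum.inl i)
      simpa using this
    · have := DFunLike.congr_fun h (Sum.inr ())
      simpa using this
  · rintro ⟨rfl, rfl⟩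
    rfl

theorem sumElim_eq_add (β : Fin n →₀ ℕ) (k : ℕ) :
    Finsupp.sumElim β (Finsupp.single () k) =
      Finsupp.mapDomain Sum.inl β + Finsupp.single (Sum.inr ()) k := by
  ext (i | i)
  · simp [Finsupp.mapDomain_apply Sum.inl_injective]
  · rw [Finsupp.add_apply, Finsupp.mapDomain_of_notMem_range _ _ (by simp)]
    simp

theorem weight_sumElim (β : Fin n →₀ ℕ) (k : ℕ) :
    Finsupp.weight (Sum.elim (fun j => (D.ell j : ℤ)) fun _ => -1)
      (Finsupp.sumElim β (Finsupp.single () k)) = (Finsupp.weight D.ell β : ℤ) - k := by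
  rw [sumElim_eq_add, map_add, Finsupp.weight_single]
  have : Finsupp.weight (Sum.elim (fun j => (D.ell j : ℤ)) fun _ => -1)
      (Finsupp.mapDomain Sum.inl β : (Fin n ⊕ Unit) →₀ ℕ) = (Finsupp.weight D.ell β : ℤ) := by
    rw [Finsupp.weight_apply, Finsupp.weight_apply, Finsupp.sum_mapDomain_index (by simp)
      (by intros; simp [add_mul]), Finsupp.sum, Finsupp.sum]
    push_cast
    simp
  rw [this]
  simp [sub_eq_add_neg]

theorem prod_scaledX (β : Fin n →₀ ℕ) : (β.prod fun j k => D.scaledX j ^ k) =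
    monomial (Finsupp.sumElim β (Finsupp.single () (Finsupp.weight D.ell β))) 1 := by
  induction β using Finsupp.induction_linear with
  | zero =>
    simp
  | add f g hf hg =>
    rw [Finsupp.prod_add_index' (fun _ => pow_zero _) fun _ _ _ => pow_add _ _ _, hf, hg,
      monomial_mul_monomial, one_mul, map_add]
    congr 1
    congr 1
    ext (i | i) <;> simp
  | single j a =>
    rw [Finsupp.prod_single_index (h := fun j k => D.scaledX j ^ k) (pow_zero _), scaledX,
      mul_pow, ← pow_mul, X_pow_eq, X_pow_eq, monomial_mul_monomial, one_mul]
    congr 1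
    rw [Finsupp.weight_single, sumElim_eq_add, Finsupp.mapDomain_single, add_comm, smul_eq_mul,
      mul_comm]

theorem coeff_subst_scaledX (h : MvPowerSeries (Fin n) K) (β : Fin n →₀ ℕ) (k : ℕ) :
    coeff (Finsupp.sumElim β (Finsupp.single () k)) (subst D.scaledX h) =
      if k = Finsupp.weight D.ell β then coeff β h else 0 := by
  classical
  rw [coeff_subst D.hasSubst_scaledX, finsum_eq_single _ β]
  · rw [prod_scaledX, coeff_monomial]
    simp [sumElim_inj]
  · intro γ hγ
    rw [prod_scaledX, coeff_monomial, if_neg (fun h => hγ (sumElim_inj.1 h).1.symm), smul_zero]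

/-- Both sides are h evaluated at the family s^(ℓ_j) ξ_j = ξ'_j(ts). -/
theorem subst_xiS_scaledX (h : MvPowerSeries (Fin n) K) :
    subst D.xiS (subst D.scaledX h) =
      diag (subst (D.xiOne : Fin n → MvPowerSeries Unit K) h) := by
  rw [subst_comp_subst_apply D.hasSubst_scaledX D.hasSubst_xiS, diag_apply,
    subst_comp_subst_apply D.hasSubst_xiOne hasSubst_diag]
  congr 1
  funext j
  rw [← diag_apply, diag_xiOne, scaledX, subst_mul D.hasSubst_xiS, subst_pow D.hasSubst_xiS,
    subst_X D.hasSubst_xiS, subst_X D.hasSubst_xiS]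
  rfl

variable {D}

theorem IsHomogeneous.coeff_eq_zero {e : ℤ} {G : MvPowerSeries (Fin n ⊕ Unit) K}
    (hG : D.IsHomogeneous e G) {β : Fin n →₀ ℕ} {k : ℕ}
    (h : (Finsupp.weight D.ell β : ℤ) - k ≠ e) :
    coeff (Finsupp.sumElim β (Finsupp.single () k)) G = 0 := by
  by_contra hne
  exact h ((D.weight_sumElim β k).symm.trans (hG _ hne))

/-- The degree fixes the exponent of s that accompanies x^β, so the sum defining `atOne` has a
single term. -/
theorem IsHomogeneous.coeff_atOne {e : ℤ} {G : MvPowerSeries (Fin n ⊕ Unit) K}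
    (hG : D.IsHomogeneous e G) {β : Fin n →₀ ℕ} {k : ℕ}
    (h : (Finsupp.weight D.ell β : ℤ) - k = e) :
    coeff β (atOne G) = coeff (Finsupp.sumElim β (Finsupp.single () k)) G :=
  finsum_eq_single _ k fun k' hk' => hG.coeff_eq_zero (by omega)

theorem IsHomogeneous.coeff_atOne_eq_zero {e : ℤ} {G : MvPowerSeries (Fin n ⊕ Unit) K}
    (hG : D.IsHomogeneous e G) {β : Fin n →₀ ℕ}
    (h : (Finsupp.weight D.ell β : ℤ) < e) : coeff β (atOne G) = 0 :=
  finsum_eq_zero_of_forall_eq_zero fun k => hG.coeff_eq_zero (by omega)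

theorem coeff_X_inr_pow_mul (a : ℕ) (G : MvPowerSeries (Fin n ⊕ Unit) K) (β : Fin n →₀ ℕ)
    (k : ℕ) : coeff (Finsupp.sumElim β (Finsupp.single () k)) (X (Sum.inr ()) ^ a * G) =
      if a ≤ k then coeff (Finsupp.sumElim β (Finsupp.single () (k - a))) G else 0 := by
  classical
  rw [X_pow_eq, coeff_monomial_mul, one_mul]
  have h1 : Finsupp.single (Sum.inr ()) a ≤ Finsupp.sumElim β (Finsupp.single () k) ↔ a ≤ k := by
    rw [Finsupp.single_le_iff]
    simp
  simp only [h1]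
  split_ifs
  · congr 2
    ext (i | i) <;> simp
  · rfl

/-- A homogeneous series is determined by its value at `s = 1`. -/
theorem IsHomogeneous.X_pow_mul_eq {e : ℤ} {G : MvPowerSeries (Fin n ⊕ Unit) K}
    (hG : D.IsHomogeneous e G) {a b : ℕ} (hab : e = a - b) :
    X (Sum.inr ()) ^ a * G = X (Sum.inr ()) ^ b * subst D.scaledX (atOne G) := by
  ext α
  obtain ⟨β, k, rfl⟩ := eq_sumElim α
  rw [coeff_X_inr_pow_mul, coeff_X_inr_pow_mul, coeff_subst_scaledX]
  by_cases hk : k = Finsupp.weight D.ell β + b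
  · rw [if_pos (show b ≤ k by omega), if_pos (show k - b = _ by omega)]
    split_ifs with ha
    · exact (hG.coeff_atOne (by omega)).symm
    · exact (hG.coeff_atOne_eq_zero (by omega)).symm
  · trans 0
    · split_ifs with ha
      · exact hG.coeff_eq_zero (by omega)
      · rfl
    · split_ifs with h1 h2
      · omega
      · rfl
      · rfl

/-- This is the dictionary between homogeneous series at (ξ, s) and series at ξ'. Two exponents a
and b are used because the degree may have either sign. -/
theorem IsHomogeneous.X_pow_mul_subst_eq {e : ℤ} {G : MvPowerSeries (Fin n ⊕ Unit) K}
    (hG : D.IsHomogeneous e G) {a b : ℕ} (hab : e = a - b) :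
    X 1 ^ a * subst D.xiS G =
      X 1 ^ b * diag (subst (D.xiOne : Fin n → MvPowerSeries Unit K) (atOne G)) := by
  have h := congrArg (subst D.xiS) (hG.X_pow_mul_eq hab)
  rw [subst_mul D.hasSubst_xiS, subst_mul D.hasSubst_xiS, subst_pow D.hasSubst_xiS,
    subst_pow D.hasSubst_xiS, subst_X D.hasSubst_xiS, subst_xiS_scaledX] at h
  exact h

variable (D)

theorem X_pow_weight_mul_aeval_monomial (α : Fin n →₀ ℕ) :
    X 1 ^ Finsupp.weight D.ell α * ((MvPolynomial.aeval D.xi (MvPolynomial.monomial α (1 : K)) :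
      MvPolynomial (Fin 2) K) : MvPowerSeries (Fin 2) K) = diag (D.xiOneMonomial α) := by
  rw [MvPolynomial.aeval_monomial, map_one, one_mul, xiOneMonomial]
  induction α using Finsupp.induction_linear with
  | zero => simp
  | add f g hf hg =>
    rw [Finsupp.prod_add_index' (fun _ => pow_zero _) fun _ _ _ => pow_add _ _ _,
      Finsupp.prod_add_index' (fun _ => pow_zero _) fun _ _ _ => pow_add _ _ _, map_mul, ← hf,
      ← hg, MvPolynomial.coe_mul, map_add, pow_add]
    ring
  | single j a =>
    rw [Finsupp.prod_single_index (h := fun j k => D.xiOne j ^ k) (pow_zero _),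
      Finsupp.prod_single_index (h := fun j k => D.xi j ^ k) (pow_zero _), map_pow, diag_xiOne,
      MvPolynomial.coe_pow, mul_pow, ← pow_mul, Finsupp.weight_single, smul_eq_mul, mul_comm a]

theorem coeff_subst_xiOne_eq_zero {h : MvPowerSeries (Fin n) K} {v : ℕ}
    (hh : ∀ β, coeff β h ≠ 0 → v ≤ Finsupp.weight D.ell β) {i : ℕ} (hi : i < v) :
    PowerSeries.coeff i (subst (D.xiOne : Fin n → MvPowerSeries Unit K) h) = 0 := by
  rw [PowerSeries.coeff, coeff_subst D.hasSubst_xiOne]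
  refine finsum_eq_zero_of_forall_eq_zero fun β => ?_
  by_cases hβ : coeff β h = 0
  · rw [hβ, zero_smul]
  · have h1 : coeff (Finsupp.single () i) (D.xiOneMonomial β : MvPowerSeries Unit K) = 0 :=
      D.coeff_xiOneMonomial_of_lt β (hi.trans_le (hh β hβ))
    exact (congrArg _ h1).trans (smul_zero _)

theorem subst_xiOne_monomial (α : Fin n →₀ ℕ) (c : K) :
    subst (D.xiOne : Fin n → MvPowerSeries Unit K) (monomial α c) = c • D.xiOneMonomial α := by
  rw [subst_monomial D.hasSubst_xiOne]
  exact (Algebra.smul_def c (D.xiOneMonomial α)).symm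

end Homogeneous

end Deformation

end CurveDeformation

end

noncomputable section

namespace CurveDeformation

open MvPowerSeries

namespace Deformation

/-! ### Liftings and the value semigroup -/

section Semigroup

variable {K : Type*} [NontriviallyNormedField K] {n m : ℕ} {D : Deformation K n}
  {f : Fin m → MvPolynomial (Fin n) K} {d : Fin m → ℕ}

theorem X_pow_mul_aeval_binomial {α β : Fin n →₀ ℕ} {e : ℕ} {p : MvPolynomial (Fin n) K}
    (hα : Finsupp.weight D.ell α = e) (hβ : Finsupp.weight D.ell β = e)
    (hp : p = MvPolynomial.monomial α 1 - MvPolynomial.monomial β 1) :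
    X 1 ^ e * ((MvPolynomial.aeval D.xi p : MvPolynomial (Fin 2) K) : MvPowerSeries (Fin 2) K) =
      diag (D.xiOneMonomial α - D.xiOneMonomial β) := by
  have hsub : ∀ p q : MvPolynomial (Fin 2) K, ((p - q : MvPolynomial (Fin 2) K) :
      MvPowerSeries (Fin 2) K) = (p : MvPowerSeries (Fin 2) K) - q := fun p q =>
    map_sub (MvPolynomial.coeToMvPowerSeries.ringHom) p q
  rw [hp, map_sub, map_sub, ← D.X_pow_weight_mul_aeval_monomial α,
    ← D.X_pow_weight_mul_aeval_monomial β, hα, hβ, hsub, mul_sub]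

theorem subst_xiOne_binomial {α β : Fin n →₀ ℕ} {p : MvPolynomial (Fin n) K}
    (hp : p = MvPolynomial.monomial α 1 - MvPolynomial.monomial β 1) :
    subst (D.xiOne : Fin n → MvPowerSeries Unit K) (p : MvPowerSeries (Fin n) K) =
      D.xiOneMonomial α - D.xiOneMonomial β := by
  have h1 : (p : MvPowerSeries (Fin n) K) = monomial α 1 - monomial β 1 := by
    rw [hp, ← MvPolynomial.coe_monomial, ← MvPolynomial.coe_monomial]
    exact map_sub (MvPolynomial.coeToMvPowerSeries.ringHom (σ := Fin n) (R := K)) _ _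
  rw [h1, subst_sub D.hasSubst_xiOne, subst_xiOne_monomial, subst_xiOne_monomial, one_smul,
    one_smul]

theorem prod_X_pow_ell (D : Deformation K n) (α : Fin n →₀ ℕ) :
    (α.prod fun j k => ((Polynomial.X : Polynomial K) ^ D.ell j) ^ k) =
      Polynomial.X ^ Finsupp.weight D.ell α := by
  rw [Finsupp.weight_apply, Finsupp.sum, ← Finset.prod_pow_eq_pow_sum]
  refine Finset.prod_congr rfl fun j _ => ?_
  dsimp only
  rw [← pow_mul, smul_eq_mul, mul_comm]

theorem sub_mem_monomialIdeal {α β : Fin n →₀ ℕ}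
    (h : Finsupp.weight D.ell α = Finsupp.weight D.ell β) :
    (MvPolynomial.monomial α 1 - MvPolynomial.monomial β 1 : MvPolynomial (Fin n) K) ∈
      D.monomialIdeal := by
  change MvPolynomial.aeval (fun j => (Polynomial.X : Polynomial K) ^ D.ell j) _ = 0
  rw [map_sub, MvPolynomial.aeval_monomial, MvPolynomial.aeval_monomial, prod_X_pow_ell,
    prod_X_pow_ell, h, sub_self]

theorem exists_sub_toNat (e : ℤ) : ∃ a b : ℕ, e = a - b :=
  ⟨e.toNat, (-e).toNat, by omega⟩

/-- A lifting of `f_i` gives an equation `f_i(ξ') = f'_i(ξ', 1)`. -/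
theorem IsLifting.subst_xiOne_eq {f' : Fin m → convergentSeries (Fin n ⊕ Unit) K}
    (hf : ∀ i, ∃ α β : Fin n →₀ ℕ, α ≠ β ∧
      Finsupp.weight D.ell α = d i ∧ Finsupp.weight D.ell β = d i ∧
      f i = MvPolynomial.monomial α 1 - MvPolynomial.monomial β 1)
    (hL : D.IsLifting f d f') (i : Fin m) :
    subst (D.xiOne : Fin n → MvPowerSeries Unit K) (f i : MvPowerSeries (Fin n) K) =
      subst (D.xiOne : Fin n → MvPowerSeries Unit K) (atOne (f' i).1) := by
  obtain ⟨α, β, -, hα, hβ, hfi⟩ := hf i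
  rw [subst_xiOne_binomial hfi]
  obtain ⟨e, he⟩ := hL.homogeneous i
  obtain ⟨a, b, hab⟩ := exists_sub_toNat e
  have h1 := he.X_pow_mul_subst_eq hab
  have h2 := X_pow_mul_aeval_binomial hα hβ hfi
  rw [hL.eq_mul i] at h2
  -- The degree of f'_i need not be known to be d_i + 1: if the exponents differ, both series are
  -- zero and still equal.
  refine eq_of_X_one_pow_mul_diag_eq (a := a) (b := d i + 1 + b) ?_
  rw [← h2, pow_add, mul_assoc, ← h1]
  ring

/-- Only δ ≥ 1 is needed here; the strict growth of weight is what makes the rewriting of f_i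
progress. -/
theorem IsLifting.le_weight {f' : Fin m → convergentSeries (Fin n ⊕ Unit) K}
    (hL : D.IsLifting f d f') (i : Fin m) {β : Fin n →₀ ℕ} (hβ : coeff β (atOne (f' i).1) ≠ 0) :
    d i + 1 ≤ Finsupp.weight D.ell β := by
  have h1 := (hL.le_order i).trans (weightedOrder_le D.ell hβ)
  have h2 : ((1 : ℕ) : ℕ∞) ≤ D.delta := le_iInf D.one_le_gap
  have h3 := (add_le_add_right h2 (d i : ℕ∞)).trans h1
  exact_mod_cast h3

/-- The initial form of a relation among the `t^(ℓ_j)` has the value of a series of larger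
weighted order. -/
theorem IsLifting.exists_lift_component {f' : Fin m → convergentSeries (Fin n ⊕ Unit) K}
    (hf : ∀ i, ∃ α β : Fin n →₀ ℕ, α ≠ β ∧
      Finsupp.weight D.ell α = d i ∧ Finsupp.weight D.ell β = d i ∧
      f i = MvPolynomial.monomial α 1 - MvPolynomial.monomial β 1)
    (hL : D.IsLifting f d f') {p : MvPolynomial (Fin n) K} (hp : p ∈ Ideal.span (Set.range f))
    (v : ℕ) : ∃ h : MvPowerSeries (Fin n) K,
      (∀ β, coeff β h ≠ 0 → v + 1 ≤ Finsupp.weight D.ell β) ∧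
      subst (D.xiOne : Fin n → MvPowerSeries Unit K)
        (MvPolynomial.weightedHomogeneousComponent D.ell v p : MvPowerSeries (Fin n) K) =
      subst (D.xiOne : Fin n → MvPowerSeries Unit K) h := by
  have hadd : ∀ p q : MvPolynomial (Fin n) K,
      (∃ h : MvPowerSeries (Fin n) K,
        (∀ β, coeff β h ≠ 0 → v + 1 ≤ Finsupp.weight D.ell β) ∧
        subst (D.xiOne : Fin n → MvPowerSeries Unit K)
          (MvPolynomial.weightedHomogeneousComponent D.ell v p : MvPowerSeries (Fin n) K) =
        subst (D.xiOne : Fin n → MvPowerSeries Unit K) h) →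
      (∃ h : MvPowerSeries (Fin n) K,
        (∀ β, coeff β h ≠ 0 → v + 1 ≤ Finsupp.weight D.ell β) ∧
        subst (D.xiOne : Fin n → MvPowerSeries Unit K)
          (MvPolynomial.weightedHomogeneousComponent D.ell v q : MvPowerSeries (Fin n) K) =
        subst (D.xiOne : Fin n → MvPowerSeries Unit K) h) →
      (∃ h : MvPowerSeries (Fin n) K,
        (∀ β, coeff β h ≠ 0 → v + 1 ≤ Finsupp.weight D.ell β) ∧
        subst (D.xiOne : Fin n → MvPowerSeries Unit K)
          (MvPolynomial.weightedHomogeneousComponent D.ell v (p + q) : MvPowerSeries (Fin n) K) =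
        subst (D.xiOne : Fin n → MvPowerSeries Unit K) h) := by
    rintro p q ⟨h, hh, hp⟩ ⟨h', hh', hq⟩
    refine ⟨h + h', fun β hβ => ?_, ?_⟩
    · by_contra hlt
      apply hβ
      rw [map_add, not_not.1 (mt (hh β) hlt), not_not.1 (mt (hh' β) hlt), add_zero]
    · rw [map_add, MvPolynomial.coe_add, subst_add D.hasSubst_xiOne, hp, hq,
        subst_add D.hasSubst_xiOne]
  have hzero : ∃ h : MvPowerSeries (Fin n) K,
        (∀ β, coeff β h ≠ 0 → v + 1 ≤ Finsupp.weight D.ell β) ∧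
        subst (D.xiOne : Fin n → MvPowerSeries Unit K)
          (MvPolynomial.weightedHomogeneousComponent D.ell v (0 : MvPolynomial (Fin n) K) :
            MvPowerSeries (Fin n) K) =
        subst (D.xiOne : Fin n → MvPowerSeries Unit K) h := by
    refine ⟨0, fun β hβ => absurd (map_zero _) hβ, ?_⟩
    rw [map_zero, MvPolynomial.coe_zero]
  obtain ⟨c, rfl⟩ := (Submodule.mem_span_range_iff_exists_fun _).1 hp
  refine Finset.sum_induction _ _ hadd hzero fun i _ => ?_
  rw [smul_eq_mul]
  -- A monomial multiple of f_i is homogeneous. It either is its own component of weight v, and f_i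
  -- is exchanged for f'_i(x, 1), or has no such component.
  induction c i using MvPolynomial.induction_on' with
  | add p q hp hq => rw [add_mul]; exact hadd _ _ hp hq
  | monomial γ a =>
    obtain ⟨α, β, -, hα, hβ, hfi⟩ := hf i
    have hhom : MvPolynomial.IsWeightedHomogeneous D.ell (MvPolynomial.monomial γ a * f i)
        (Finsupp.weight D.ell γ + d i) := by
      refine (MvPolynomial.isWeightedHomogeneous_monomial _ _ _ rfl).mul ?_
      rw [hfi]
      exact (MvPolynomial.isWeightedHomogeneous_monomial _ _ _ hα).sub
        (MvPolynomial.isWeightedHomogeneous_monomial _ _ _ hβ)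
    by_cases hv : v = Finsupp.weight D.ell γ + d i
    · subst hv
      rw [hhom.weightedHomogeneousComponent_same]
      refine ⟨atOne (f' i).1 * monomial γ a, fun δ hδ => ?_, ?_⟩
      · classical
        rw [coeff_mul_monomial] at hδ
        split_ifs at hδ with hle
        · have h1 := hL.le_weight i (left_ne_zero_of_mul hδ)
          have h2 : Finsupp.weight D.ell δ =
              Finsupp.weight D.ell (δ - γ) + Finsupp.weight D.ell γ := by
            rw [← map_add, tsub_add_cancel_of_le hle]
          omega
        · exact absurd rfl hδ
      · rw [MvPolynomial.coe_mul, subst_mul D.hasSubst_xiOne, subst_mul D.hasSubst_xiOne,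
          hL.subst_xiOne_eq hf i, MvPolynomial.coe_monomial, mul_comm]
    · rw [hhom.weightedHomogeneousComponent_ne v hv]
      rw [map_zero] at hzero
      exact hzero

theorem semigroup_subset_valueSemigroup (D : Deformation K n) :
    (D.semigroup : Set ℕ) ⊆ D.valueSemigroup := by
  intro k hk
  obtain ⟨α, rfl⟩ := D.mem_semigroup_iff.1 hk
  exact ⟨D.xiOneMonomial α, D.mem_curveRing.2 ⟨_, D.substOne_monomial α⟩,
    D.order_xiOneMonomial α⟩

open Classical in
/-- The part of weight `v` of a power series, as a polynomial. -/
def weightPart (D : Deformation K n) (v : ℕ) (h : MvPowerSeries (Fin n) K) :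
    MvPolynomial (Fin n) K :=
  ∑ α ∈ ((Finsupp.finite_of_nat_weight_le D.ell (fun j => (D.ell_pos j).ne') v).toFinset.filter
    fun α => Finsupp.weight D.ell α = v), MvPolynomial.monomial α (coeff α h)

theorem coeff_weightPart (v : ℕ) (h : MvPowerSeries (Fin n) K) (β : Fin n →₀ ℕ) :
    MvPolynomial.coeff β (D.weightPart v h) =
      if Finsupp.weight D.ell β = v then coeff β h else 0 := by
  classical
  rw [weightPart, MvPolynomial.coeff_sum]
  simp only [MvPolynomial.coeff_monomial]
  rw [Finset.sum_ite_eq']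
  refine if_congr ?_ rfl rfl
  simp only [Finset.mem_filter, Set.Finite.mem_toFinset]
  exact ⟨fun h => h.2, fun h => ⟨h.le, h⟩⟩

/-- Subduction on the weighted order of a representation of g. Formal series suffice, since only the
k + 1 steps up to the order k of g are carried out. -/
theorem IsLifting.valueSemigroup_eq {f' : Fin m → convergentSeries (Fin n ⊕ Unit) K}
    (hf : ∀ i, ∃ α β : Fin n →₀ ℕ, α ≠ β ∧
      Finsupp.weight D.ell α = d i ∧ Finsupp.weight D.ell β = d i ∧
      f i = MvPolynomial.monomial α 1 - MvPolynomial.monomial β 1)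
    (hI : Ideal.span (Set.range f) = D.monomialIdeal) (hL : D.IsLifting f d f') :
    D.valueSemigroup = (D.semigroup : Set ℕ) := by
  classical
  refine Set.Subset.antisymm (fun k hk => ?_) D.semigroup_subset_valueSemigroup
  obtain ⟨g, hg, hgk⟩ := hk
  obtain ⟨h₀, hh₀⟩ := D.mem_curveRing.1 hg
  rw [coe_substOne] at hh₀
  rw [PowerSeries.order_eq_nat] at hgk
  by_contra hkΓ
  have key : ∀ v ≤ k + 1, ∃ h : MvPowerSeries (Fin n) K,
      (∀ β, coeff β h ≠ 0 → v ≤ Finsupp.weight D.ell β) ∧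
      subst (D.xiOne : Fin n → MvPowerSeries Unit K) h = g := by
    intro v
    induction v with
    | zero => exact fun _ => ⟨h₀.1, fun _ _ => Nat.zero_le _, hh₀⟩
    | succ v ih =>
      intro hv
      obtain ⟨h, hh, hhg⟩ := ih (by omega)
      set p := D.weightPart v h with hp
      have hrest : ∀ β, coeff β (h - (p : MvPowerSeries (Fin n) K)) ≠ 0 →
          v + 1 ≤ Finsupp.weight D.ell β := by
        intro β hβ
        rw [map_sub, MvPolynomial.coeff_coe, hp, coeff_weightPart] at hβ
        split_ifs at hβ with hβv
        · exact absurd (sub_self _) hβ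
        · rw [sub_zero] at hβ
          have := hh β hβ
          omega
      -- Every monomial of weight v has leading term t^v at ξ', and the rest of h contributes only
      -- higher orders.
      have hgv : PowerSeries.coeff v g = ∑ α ∈ p.support, p.coeff α := by
        have h1 : g = subst (D.xiOne : Fin n → MvPowerSeries Unit K)
            (p : MvPowerSeries (Fin n) K) + subst (D.xiOne : Fin n → MvPowerSeries Unit K)
            (h - (p : MvPowerSeries (Fin n) K)) := by
          rw [← subst_add D.hasSubst_xiOne, add_sub_cancel, hhg]
        have h2 : subst (D.xiOne : Fin n → MvPowerSeries Unit K)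
            (p : MvPowerSeries (Fin n) K) =
            ∑ α ∈ p.support, p.coeff α • D.xiOneMonomial α := by
          have h3 : (p : MvPowerSeries (Fin n) K) =
              ∑ α ∈ p.support, monomial α (p.coeff α) := by
            conv_lhs => rw [p.as_sum]
            simp only [← MvPolynomial.coe_monomial]
            exact map_sum (MvPolynomial.coeToMvPowerSeries.ringHom) _ _
          rw [h3, ← substAlgHom_apply D.hasSubst_xiOne, map_sum]
          refine Finset.sum_congr rfl fun α _ => ?_
          rw [substAlgHom_apply, subst_xiOne_monomial]
        rw [h1, map_add, D.coeff_subst_xiOne_eq_zero hrest (Nat.lt_succ_self v), add_zero, h2,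
          map_sum]
        refine Finset.sum_congr rfl fun α hα => ?_
        have h4 : Finsupp.weight D.ell α = v := by
          have := MvPolynomial.mem_support_iff.1 hα
          rw [hp, coeff_weightPart] at this
          by_contra hne
          exact this (if_neg hne)
        rw [PowerSeries.coeff_smul, ← h4, D.coeff_xiOneMonomial_self, smul_eq_mul, mul_one]
      -- Below k the coefficient of g vanishes; at v = k a nonzero sum would exhibit a monomial of
      -- weight k, contrary to k ∉ Γ.
      have hsum : ∑ α ∈ p.support, p.coeff α = 0 := by
        by_contra hne
        have hvk : v = k := by
          rcases lt_trichotomy v k with hlt | heq | hgt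
          · exact absurd (hgv ▸ hgk.2 v hlt) hne
          · exact heq
          · omega
        obtain ⟨α, hα, -⟩ := Finset.exists_ne_zero_of_sum_ne_zero hne
        have h4 : Finsupp.weight D.ell α = v := by
          have := MvPolynomial.mem_support_iff.1 hα
          rw [hp, coeff_weightPart] at this
          by_contra hne
          exact this (if_neg hne)
        exact hkΓ (D.mem_semigroup_iff.2 ⟨α, h4.trans hvk⟩)
      have hhom : MvPolynomial.IsWeightedHomogeneous D.ell p v := by
        intro α hα
        rw [hp, coeff_weightPart] at hα
        by_contra hne
        exact hα (if_neg hne)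
      have hpI : p ∈ D.monomialIdeal := by
        change MvPolynomial.aeval (fun j => (Polynomial.X : Polynomial K) ^ D.ell j) p = 0
        rw [p.as_sum, map_sum]
        have h5 : ∀ α ∈ p.support, MvPolynomial.aeval
            (fun j => (Polynomial.X : Polynomial K) ^ D.ell j)
            (MvPolynomial.monomial α (p.coeff α)) =
            Polynomial.C (p.coeff α) * Polynomial.X ^ v := by
          intro α hα
          rw [MvPolynomial.aeval_monomial, D.prod_X_pow_ell, hhom (MvPolynomial.mem_support_iff.1 hα)]
          rfl
        rw [Finset.sum_congr rfl h5, ← Finset.sum_mul, ← map_sum, hsum]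
        simp
      rw [← hI] at hpI
      obtain ⟨h', hh', hhp⟩ := hL.exists_lift_component hf hpI v
      rw [hhom.weightedHomogeneousComponent_same] at hhp
      refine ⟨(h - (p : MvPowerSeries (Fin n) K)) + h', fun β hβ => ?_, ?_⟩
      · by_contra hlt
        apply hβ
        rw [map_add, not_not.1 (mt (hrest β) hlt), not_not.1 (mt (hh' β) hlt), add_zero]
      · rw [subst_add D.hasSubst_xiOne, ← hhp, ← subst_add D.hasSubst_xiOne, sub_add_cancel, hhg]
  obtain ⟨h, hh, hhg⟩ := key (k + 1) le_rfl
  exact hgk.1 (hhg ▸ D.coeff_subst_xiOne_eq_zero hh (Nat.lt_succ_self k))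

/-- The family `s^(ℓ_j) x_j` of convergent series. -/
def scaledXC (D : Deformation K n) (j : Fin n) : convergentSeries (Fin n ⊕ Unit) K :=
  convergentX (Sum.inr ()) ^ D.ell j * convergentX (Sum.inl j)

theorem constantCoeff_scaledXC (D : Deformation K n) (j : Fin n) :
    constantCoeff (D.scaledXC j).1 = 0 :=
  D.constantCoeff_scaledX j

/-- The substitution `x_j ↦ s^(ℓ_j) x_j`. -/
def substScaled (D : Deformation K n) :
    convergentSeries (Fin n) K →ₐ[K] convergentSeries (Fin n ⊕ Unit) K :=
  convergentSubst D.scaledXC D.constantCoeff_scaledXC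

theorem coe_substScaled (h : convergentSeries (Fin n) K) :
    (D.substScaled h).1 = subst D.scaledX h.1 :=
  coe_convergentSubst _ _ _

/-- The homogeneous series of degree `e` with value `h` at `s = 1`. -/
def homogenize (D : Deformation K n) (e : ℕ) (h : convergentSeries (Fin n) K) :
    convergentSeries (Fin n ⊕ Unit) K :=
  ⟨divPart (Finsupp.single (Sum.inr ()) e) Set.univ (D.substScaled h).1,
    (D.substScaled h).2.divPart _ _⟩

theorem coeff_homogenize (e : ℕ) (h : convergentSeries (Fin n) K) (β : Fin n →₀ ℕ) (k : ℕ) :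
    coeff (Finsupp.sumElim β (Finsupp.single () k)) (D.homogenize e h).1 =
      if k + e = Finsupp.weight D.ell β then coeff β h.1 else 0 := by
  classical
  rw [homogenize, coeff_divPart, if_pos (Set.mem_univ _), coe_substScaled, sumElim_eq_add,
    add_assoc, ← Finsupp.single_add, ← sumElim_eq_add, coeff_subst_scaledX]

theorem isHomogeneous_homogenize (e : ℕ) (h : convergentSeries (Fin n) K) :
    D.IsHomogeneous e (D.homogenize e h).1 := by
  intro α hα
  obtain ⟨β, k, rfl⟩ := eq_sumElim α
  rw [coeff_homogenize] at hα
  split_ifs at hα with hk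
  · rw [weight_sumElim]
    omega
  · exact absurd rfl hα

theorem atOne_homogenize {e : ℕ} {h : convergentSeries (Fin n) K}
    (hh : ∀ β, coeff β h.1 ≠ 0 → e ≤ Finsupp.weight D.ell β) :
    atOne (D.homogenize e h).1 = h.1 := by
  ext β
  by_cases hβ : e ≤ Finsupp.weight D.ell β
  · rw [(isHomogeneous_homogenize e h).coeff_atOne (k := Finsupp.weight D.ell β - e) (by omega),
      coeff_homogenize, if_pos (by omega)]
  · rw [(isHomogeneous_homogenize e h).coeff_atOne_eq_zero (by omega)]
    exact (not_not.1 (mt (hh β) hβ)).symm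

/-- The liftings are returned as explicit homogenizations: the comparison with the Rees algebra
needs f'_i to come from a polynomial over K{y}. -/
theorem exists_isLifting_homogenize [CompleteSpace K] (hgcd : Finset.univ.gcd D.ell = 1)
    (hf : ∀ i, ∃ α β : Fin n →₀ ℕ, α ≠ β ∧
      Finsupp.weight D.ell α = d i ∧ Finsupp.weight D.ell β = d i ∧
      f i = MvPolynomial.monomial α 1 - MvPolynomial.monomial β 1)
    (hΓ : D.valueSemigroup = (D.semigroup : Set ℕ)) :
    ∃ h : Fin m → convergentSeries (Fin n) K,
      (∀ i β, coeff β (h i).1 ≠ 0 → d i + 1 ≤ Finsupp.weight D.ell β) ∧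
      D.IsLifting f d fun i => D.homogenize (d i + 1) (h i) := by
  have key : ∀ i, ∃ h : convergentSeries (Fin n) K,
      subst (D.xiOne : Fin n → MvPowerSeries Unit K) h.1 =
        subst (D.xiOne : Fin n → MvPowerSeries Unit K) (f i : MvPowerSeries (Fin n) K) ∧
      ∀ β, coeff β h.1 ≠ 0 → (d i : ℕ∞) + D.delta ≤ (Finsupp.weight D.ell β : ℕ∞) := by
    intro i
    obtain ⟨α, β, -, hα, hβ, hfi⟩ := hf i
    have hval := subst_xiOne_binomial (D := D) hfi
    -- Both monomials are t^(d_i) (1 + t^k ⋯), so the leading terms cancel.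
    have hlow : ∀ k : ℕ, (k : ℕ∞) ≤ D.delta → ∀ l < d i + k,
        PowerSeries.coeff l (D.xiOneMonomial α - D.xiOneMonomial β) = 0 := by
      intro k hk l hl
      have hk' : ∀ j, (k : ℕ∞) ≤ D.gap j := fun j => hk.trans (iInf_le _ j)
      obtain ⟨u, hu⟩ := D.xiOneMonomial_eq_mul α hk'
      obtain ⟨v, hv⟩ := D.xiOneMonomial_eq_mul β hk'
      have : D.xiOneMonomial α - D.xiOneMonomial β = PowerSeries.X ^ (d i + k) * (u - v) := by
        rw [hu, hv, hα, hβ]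
        ring
      rw [this, PowerSeries.coeff_X_pow_mul', if_neg (by omega)]
    cases hδ : D.delta with
    | top =>
      -- For δ = ∞ the two monomials agree to every order at ξ', so f_i(ξ') = 0 and the zero series
      -- lifts it.
      refine ⟨0, ?_, fun β hβ => absurd (map_zero _) hβ⟩
      have h0 : D.xiOneMonomial α - D.xiOneMonomial β = 0 := by
        ext l
        exact hlow (l + 1) (by rw [hδ]; exact le_top) l (by omega)
      rw [hval, h0]
      exact (substAlgHom_apply D.hasSubst_xiOne 0).symm.trans (map_zero _)
    | coe k =>
      obtain ⟨h, hh, hh'⟩ := D.exists_lift_of_le_order hgcd hΓ (d i + k)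
        (D.xiOneMonomial α - D.xiOneMonomial β)
        (sub_mem (D.mem_curveRing.2 ⟨_, D.substOne_monomial α⟩)
          (D.mem_curveRing.2 ⟨_, D.substOne_monomial β⟩)) (hlow k hδ.ge)
      refine ⟨h, ?_, fun β hβ => by exact_mod_cast hh' β hβ⟩
      rw [hval, ← hh, coe_substOne]
  choose h hh hhδ using key
  have hhd : ∀ i β, coeff β (h i).1 ≠ 0 → d i + 1 ≤ Finsupp.weight D.ell β := by
    intro i β hβ
    have h2 : ((1 : ℕ) : ℕ∞) ≤ D.delta := le_iInf D.one_le_gap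
    have h3 := (add_le_add_right h2 (d i : ℕ∞)).trans (hhδ i β hβ)
    exact_mod_cast h3
  refine ⟨h, hhd, fun i => ⟨_, isHomogeneous_homogenize _ _⟩,
    fun i => ?_, fun i => ?_⟩
  · obtain ⟨α, β, -, hα, hβ, hfi⟩ := hf i
    have h1 := X_pow_mul_aeval_binomial hα hβ hfi
    have h2 := (isHomogeneous_homogenize (D := D) (d i + 1) (h i)).X_pow_mul_subst_eq
      (a := d i + 1) (b := 0) (by simp)
    rw [atOne_homogenize (hhd i), hh i, subst_xiOne_binomial hfi, ← h1, pow_zero, one_mul] at h2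
    refine mul_left_cancel₀ (X_one_pow_ne_zero (d i)) ?_
    rw [← h2, pow_succ]
    ring
  · rw [atOne_homogenize (hhd i)]
    refine le_weightedOrder _ fun β hβ => ?_
    by_contra hne
    exact absurd (hhδ i β hne) (not_le.2 hβ)

end Semigroup

end Deformation

end CurveDeformation

end

noncomputable section

namespace CurveDeformation

open MvPowerSeries

namespace Deformation

/-! ### The total space of the deformation -/

section Total

variable {K : Type*} [NontriviallyNormedField K] {n m : ℕ} {D : Deformation K n}
  {f : Fin m → MvPolynomial (Fin n) K} {d : Fin m → ℕ}

/-- The substitution `x_j ↦ ξ_j`, `s ↦ s`. -/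
def toTotal (D : Deformation K n) : convergentSeries (Fin n ⊕ Unit) K →ₐ[K] D.totalRing :=
  ((substAlgHom D.hasSubst_xiS).comp (convergentSeries (Fin n ⊕ Unit) K).val).codRestrict _
    fun h => ⟨h.1, h.2, rfl⟩

theorem coe_toTotal (h : convergentSeries (Fin n ⊕ Unit) K) :
    (D.toTotal h : MvPowerSeries (Fin 2) K) = subst D.xiS h.1 :=
  substAlgHom_apply D.hasSubst_xiS h.1

theorem toTotal_surjective (D : Deformation K n) : Function.Surjective D.toTotal := by
  rintro ⟨_, h, hh, rfl⟩
  exact ⟨⟨h, hh⟩, rfl⟩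

/-- A polynomial in the variables `x_j` as a convergent series in `x` and `s`. -/
def polyXS : MvPolynomial (Fin n) K →ₐ[K] convergentSeries (Fin n ⊕ Unit) K :=
  MvPolynomial.aeval fun j => convergentX (Sum.inl j)

theorem convergentOfPoly_rename (p : MvPolynomial (Fin n) K) :
    convergentOfPoly (MvPolynomial.rename Sum.inl p) = polyXS p := by
  rw [convergentOfPoly_eq_aeval, MvPolynomial.aeval_rename]
  rfl

theorem coe_toTotal_polyXS (p : MvPolynomial (Fin n) K) :
    (D.toTotal (polyXS p) : MvPowerSeries (Fin 2) K) =
      ((MvPolynomial.aeval D.xi p : MvPolynomial (Fin 2) K) : MvPowerSeries (Fin 2) K) := by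
  rw [coe_toTotal, ← convergentOfPoly_rename]
  change subst D.xiS ((MvPolynomial.rename Sum.inl p : MvPolynomial (Fin n ⊕ Unit) K) :
    MvPowerSeries (Fin n ⊕ Unit) K) = _
  rw [subst_coe, MvPolynomial.aeval_rename]
  have h : ∀ q : MvPolynomial (Fin 2) K, (q : MvPowerSeries (Fin 2) K) =
      MvPolynomial.coeToMvPowerSeries.algHom K q := fun q => by
    simp [MvPolynomial.coeToMvPowerSeries.algHom_apply]
  rw [h, ← AlgHom.comp_apply, MvPolynomial.comp_aeval]
  congr 2

theorem coe_toTotal_s (D : Deformation K n) :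
    (D.toTotal (convergentX (Sum.inr ())) : MvPowerSeries (Fin 2) K) = X 1 := by
  rw [coe_toTotal]
  exact subst_X D.hasSubst_xiS _

theorem totalIdeal_eq (f' : Fin m → convergentSeries (Fin n ⊕ Unit) K) :
    totalIdeal f f' = Ideal.span (Set.range fun i =>
      polyXS (f i) - f' i * convergentX (Sum.inr ())) := by
  simp only [totalIdeal, convergentOfPoly_rename]

theorem IsLifting.totalIdeal_le {f' : Fin m → convergentSeries (Fin n ⊕ Unit) K}
    (hL : D.IsLifting f d f') : totalIdeal f f' ≤ RingHom.ker D.toTotal := by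
  rw [totalIdeal_eq, Ideal.span_le]
  rintro _ ⟨i, rfl⟩
  change D.toTotal _ = 0
  apply Subtype.ext
  have h1 : (D.toTotal (polyXS (f i) - f' i * convergentX (Sum.inr ())) :
      MvPowerSeries (Fin 2) K) = (D.toTotal (polyXS (f i)) : MvPowerSeries (Fin 2) K) -
      D.toTotal (f' i) * D.toTotal (convergentX (Sum.inr ())) := by
    rw [map_sub, map_mul]
    rfl
  rw [h1, coe_toTotal_polyXS, coe_toTotal_s, hL.eq_mul i, coe_toTotal]
  exact sub_self _

/-- Modulo the ideal of the total space, a relation among the `t^(ℓ_j)` is divisible by `s`. -/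
theorem exists_polyXS_sub_mem (f' : Fin m → convergentSeries (Fin n ⊕ Unit) K)
    {p : MvPolynomial (Fin n) K} (hp : p ∈ Ideal.span (Set.range f)) :
    ∃ r : convergentSeries (Fin n ⊕ Unit) K,
      polyXS p - convergentX (Sum.inr ()) * r ∈ totalIdeal f f' := by
  obtain ⟨c, rfl⟩ := (Submodule.mem_span_range_iff_exists_fun _).1 hp
  refine ⟨∑ i, polyXS (c i) * f' i, ?_⟩
  have h1 : polyXS (∑ i, c i • f i) - convergentX (Sum.inr ()) * ∑ i, polyXS (c i) * f' i =
      ∑ i, polyXS (c i) * (polyXS (f i) - f' i * convergentX (Sum.inr ())) := by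
    rw [map_sum, Finset.mul_sum, ← Finset.sum_sub_distrib]
    refine Finset.sum_congr rfl fun i _ => ?_
    rw [smul_eq_mul, map_mul]
    ring
  rw [h1, totalIdeal_eq]
  exact sum_mem fun i _ => Ideal.mul_mem_left _ _ (Ideal.subset_span ⟨i, rfl⟩)

theorem exists_surjective_ker_eq.{u} {A : Type u} [CommRing A] (I : Ideal A) :
    ∃ (B : Type u) (_ : CommRing B) (φ : A →+* B), Function.Surjective φ ∧ RingHom.ker φ = I :=
  ⟨A ⧸ I, inferInstance, Ideal.Quotient.mk I, Ideal.Quotient.mk_surjective, Ideal.mk_ker⟩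

/-- Monomials of minimal weight in the residue classes modulo `ℓ_(j₀)`. -/
theorem exists_apery (D : Deformation K n) (hgcd : Finset.univ.gcd D.ell = 1) (j₀ : Fin n) :
    ∃ γ : Fin (D.ell j₀) → Fin n →₀ ℕ,
      (∀ r, Finsupp.weight D.ell (γ r) % D.ell j₀ = r) ∧
      ∀ α : Fin n →₀ ℕ, ∃ r c, Finsupp.weight D.ell α = Finsupp.weight D.ell (γ r) + c * D.ell j₀ := by
  classical
  obtain ⟨c, hc⟩ := D.exists_weight_eq_of_ge hgcd
  have hpos := D.ell_pos j₀
  have hex : ∀ r : Fin (D.ell j₀), ∃ k, (∃ α : Fin n →₀ ℕ, Finsupp.weight D.ell α = k) ∧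
      k % D.ell j₀ = r := by
    intro r
    -- A multiple of ℓ_(j₀) that exceeds the conductor moves r into Γ without changing its residue.
    refine ⟨r + D.ell j₀ * c, hc _ ?_, ?_⟩
    · nlinarith
    · rw [Nat.add_mul_mod_self_left, Nat.mod_eq_of_lt r.2]
  choose γ hγ using fun r => (Nat.find_spec (hex r)).1
  refine ⟨γ, fun r => by rw [hγ]; exact (Nat.find_spec (hex r)).2, fun α => ?_⟩
  let r : Fin (D.ell j₀) := ⟨Finsupp.weight D.ell α % D.ell j₀, Nat.mod_lt _ hpos⟩
  have h1 : Nat.find (hex r) ≤ Finsupp.weight D.ell α := Nat.find_min' (hex r) ⟨⟨α, rfl⟩, rfl⟩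
  have h2 := (Nat.find_spec (hex r)).2
  have h3 : D.ell j₀ ∣ Finsupp.weight D.ell α - Nat.find (hex r) :=
    (Nat.modEq_iff_dvd' h1).1 h2
  obtain ⟨k, hk⟩ := h3
  refine ⟨r, k, ?_⟩
  rw [hγ, mul_comm k]
  omega

/-- The variables `x_(j₀)` and `s`. -/
def baseEmb (j₀ : Fin n) : Fin 1 ⊕ Unit ↪ Fin n ⊕ Unit :=
  ⟨Sum.map (fun _ => j₀) id, Sum.map_injective.2
    ⟨fun _ _ _ => Subsingleton.elim _ _, Function.injective_id⟩⟩

/-- The finiteness theorem over K{x_(j₀), s}: modulo s the F_i become the f_i, so monomials of equal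
weight agree and each one is a power of x_(j₀) times an Apéry monomial. -/
theorem exists_combination [CompleteSpace K] {B : Type*} [CommRing B]
    (hI : Ideal.span (Set.range f) = D.monomialIdeal)
    (f' : Fin m → convergentSeries (Fin n ⊕ Unit) K) (j₀ : Fin n)
    {γ : Fin (D.ell j₀) → Fin n →₀ ℕ}
    (hγ : ∀ α : Fin n →₀ ℕ,
      ∃ r c, Finsupp.weight D.ell α = Finsupp.weight D.ell (γ r) + c * D.ell j₀)
    (φ : convergentSeries (Fin n ⊕ Unit) K →+* B) (hφ : Function.Surjective φ)
    (hφ' : totalIdeal f f' ≤ RingHom.ker φ) (h : convergentSeries (Fin n ⊕ Unit) K) :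
    ∃ H : Fin (D.ell j₀) → convergentSeries (Fin 1 ⊕ Unit) K,
      φ h = ∑ r, φ (convergentRename (baseEmb j₀) (H r)) *
        φ (polyXS (MvPolynomial.monomial (γ r) 1)) := by
  classical
  have heq : ∀ x y, x - y ∈ totalIdeal f f' → φ x = φ y := fun x y hxy =>
    sub_eq_zero.1 ((map_sub φ x y).symm.trans (hφ' hxy))
  have hs : (convergentRename (baseEmb j₀) (convergentX (Sum.inr ())) :
      convergentSeries (Fin n ⊕ Unit) K) = convergentX (Sum.inr ()) := Subtype.ext (rename_X _ _)
  have hx : (convergentRename (baseEmb j₀) (convergentX (Sum.inl 0)) :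
      convergentSeries (Fin n ⊕ Unit) K) = convergentX (Sum.inl j₀) := Subtype.ext (rename_X _ _)
  -- The relation x_j^(ℓ_(j₀)) - x_(j₀)^(ℓ_j) lies in the monomial ideal, hence is divisible by s
  -- modulo the F_i. Every monomial of the resulting E_j involves x_(j₀) or s.
  have hE : ∀ j : Fin n, ∃ r : convergentSeries (Fin n ⊕ Unit) K,
      convergentX (Sum.inl j) ^ D.ell j₀ - (convergentX (Sum.inl j₀) ^ D.ell j +
        convergentX (Sum.inr ()) * r) ∈ totalIdeal f f' := by
    intro j
    have h1 : (MvPolynomial.monomial (Finsupp.single j (D.ell j₀)) 1 -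
        MvPolynomial.monomial (Finsupp.single j₀ (D.ell j)) 1 : MvPolynomial (Fin n) K) ∈
          Ideal.span (Set.range f) := by
      rw [hI]
      apply sub_mem_monomialIdeal
      rw [Finsupp.weight_single, Finsupp.weight_single, smul_eq_mul, smul_eq_mul, mul_comm]
    obtain ⟨r, hr⟩ := exists_polyXS_sub_mem f' h1
    refine ⟨r, ?_⟩
    rw [← MvPolynomial.X_pow_eq_monomial, ← MvPolynomial.X_pow_eq_monomial, map_sub, map_pow,
      map_pow, polyXS, MvPolynomial.aeval_X, MvPolynomial.aeval_X] at hr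
    rwa [← sub_sub]
  choose R hR using hE
  let E : Fin n ⊕ Unit → convergentSeries (Fin n ⊕ Unit) K := Sum.elim
    (fun j => convergentX (Sum.inl j₀) ^ D.ell j + convergentX (Sum.inr ()) * R j) fun _ => 0
  refine exists_eq_sum_of_division (baseEmb j₀) φ hφ
    (p := D.ell j₀) E ?_ ?_ (fun r => φ (polyXS (MvPolynomial.monomial (γ r) 1))) ?_ (φ h)
  · rintro (j | j) hj α hα
    · left
      have h1 : coeff α (E (Sum.inl j)).1 = coeff α (X (Sum.inl j₀) ^ D.ell j) +
        coeff α (X (Sum.inr ()) * (R j).1) := rfl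
      rw [h1] at hα
      by_cases h2 : α = Finsupp.single (Sum.inl j₀) (D.ell j)
      · exact ⟨Sum.inl j₀, ⟨Sum.inl 0, rfl⟩, by rw [h2]; simp [(D.ell_pos j).ne']⟩
      · rw [coeff_X_pow, if_neg h2, zero_add, X, coeff_monomial_mul] at hα
        split_ifs at hα with h3
        · refine ⟨Sum.inr (), ⟨Sum.inr (), rfl⟩, ?_⟩
          have := Finsupp.single_le_iff.1 h3
          omega
        · exact absurd rfl hα
    · exact absurd ⟨Sum.inr (), rfl⟩ hj
  · rintro (j | j) hj
    · rw [← map_pow]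
      exact heq _ _ (hR j)
    · exact absurd ⟨Sum.inr (), rfl⟩ hj
  · intro β hβ
    obtain ⟨β', k, rfl⟩ := eq_sumElim β
    have hk : k = 0 := by
      have := hβ (Sum.inr ()) ⟨Sum.inr (), rfl⟩
      simpa using this
    subst hk
    obtain ⟨r, c, hrc⟩ := hγ β'
    have h1 : (MvPolynomial.monomial β' 1 - MvPolynomial.monomial (Finsupp.single j₀ c + γ r) 1 :
        MvPolynomial (Fin n) K) ∈ Ideal.span (Set.range f) := by
      rw [hI]
      apply sub_mem_monomialIdeal
      rw [hrc, map_add, Finsupp.weight_single, smul_eq_mul, add_comm]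
    obtain ⟨q, hq⟩ := exists_polyXS_sub_mem f' h1
    have h2 : convergentOfPoly (MvPolynomial.monomial
        (Finsupp.sumElim β' (Finsupp.single () 0)) (1 : K)) =
        polyXS (MvPolynomial.monomial β' 1) := by
      rw [← convergentOfPoly_rename, MvPolynomial.rename_monomial, sumElim_eq_add]
      simp
    rw [h2]
    -- One Apéry monomial, multiplied by x_(j₀)^c, represents x^β' up to an s-multiple, as
    -- Nakayama's lemma requires.
    refine ⟨Pi.single r (convergentX (Sum.inl 0) ^ c), convergentX (Sum.inr ()), φ q,
      constantCoeff_X _, ?_⟩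
    rw [Finset.sum_eq_single r]
    · rw [Pi.single_eq_same, map_pow, hx, hs, ← map_mul, ← map_mul, ← map_add]
      refine heq _ _ ?_
      have h4 : polyXS (MvPolynomial.monomial (Finsupp.single j₀ c + γ r) (1 : K)) =
          convergentX (Sum.inl j₀) ^ c * polyXS (MvPolynomial.monomial (γ r) 1) := by
        rw [show (MvPolynomial.monomial (Finsupp.single j₀ c + γ r) (1 : K)) =
          MvPolynomial.monomial (Finsupp.single j₀ c) 1 * MvPolynomial.monomial (γ r) 1 by
            rw [MvPolynomial.monomial_mul, one_mul], map_mul,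
          ← MvPolynomial.X_pow_eq_monomial, map_pow, polyXS, MvPolynomial.aeval_X]
      rw [map_sub, h4] at hq
      rwa [← sub_sub]
    · intro r' _ hr'
      rw [Pi.single_eq_of_ne hr', map_zero, map_zero, zero_mul]
    · exact fun h => absurd (Finset.mem_univ r) h

/-- The value at `s = 0` of a series in `t` and `s`. -/
def atZero : MvPowerSeries (Fin 2) K →ₐ[K] PowerSeries K :=
  substAlgHom (a := ![(X () : MvPowerSeries Unit K), 0])
    (hasSubst_of_constantCoeff_zero fun i => by fin_cases i <;> simp)

theorem atZero_coe (p : MvPolynomial (Fin 2) K) :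
    atZero (p : MvPowerSeries (Fin 2) K) =
      MvPolynomial.aeval ![(PowerSeries.X : PowerSeries K), 0] p :=
  substAlgHom_coe _ p

theorem atZero_xi (j : Fin n) :
    atZero (D.xi j : MvPowerSeries (Fin 2) K) = PowerSeries.X ^ D.ell j := by
  rw [atZero_coe, xi, map_add, map_finsuppSum, map_pow, MvPolynomial.aeval_X]
  rw [Finsupp.sum, Finset.sum_eq_zero, add_zero]
  · rfl
  · intro i hi
    have h1 : D.ell j + 1 ≤ i := by
      have := (add_le_add_right (D.one_le_gap j) _).trans
        (D.le_of_tail_ne_zero j i (Finsupp.mem_support_iff.1 hi))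
      exact_mod_cast this
    simp [show i - D.ell j ≠ 0 by omega]

/-- The family `ξ_(j₀), s`. -/
def baseFamily (D : Deformation K n) (j₀ : Fin n) : Fin 1 ⊕ Unit → MvPowerSeries (Fin 2) K :=
  fun i => D.xiS (baseEmb j₀ i)

theorem constantCoeff_xiS (D : Deformation K n) (i : Fin n ⊕ Unit) :
    constantCoeff (D.xiS i) = 0 := by
  rcases i with j | _
  · have h1 : constantCoeff (atZero (D.xi j : MvPowerSeries (Fin 2) K) : MvPowerSeries Unit K) =
        constantCoeff (D.xi j : MvPowerSeries (Fin 2) K) := by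
      rw [atZero, substAlgHom_apply]
      exact constantCoeff_subst_eq (fun i => by fin_cases i <;> simp) _
    rw [atZero_xi] at h1
    refine h1.symm.trans ?_
    change PowerSeries.constantCoeff _ = 0
    simp [(D.ell_pos j).ne']
  · simp [xiS]

theorem hasSubst_baseFamily (D : Deformation K n) (j₀ : Fin n) : HasSubst (D.baseFamily j₀) :=
  hasSubst_of_constantCoeff_zero fun _ => D.constantCoeff_xiS _

/-- At s = 0 the series ξ_(j₀) becomes t^(ℓ_(j₀)), so only exponents divisible by ℓ_(j₀) survive. -/
theorem coeff_atZero_subst_baseFamily (D : Deformation K n) (j₀ : Fin n)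
    (H : MvPowerSeries (Fin 1 ⊕ Unit) K) (N : ℕ) :
    PowerSeries.coeff N (atZero (subst (D.baseFamily j₀) H)) =
      if D.ell j₀ ∣ N then coeff (Finsupp.single (Sum.inl 0) (N / D.ell j₀)) H else 0 := by
  classical
  let b : Fin 1 ⊕ Unit → MvPowerSeries Unit K :=
    Sum.elim (fun _ => (PowerSeries.X : PowerSeries K) ^ D.ell j₀) fun _ => 0
  have hb : HasSubst b := by
    refine hasSubst_of_constantCoeff_zero fun i => ?_
    rcases i with i | i
    · change PowerSeries.constantCoeff ((PowerSeries.X : PowerSeries K) ^ D.ell j₀) = 0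
      simp [(D.ell_pos j₀).ne']
    · simp [b]
  have h1 : atZero (subst (D.baseFamily j₀) H) = subst b H := by
    rw [atZero, substAlgHom_apply, subst_comp_subst_apply (D.hasSubst_baseFamily j₀)]
    · congr 1
      funext i
      rcases i with i | i
      · rw [← substAlgHom_apply]
        exact atZero_xi j₀
      · change subst _ (X 1) = _
        rw [subst_X]
        · rfl
        · exact hasSubst_of_constantCoeff_zero fun i => by fin_cases i <;> simp
    · exact hasSubst_of_constantCoeff_zero fun i => by fin_cases i <;> simp
  have hprod : ∀ α : (Fin 1 ⊕ Unit) →₀ ℕ, (α.prod fun i k => b i ^ k) =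
      (if α (Sum.inr ()) = 0 then PowerSeries.X ^ (D.ell j₀ * α (Sum.inl 0)) else 0 :
        PowerSeries K) := by
    intro α
    rw [Finsupp.prod_fintype _ _ fun _ => pow_zero _, Fintype.prod_sum_type]
    simp only [b, Sum.elim_inl, Sum.elim_inr, Finset.univ_unique, Finset.prod_singleton]
    change ((PowerSeries.X : PowerSeries K) ^ D.ell j₀) ^ α (Sum.inl 0) *
      (0 : PowerSeries K) ^ α (Sum.inr ()) = _
    split_ifs with h
    · rw [h, pow_zero, mul_one, ← pow_mul]
    · rw [zero_pow h, mul_zero]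
  have hpos := D.ell_pos j₀
  rw [h1, PowerSeries.coeff, coeff_subst hb, finsum_eq_single _
    (Finsupp.single (Sum.inl 0) (N / D.ell j₀))]
  · rw [hprod, if_pos (by simp)]
    change coeff _ H * PowerSeries.coeff N (PowerSeries.X ^ _ : PowerSeries K) = _
    rw [PowerSeries.coeff_X_pow]
    simp only [Finsupp.single_eq_same]
    by_cases h : D.ell j₀ ∣ N
    · rw [if_pos h, if_pos (Nat.mul_div_cancel' h).symm, mul_one]
    · rw [if_neg h, if_neg fun h' => h ⟨_, h'⟩, mul_zero]
  · intro α hα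
    rw [hprod]
    change coeff α H * PowerSeries.coeff N (if α (Sum.inr ()) = 0 then
      PowerSeries.X ^ (D.ell j₀ * α (Sum.inl 0)) else 0 : PowerSeries K) = 0
    split_ifs with h
    · rw [PowerSeries.coeff_X_pow, if_neg, mul_zero]
      intro h'
      apply hα
      ext (i | i)
      · rw [h', Nat.mul_div_cancel_left _ hpos, Subsingleton.elim i 0]
        simp
      · simpa using h
    · rw [map_zero, mul_zero]

/-- The monomials of an Apéry set are independent over `K⟦ξ_(j₀), s⟧`. -/
theorem coeff_eq_zero_of_combination (D : Deformation K n) (j₀ : Fin n)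
    {γ : Fin (D.ell j₀) → Fin n →₀ ℕ}
    (hγ : ∀ r, Finsupp.weight D.ell (γ r) % D.ell j₀ = r) (k : ℕ)
    (H : Fin (D.ell j₀) → MvPowerSeries (Fin 1 ⊕ Unit) K)
    (hH : ∑ r, subst (D.baseFamily j₀) (H r) *
      ((MvPolynomial.aeval D.xi (MvPolynomial.monomial (γ r) (1 : K)) : MvPolynomial (Fin 2) K) :
        MvPowerSeries (Fin 2) K) = 0) (r : Fin (D.ell j₀)) (α : (Fin 1 ⊕ Unit) →₀ ℕ)
    (hα : α (Sum.inr ()) = k) : coeff α (H r) = 0 := by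
  classical
  have hmon : ∀ γ : Fin n →₀ ℕ, atZero ((MvPolynomial.aeval D.xi
      (MvPolynomial.monomial γ (1 : K)) : MvPolynomial (Fin 2) K) : MvPowerSeries (Fin 2) K) =
      PowerSeries.X ^ Finsupp.weight D.ell γ := by
    intro γ
    rw [atZero_coe, MvPolynomial.aeval_monomial, map_one, one_mul, map_finsuppProd,
      Finsupp.weight_apply, Finsupp.sum, ← Finset.prod_pow_eq_pow_sum]
    refine Finset.prod_congr rfl fun j _ => ?_
    dsimp only
    rw [map_pow, ← atZero_coe, atZero_xi, ← pow_mul, smul_eq_mul, mul_comm]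
  have hpos := D.ell_pos j₀
  have base : ∀ H : Fin (D.ell j₀) → MvPowerSeries (Fin 1 ⊕ Unit) K,
      ∑ r, subst (D.baseFamily j₀) (H r) * ((MvPolynomial.aeval D.xi
        (MvPolynomial.monomial (γ r) (1 : K)) : MvPolynomial (Fin 2) K) :
          MvPowerSeries (Fin 2) K) = 0 →
      ∀ (r : Fin (D.ell j₀)) (α : (Fin 1 ⊕ Unit) →₀ ℕ), α (Sum.inr ()) = 0 →
        coeff α (H r) = 0 := by
    intro H hH r α hα
    -- At s = 0 the r-th summand involves only exponents congruent to the weight of `γ r` modulo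
    -- ℓ_(j₀). These classes are distinct, so this coefficient isolates one coefficient of `H r`.
    have h1 := congrArg (PowerSeries.coeff
      (D.ell j₀ * α (Sum.inl 0) + Finsupp.weight D.ell (γ r))) (congrArg atZero hH)
    rw [map_sum, map_zero, map_zero, map_sum, Finset.sum_eq_single r] at h1
    · rw [map_mul, hmon, PowerSeries.coeff_mul_X_pow, coeff_atZero_subst_baseFamily,
        if_pos (dvd_mul_right _ _), Nat.mul_div_cancel_left _ hpos] at h1
      rw [← h1]
      congr 1
      congr 1
      ext (i | i)
      · rw [Subsingleton.elim i 0]; simp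
      · simpa using hα
    · intro r' _ hr'
      rw [map_mul, hmon, PowerSeries.coeff_mul_X_pow']
      split_ifs with hle
      · rw [coeff_atZero_subst_baseFamily, if_neg]
        intro hdvd
        apply hr'
        have h2 := (Nat.modEq_iff_dvd' hle).2 hdvd
        have h3 : Finsupp.weight D.ell (γ r') % D.ell j₀ =
            Finsupp.weight D.ell (γ r) % D.ell j₀ := by
          rw [Nat.ModEq, Nat.mul_add_mod] at h2
          exact h2
        rw [hγ, hγ] at h3
        exact Fin.ext h3
      · rfl
    · exact fun h => absurd (Finset.mem_univ r) h
  induction k generalizing H r α with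
  | zero => exact base H hH r α hα
  | succ k ih =>
    let e : (Fin 1 ⊕ Unit) →₀ ℕ := Finsupp.single (Sum.inr ()) 1
    -- The case s = 0 makes every `H r` divisible by s. Cancelling s gives a relation of the same
    -- kind, and the exponent of s drops by one.
    have hdiv : ∀ r, H r = X (Sum.inr ()) * divPart e Set.univ (H r) := by
      intro r
      ext β
      rw [show (X (Sum.inr ()) : MvPowerSeries (Fin 1 ⊕ Unit) K) = monomial e 1 from rfl,
        coeff_monomial_mul, one_mul]
      split_ifs with hle
      · rw [coeff_divPart, if_pos (Set.mem_univ _), tsub_add_cancel_of_le hle]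
      · refine base H hH r β ?_
        rw [Finsupp.single_le_iff] at hle
        omega
    have hX : subst (D.baseFamily j₀) (X (Sum.inr ()) : MvPowerSeries (Fin 1 ⊕ Unit) K) =
        (X 1 : MvPowerSeries (Fin 2) K) :=
      subst_X (D.hasSubst_baseFamily j₀) _
    have hH' : ∑ r, subst (D.baseFamily j₀) (divPart e Set.univ (H r)) *
        ((MvPolynomial.aeval D.xi (MvPolynomial.monomial (γ r) (1 : K)) :
          MvPolynomial (Fin 2) K) : MvPowerSeries (Fin 2) K) = 0 := by
      refine (mul_eq_zero.1 ?_).resolve_left (Deformation.X_one_pow_ne_zero (K := K) 1)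
      rw [pow_one, Finset.mul_sum, ← hH]
      refine Finset.sum_congr rfl fun r _ => ?_
      conv_rhs => rw [hdiv r, subst_mul (D.hasSubst_baseFamily j₀), hX]
      rw [mul_assoc]
    have hle : e ≤ α := by
      rw [Finsupp.single_le_iff]
      omega
    have h1 := ih _ hH' r (α - e) (by simp [e, hα])
    rw [coeff_divPart, if_pos (Set.mem_univ _), tsub_add_cancel_of_le hle] at h1
    exact h1

theorem subst_xiS_rename (D : Deformation K n) {τ : Type*} [Finite τ] (e : τ ↪ Fin n ⊕ Unit)
    (h : MvPowerSeries τ K) :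
    subst D.xiS (MvPowerSeries.rename e h) = subst (fun i => D.xiS (e i)) h := by
  rw [rename_eq_subst, subst_comp_subst_apply (HasSubst.X_comp _) D.hasSubst_xiS]
  congr 1
  funext i
  exact subst_X D.hasSubst_xiS _

theorem exists_combination_sub_mem [CompleteSpace K]
    (hI : Ideal.span (Set.range f) = D.monomialIdeal)
    (f' : Fin m → convergentSeries (Fin n ⊕ Unit) K) (j₀ : Fin n)
    {γ : Fin (D.ell j₀) → Fin n →₀ ℕ}
    (hγ : ∀ α : Fin n →₀ ℕ,
      ∃ r c, Finsupp.weight D.ell α = Finsupp.weight D.ell (γ r) + c * D.ell j₀)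
    (h : convergentSeries (Fin n ⊕ Unit) K) :
    ∃ H : Fin (D.ell j₀) → convergentSeries (Fin 1 ⊕ Unit) K,
      h - ∑ r, convergentRename (baseEmb j₀) (H r) * polyXS (MvPolynomial.monomial (γ r) 1) ∈
        totalIdeal f f' := by
  obtain ⟨B, _, φ, hφ, hker⟩ := exists_surjective_ker_eq (totalIdeal f f')
  obtain ⟨H, hH⟩ := exists_combination hI f' j₀ hγ φ hφ hker.ge h
  refine ⟨H, ?_⟩
  rw [← hker, RingHom.mem_ker, map_sub, sub_eq_zero, hH, map_sum]
  exact Finset.sum_congr rfl fun r _ => (map_mul φ _ _).symm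

/-- A series is an Apéry combination modulo the F_i. If it vanishes at (ξ, s), independence of the
Apéry monomials kills all coefficients. -/
theorem IsLifting.ker_toTotal [CompleteSpace K] {f' : Fin m → convergentSeries (Fin n ⊕ Unit) K}
    (hL : D.IsLifting f d f') (hgcd : Finset.univ.gcd D.ell = 1)
    (hI : Ideal.span (Set.range f) = D.monomialIdeal) :
    RingHom.ker D.toTotal = totalIdeal f f' := by
  refine le_antisymm (fun h hh => ?_) hL.totalIdeal_le
  have hn : Nonempty (Fin n) := by
    by_contra hn
    rw [not_nonempty_iff] at hn
    rw [Finset.univ_eq_empty, Finset.gcd_empty] at hgcd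
    exact zero_ne_one hgcd
  obtain ⟨j₀⟩ := hn
  obtain ⟨γ, hγ, hγ'⟩ := D.exists_apery hgcd j₀
  obtain ⟨H, hH⟩ := exists_combination_sub_mem hI f' j₀ hγ' h
  have h1 := hL.totalIdeal_le hH
  rw [RingHom.mem_ker, map_sub, RingHom.mem_ker.1 hh, zero_sub, neg_eq_zero] at h1
  have h2 : ∑ r, subst (D.baseFamily j₀) (H r).1 *
      ((MvPolynomial.aeval D.xi (MvPolynomial.monomial (γ r) (1 : K)) : MvPolynomial (Fin 2) K) :
        MvPowerSeries (Fin 2) K) = 0 := by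
    have h3 := congrArg Subtype.val h1
    rw [map_sum, AddSubmonoidClass.coe_finsetSum] at h3
    refine Eq.trans (Finset.sum_congr rfl fun r _ => ?_) h3
    rw [map_mul, ← coe_toTotal_polyXS]
    change _ = (D.toTotal (convergentRename (baseEmb j₀) (H r)) : MvPowerSeries (Fin 2) K) *
      (D.toTotal (polyXS (MvPolynomial.monomial (γ r) 1)) : MvPowerSeries (Fin 2) K)
    congr 1
    rw [coe_toTotal]
    exact (D.subst_xiS_rename (baseEmb j₀) (H r).1).symm
  have h4 : ∀ r, H r = 0 := fun r => Subtype.ext <| MvPowerSeries.ext fun α =>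
    D.coeff_eq_zero_of_combination j₀ hγ _ (fun r => (H r).1) h2 r α rfl
  simpa [h4] using hH

/-- The isomorphism of `K{x, s} / (F)` with `K{ξ, s}`. -/
theorem IsLifting.exists_algEquiv [CompleteSpace K]
    {f' : Fin m → convergentSeries (Fin n ⊕ Unit) K}
    (hL : D.IsLifting f d f') (hgcd : Finset.univ.gcd D.ell = 1)
    (hI : Ideal.span (Set.range f) = D.monomialIdeal) :
    ∃ Ψ : (convergentSeries (Fin n ⊕ Unit) K ⧸ totalIdeal f f') ≃ₐ[K] D.totalRing,
      ∀ h : convergentSeries (Fin n ⊕ Unit) K,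
        (Ψ (Ideal.Quotient.mk _ h) : MvPowerSeries (Fin 2) K) =
          subst D.xiS (h : MvPowerSeries (Fin n ⊕ Unit) K) :=
  ⟨(Ideal.quotientEquivAlgOfEq K (hL.ker_toTotal hgcd hI).symm).trans
    (Ideal.quotientKerAlgEquivOfSurjective D.toTotal_surjective), fun h => coe_toTotal h⟩

/-- The quotient embeds in the domain K⟦t, s⟧, where K{s} is embedded as the series in s; hence it
is torsion free. -/
theorem IsLifting.flat_structureMap [CompleteSpace K]
    {f' : Fin m → convergentSeries (Fin n ⊕ Unit) K}
    (hL : D.IsLifting f d f') (hgcd : Finset.univ.gcd D.ell = 1)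
    (hI : Ideal.span (Set.range f) = D.monomialIdeal) :
    RingHom.Flat (R := convergentSeries Unit K)
      (S := convergentSeries (Fin n ⊕ Unit) K ⧸ totalIdeal f f') (structureMap f f') := by
  obtain ⟨Ψ, hΨ⟩ := hL.exists_algEquiv hgcd hI
  have hinj : ∀ g : convergentSeries Unit K,
      (Ψ (structureMap f f' g) : MvPowerSeries (Fin 2) K) = 0 → g = 0 := by
    intro g hg
    let e : Unit ↪ Fin 2 := ⟨fun _ => 1, fun _ _ _ => rfl⟩
    have h1 : (Ψ (structureMap f f' g) : MvPowerSeries (Fin 2) K) =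
        MvPowerSeries.rename e g.1 := by
      refine (hΨ _).trans ?_
      change subst D.xiS (MvPowerSeries.rename _ g.1) = _
      rw [subst_xiS_rename, rename_eq_subst]
      rfl
    rw [h1] at hg
    exact Subtype.ext (rename_injective e (hg.trans (map_zero _).symm))
  refine flat_of_isTorsionFree (R := convergentSeries Unit K)
    (B := convergentSeries (Fin n ⊕ Unit) K ⧸ totalIdeal f f') (structureMap f f') fun r hr x y h1 => ?_
  have h2 := congrArg (fun z => (Ψ z : MvPowerSeries (Fin 2) K)) h1
  simp only [map_mul] at h2
  exact Ψ.injective (Subtype.ext (mul_left_cancel₀ (fun h => hr (hinj r h)) h2))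

end Total

end Deformation

end CurveDeformation

end

noncomputable section

namespace CurveDeformation

open MvPowerSeries

/-! ### The Rees algebra as a ring of power series -/

section ReesSeries

open Deformation

variable {K : Type*} [Field K]

/-- The additive map `K⟦t'⟧[s, s⁻¹] → K⟦t, s⟧` that sends `c t'^a s^i` to `c t^a s^(a + i)`
if `a + i ≥ 0` and to zero otherwise. -/
def laurentToSeries : LaurentPolynomial (PowerSeries K) →+ MvPowerSeries (Fin 2) K where
  toFun p := fun e => PowerSeries.coeff (e 0) (p.coeff ((e 1 : ℤ) - (e 0 : ℤ)))
  map_zero' := by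
    ext e
    exact map_zero (PowerSeries.coeff (e 0))
  map_add' p q := by
    ext e
    exact map_add (PowerSeries.coeff (e 0)) _ _

theorem coeff_laurentToSeries (p : LaurentPolynomial (PowerSeries K)) (e : Fin 2 →₀ ℕ) :
    coeff e (laurentToSeries p) = PowerSeries.coeff (e 0) (p.coeff ((e 1 : ℤ) - (e 0 : ℤ))) :=
  rfl

theorem exponent_eq (e : Fin 2 →₀ ℕ) : e = Finsupp.single 0 (e 0) + Finsupp.single 1 (e 1) := by
  ext i
  fin_cases i <;> simp

/-- The order condition ensures that no term of g(ts) s^i has a negative exponent of s, so the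
truncation loses nothing. The factor s^(-i) clears denominators when i < 0. -/
theorem X_pow_mul_laurentToSeries_single {i : ℤ} {g : PowerSeries K}
    (hg : ((-i).toNat : ℕ∞) ≤ g.order) :
    X 1 ^ (-i).toNat * laurentToSeries (AddMonoidAlgebra.single i g) =
      X 1 ^ i.toNat * diag g := by
  classical
  ext e
  rw [exponent_eq e, coeff_X_one_pow_mul_diag, X_pow_eq, coeff_monomial_mul, one_mul,
    coeff_laurentToSeries, AddMonoidAlgebra.coeff_single, Finsupp.single_apply]
  generalize e 0 = k
  generalize e 1 = l
  have h1 : Finsupp.single (1 : Fin 2) (-i).toNat ≤ Finsupp.single 0 k + Finsupp.single 1 l ↔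
      (-i).toNat ≤ l := by
    rw [Finsupp.single_le_iff]
    simp
  have h2 : ((Finsupp.single 0 k + Finsupp.single 1 l - Finsupp.single (1 : Fin 2) (-i).toNat :
      Fin 2 →₀ ℕ)) 0 = k := by simp
  have h3 : ((Finsupp.single 0 k + Finsupp.single 1 l - Finsupp.single (1 : Fin 2) (-i).toNat :
      Fin 2 →₀ ℕ)) 1 = l - (-i).toNat := by simp
  rw [h2, h3]
  by_cases hl : (-i).toNat ≤ l
  · rw [if_pos (h1.2 hl)]
    by_cases hk : l = k + i.toNat
    · rw [if_pos hk, if_pos (by omega)]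
    · rw [if_neg hk, if_neg (by omega), map_zero]
  · rw [if_neg (fun h => hl (h1.1 h))]
    split_ifs with hk
    · refine (PowerSeries.coeff_of_lt_order k (lt_of_lt_of_le ?_ hg)).symm
      exact_mod_cast (by omega : k < (-i).toNat)
    · rfl

instance : IsDomain (MvPowerSeries (Fin 2) K) := NoZeroDivisors.to_isDomain _

theorem algebraMap_X_one_pow_ne_zero (a : ℕ) :
    algebraMap (MvPowerSeries (Fin 2) K) (FractionRing (MvPowerSeries (Fin 2) K)) (X 1 ^ a) ≠ 0 :=
  fun h => X_one_pow_ne_zero (K := K) a <| IsFractionRing.injective (MvPowerSeries (Fin 2) K)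
    (FractionRing (MvPowerSeries (Fin 2) K)) (h.trans (map_zero _).symm)

theorem algebraMap_X_one_ne_zero :
    algebraMap (MvPowerSeries (Fin 2) K) (FractionRing (MvPowerSeries (Fin 2) K)) (X 1) ≠ 0 := by
  simpa using algebraMap_X_one_pow_ne_zero (K := K) 1

/-- The ring homomorphism `K⟦t'⟧[s, s⁻¹] → Frac K⟦t, s⟧`, `t' ↦ t s`. -/
def laurentToFraction :
    LaurentPolynomial (PowerSeries K) →+* FractionRing (MvPowerSeries (Fin 2) K) :=
  LaurentPolynomial.eval₂ ((algebraMap (MvPowerSeries (Fin 2) K)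
      (FractionRing (MvPowerSeries (Fin 2) K))).comp (diag (K := K)).toRingHom)
    (Units.mk0 _ algebraMap_X_one_ne_zero)

theorem laurentToFraction_single (i : ℤ) (g : PowerSeries K) :
    algebraMap (MvPowerSeries (Fin 2) K) (FractionRing (MvPowerSeries (Fin 2) K))
        (X 1 ^ (-i).toNat) * laurentToFraction (AddMonoidAlgebra.single i g) =
      algebraMap _ _ (X 1 ^ i.toNat * diag g) := by
  rw [LaurentPolynomial.single_eq_C_mul_T, laurentToFraction, LaurentPolynomial.eval₂_C_mul_T,
    Units.val_zpow_eq_zpow_val, Units.val_mk0, map_pow, map_mul, map_pow, mul_left_comm, mul_comm,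
    ← zpow_natCast, ← zpow_natCast, ← zpow_add₀ algebraMap_X_one_ne_zero,
    show ((-i).toNat : ℤ) + i = i.toNat by omega]
  rfl

/-- The truncating map is merely additive; where nothing is truncated it agrees with a ring
homomorphism to the fraction field. This is how `reesHom` is seen to be multiplicative. -/
theorem algebraMap_laurentToSeries {p : LaurentPolynomial (PowerSeries K)}
    (hp : ∀ i : ℤ, ((-i).toNat : ℕ∞) ≤ (p.coeff i).order) :
    algebraMap (MvPowerSeries (Fin 2) K) (FractionRing (MvPowerSeries (Fin 2) K))
      (laurentToSeries p) = laurentToFraction p := by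
  rw [← AddMonoidAlgebra.sum_coeff_single p, Finsupp.sum, map_sum, map_sum, map_sum]
  refine Finset.sum_congr rfl fun i _ => ?_
  refine mul_left_cancel₀ (algebraMap_X_one_pow_ne_zero (-i).toNat) ?_
  rw [laurentToFraction_single, ← map_mul, X_pow_mul_laurentToSeries_single (hp i)]

/-- The inclusion of the Rees algebra in `K⟦t, s⟧` as a ring homomorphism. -/
def reesHom (O : Subalgebra K (PowerSeries K)) : orderRees O →+* MvPowerSeries (Fin 2) K where
  toFun := reesToSeries O
  map_zero' := map_zero laurentToSeries
  map_add' p q := map_add laurentToSeries p.1 q.1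
  map_one' := by
    apply IsFractionRing.injective (MvPowerSeries (Fin 2) K)
      (FractionRing (MvPowerSeries (Fin 2) K))
    refine (algebraMap_laurentToSeries fun i => ((1 : orderRees O).2 i).2).trans ?_
    rw [map_one]
    exact map_one laurentToFraction
  map_mul' p q := by
    apply IsFractionRing.injective (MvPowerSeries (Fin 2) K)
      (FractionRing (MvPowerSeries (Fin 2) K))
    refine (algebraMap_laurentToSeries fun i => ((p * q).2 i).2).trans ?_
    rw [map_mul]
    refine (map_mul laurentToFraction p.1 q.1).trans ?_
    rw [← algebraMap_laurentToSeries fun i => (p.2 i).2,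
      ← algebraMap_laurentToSeries fun i => (q.2 i).2]
    rfl

variable (O : Subalgebra K (PowerSeries K))

theorem reesHom_apply (p : orderRees O) : reesHom O p = laurentToSeries p.1 := rfl

/-- The coefficient of t'^k s^i is found at t^k s^(k+i) if k + i ≥ 0; otherwise it is zero by the
order condition. -/
theorem reesHom_injective : Function.Injective (reesHom O) := by
  refine (injective_iff_map_eq_zero _).2 fun p hp => Subtype.ext (LaurentPolynomial.ext fun i => ?_)
  change p.1.coeff i = 0
  ext k
  rw [map_zero]
  by_cases hk : 0 ≤ (k : ℤ) + i
  · have h1 := congrArg (coeff (Finsupp.single 0 k + Finsupp.single 1 ((k : ℤ) + i).toNat)) hp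
    rw [reesHom_apply, coeff_laurentToSeries] at h1
    simpa [hk] using h1
  · refine PowerSeries.coeff_of_lt_order k (lt_of_lt_of_le ?_ (p.2 i).2)
    exact_mod_cast (by omega : k < (-i).toNat)

theorem reesHom_toRees (g : O) : reesHom O (toRees O g) = diag g.1 := by
  have h := X_pow_mul_laurentToSeries_single (i := 0) (g := g.1) (by simp)
  rw [Int.neg_zero, Int.toNat_zero, pow_zero, one_mul, one_mul] at h
  exact h

theorem reesHom_reesS : reesHom O (reesS O) = X 1 := by
  have h := X_pow_mul_laurentToSeries_single (i := 1) (g := (1 : PowerSeries K)) (by simp)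
  rw [map_one, mul_one, show (-1 : ℤ).toNat = 0 from rfl, show (1 : ℤ).toNat = 1 from rfl,
    pow_zero, one_mul, pow_one] at h
  exact h

theorem constantCoeff_reesHom_of_mem {p : orderRees O} (hp : p ∈ vertexIdeal O) :
    constantCoeff (reesHom O p) = 0 := by
  have h : vertexIdeal O ≤ RingHom.ker ((constantCoeff (σ := Fin 2) (R := K)).comp (reesHom O)) := by
    rw [vertexIdeal, Ideal.span_le]
    rintro q (hq | rfl)
    · change constantCoeff (reesHom O q) = 0
      rw [← coeff_zero_eq_constantCoeff_apply, reesHom_apply, coeff_laurentToSeries]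
      simpa using hq 0
    · change constantCoeff (reesHom O (reesS O)) = 0
      rw [reesHom_reesS, constantCoeff_X]
  exact h hp

theorem reesHom_eq_sum (p : orderRees O) : reesHom O p =
    ∑ i ∈ p.1.coeff.support, laurentToSeries (AddMonoidAlgebra.single i (p.1.coeff i)) := by
  conv_lhs => rw [reesHom_apply, ← AddMonoidAlgebra.sum_coeff_single p.1, Finsupp.sum, map_sum]

end ReesSeries

end CurveDeformation

end

noncomputable section

namespace CurveDeformation

open MvPowerSeries

/-! ### Composition of substitutions and first-order expansion -/

section Difference

variable {σ τ υ K : Type*} [Finite τ] [Finite υ] [NontriviallyNormedField K]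

theorem convergentSubst_comp [Finite σ] {b : σ → convergentSeries τ K}
    (hb : ∀ i, constantCoeff (b i).1 = 0) {c : τ → convergentSeries υ K}
    (hc : ∀ i, constantCoeff (c i).1 = 0) {d : σ → convergentSeries υ K}
    (hd : ∀ i, constantCoeff (d i).1 = 0) (h : ∀ i, convergentSubst c hc (b i) = d i)
    (g : convergentSeries σ K) :
    convergentSubst c hc (convergentSubst b hb g) = convergentSubst d hd g := by
  apply Subtype.ext
  rw [coe_convergentSubst, coe_convergentSubst, coe_convergentSubst,
    subst_comp_subst_apply (hasSubst_of_constantCoeff_zero hb) (hasSubst_of_constantCoeff_zero hc)]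
  congr 1
  funext i
  rw [← h i, coe_convergentSubst]

/-- The expansion `g(x + z) = g(x) + ∑ z_i q_i(x, z)`. -/
theorem exists_convergentSubst_add_eq [Fintype σ] (g : convergentSeries σ K)
    (hX : ∀ i : σ, constantCoeff (convergentX (Sum.inl i) + convergentX (Sum.inr i) :
      convergentSeries (σ ⊕ σ) K).1 = 0) :
    ∃ q : σ → convergentSeries (σ ⊕ σ) K,
      convergentSubst (fun i => convergentX (Sum.inl i) + convergentX (Sum.inr i)) hX g =
        convergentRename Function.Embedding.inl g + ∑ i, convergentX (Sum.inr i) * q i := by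
  classical
  set G := convergentSubst (fun i => convergentX (Sum.inl i) + convergentX (Sum.inr i)) hX g
    with hG
  let c : ((σ ⊕ σ) →₀ ℕ) → Option σ := fun α =>
    if h : ∃ i, α (Sum.inr i) ≠ 0 then some h.choose else none
  let e : Option σ → (σ ⊕ σ) →₀ ℕ := fun o => o.elim 0 fun i => Finsupp.single (Sum.inr i) 1
  have hsome : ∀ α : (σ ⊕ σ) →₀ ℕ, ∀ h : ∃ i, α (Sum.inr i) ≠ 0, c α = some h.choose :=
    fun α h => dif_pos h
  have he : ∀ α, e (c α) ≤ α := by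
    intro α
    by_cases h : ∃ i, α (Sum.inr i) ≠ 0
    · rw [hsome α h]
      exact Finsupp.single_le_iff.2 (Nat.one_le_iff_ne_zero.2 h.choose_spec)
    · have : c α = none := dif_neg h
      rw [this]
      exact zero_le
  let p : Option σ → convergentSeries (σ ⊕ σ) K := fun o =>
    ⟨divPart (e o) {α | c α = o} G.1, G.2.divPart _ _⟩
  have hsplit : G = p none + ∑ i, convergentX (Sum.inr i) * p (some i) := by
    apply Subtype.ext
    have h1 := eq_sum_monomial_mul_divPart c e he G.1
    rw [Fintype.sum_option] at h1
    have h2 : ((p none + ∑ i, convergentX (Sum.inr i) * p (some i) :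
        convergentSeries (σ ⊕ σ) K)).1 = (p none).1 + ∑ i, X (Sum.inr i) * (p (some i)).1 := by
      rw [Subalgebra.coe_add, AddSubmonoidClass.coe_finsetSum]
      rfl
    rw [h2]
    refine h1.trans (congrArg₂ (· + ·) ?_ rfl)
    exact one_mul _
  -- The part of g(x + z) free of the z_i is a series in x alone; setting z = 0 identifies it with
  -- g.
  obtain ⟨g', hrename⟩ := exists_convergentRename_eq (Function.Embedding.inl : σ ↪ σ ⊕ σ) (p none) (by
    intro α hα i hi
    rcases i with i | i
    · exact ⟨i, rfl⟩
    · exfalso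
      apply hα
      change coeff α (divPart (e none) {α | c α = none} G.1) = 0
      rw [coeff_divPart, if_neg]
      have : c (α + e none) = c α := congrArg c (add_zero α)
      rw [Set.mem_ofPred_eq, this, hsome α ⟨i, hi⟩]
      exact Option.some_ne_none _)
  have h0 : ∀ i : σ ⊕ σ, constantCoeff (Sum.elim convergentX (fun _ => 0) i :
      convergentSeries σ K).1 = 0 := by
    rintro (i | i)
    · exact constantCoeff_convergentX i
    · exact map_zero _
  have hgg : g = g' := by
    have h1 := congrArg (convergentSubst _ h0) hsplit
    rw [hG, convergentSubst_comp hX h0 constantCoeff_convergentX (fun i => by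
      rw [map_add, convergentSubst_X, convergentSubst_X]; exact add_zero _), convergentSubst_X_eq,
      map_add, map_sum, Finset.sum_eq_zero (fun i _ => by
        rw [map_mul, convergentSubst_X]; exact zero_mul _), add_zero, ← hrename,
      convergentSubst_rename] at h1
    exact h1.trans (convergentSubst_X_eq g')
  refine ⟨fun i => p (some i), ?_⟩
  rw [hsplit, ← hrename, hgg]

/-- Congruent substitutions have congruent values. -/
theorem map_convergentSubst_congr [Fintype σ] {B : Type*} [CommRing B]
    (φ : convergentSeries τ K →+* B) {u v : σ → convergentSeries τ K}
    (hu : ∀ i, constantCoeff (u i).1 = 0) (hv : ∀ i, constantCoeff (v i).1 = 0)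
    (huv : ∀ i, φ (u i) = φ (v i)) (g : convergentSeries σ K) :
    φ (convergentSubst u hu g) = φ (convergentSubst v hv g) := by
  have hX : ∀ i : σ, constantCoeff (convergentX (Sum.inl i) + convergentX (Sum.inr i) :
      convergentSeries (σ ⊕ σ) K).1 = 0 := fun i => by
    rw [Subalgebra.coe_add, map_add, constantCoeff_convergentX, constantCoeff_convergentX, add_zero]
  obtain ⟨q, hq⟩ := exists_convergentSubst_add_eq g hX
  have hw : ∀ i : σ ⊕ σ, constantCoeff (Sum.elim v (fun i => u i - v i) i :
      convergentSeries τ K).1 = 0 := by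
    rintro (i | i)
    · exact hv i
    · change constantCoeff ((u i).1 - (v i).1) = 0
      rw [map_sub, hu, hv, sub_zero]
  -- Setting x = v and z = u - v writes the difference of the two values as a combination of the u_i
  -- - v_i, which φ kills.
  have h1 := congrArg (convergentSubst _ hw) hq
  rw [convergentSubst_comp hX hw hu (fun i => by
    rw [map_add, convergentSubst_X, convergentSubst_X]; exact add_sub_cancel _ _), map_add,
    convergentSubst_rename, map_sum] at h1
  rw [h1, map_add, map_sum, Finset.sum_eq_zero (fun i _ => ?_), add_zero]
  · rfl
  · rw [map_mul, convergentSubst_X, map_mul, Sum.elim_inr, map_sub, huv, sub_self, zero_mul]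

end Difference

namespace Deformation

/-! ### Generators of the Rees algebra -/

section Rees

variable {K : Type*} [NontriviallyNormedField K] {n m : ℕ} {D : Deformation K n}
  {f : Fin m → MvPolynomial (Fin n) K} {d : Fin m → ℕ}

/-- The element `ξ'_j s^(-ℓ_j)` of the Rees algebra. -/
def reesXi (D : Deformation K n) (j : Fin n) : orderRees D.curveRing :=
  ⟨AddMonoidAlgebra.single (-(D.ell j : ℤ)) (D.xiOne j), fun i => by
    classical
    rw [AddMonoidAlgebra.coeff_single, Finsupp.single_apply]
    split_ifs with h
    · subst h
      refine ⟨D.mem_curveRing.2 ⟨convergentX j, ?_⟩, ?_⟩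
      · rw [substOne, convergentSubst_X]
        rfl
      · rw [neg_neg, Int.toNat_natCast]
        refine PowerSeries.nat_le_order _ _ fun k hk => ?_
        obtain ⟨v, hv⟩ := D.xiOne_eq_mul j (D.one_le_gap j)
        rw [hv, PowerSeries.coeff_X_pow_mul', if_neg (not_le.2 hk)]
    · exact ⟨zero_mem _, by simp⟩⟩

theorem reesHom_reesXi (j : Fin n) :
    reesHom D.curveRing (D.reesXi j) = (D.xi j : MvPowerSeries (Fin 2) K) := by
  have h := X_pow_mul_laurentToSeries_single (i := -(D.ell j : ℤ)) (g := D.xiOne j) (by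
    have := ((D.reesXi j).2 (-(D.ell j : ℤ))).2
    rwa [reesXi, AddMonoidAlgebra.coeff_single, Finsupp.single_eq_same] at this)
  rw [neg_neg, Int.toNat_natCast, show (-(D.ell j : ℤ)).toNat = 0 by omega, pow_zero, one_mul,
    diag_xiOne] at h
  exact mul_left_cancel₀ (X_one_pow_ne_zero _) h

theorem reesXi_mem_vertexIdeal (j : Fin n) : D.reesXi j ∈ vertexIdeal D.curveRing := by
  classical
  refine Ideal.subset_span (Or.inl fun i => ?_)
  rw [reesXi, AddMonoidAlgebra.coeff_single, Finsupp.single_apply]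
  split_ifs
  · exact D.xiOne_constantCoeff j
  · exact map_zero _

/-- The elements `ξ'_j s^(-ℓ_j)` and `s` of the Rees algebra. -/
def reesGen (D : Deformation K n) : Fin n ⊕ Unit → orderRees D.curveRing :=
  Sum.elim D.reesXi fun _ => reesS D.curveRing

theorem reesHom_reesGen (k : Fin n ⊕ Unit) : reesHom D.curveRing (D.reesGen k) = D.xiS k := by
  rcases k with j | _
  · exact reesHom_reesXi j
  · exact reesHom_reesS _

theorem reesGen_mem_vertexIdeal (k : Fin n ⊕ Unit) : D.reesGen k ∈ vertexIdeal D.curveRing := by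
  rcases k with j | _
  · exact reesXi_mem_vertexIdeal j
  · exact Ideal.subset_span (Or.inr rfl)

/-- The homomorphism `K{y}[x, s] → A` to the Rees algebra, `y_j ↦ ξ'_j`, `x_j ↦ ξ'_j s^(-ℓ_j)`. -/
def polyToRees (D : Deformation K n) :
    MvPolynomial (Fin n ⊕ Unit) (convergentSeries (Fin n) K) →+* orderRees D.curveRing :=
  MvPolynomial.eval₂Hom ((toRees D.curveRing).comp D.toCurveRing) D.reesGen

/-- The homomorphism `K{y}[x, s] → K{x, s}`, `y_j ↦ s^(ℓ_j) x_j`. -/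
def polyEval (D : Deformation K n) :
    MvPolynomial (Fin n ⊕ Unit) (convergentSeries (Fin n) K) →+*
      convergentSeries (Fin n ⊕ Unit) K :=
  MvPolynomial.eval₂Hom D.substScaled.toRingHom convergentX

theorem polyEval_C (h : convergentSeries (Fin n) K) :
    D.polyEval (MvPolynomial.C h) = D.substScaled h :=
  MvPolynomial.eval₂Hom_C _ _ _

theorem polyEval_X (k : Fin n ⊕ Unit) : D.polyEval (MvPolynomial.X k) = convergentX k :=
  MvPolynomial.eval₂Hom_X' _ _ _

theorem coe_toTotal_X (k : Fin n ⊕ Unit) :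
    (D.toTotal (convergentX k) : MvPowerSeries (Fin 2) K) = D.xiS k := by
  rw [coe_toTotal]
  exact subst_X D.hasSubst_xiS k

theorem coe_toTotal_substScaled (h : convergentSeries (Fin n) K) :
    (D.toTotal (D.substScaled h) : MvPowerSeries (Fin 2) K) =
      reesHom D.curveRing (toRees D.curveRing (D.toCurveRing h)) := by
  rw [coe_toTotal, coe_substScaled, subst_xiS_scaledX, reesHom_toRees]
  exact congrArg diag (substAlgHom_apply D.hasSubst_xiOne h.1).symm

theorem coe_toTotal_polyEval (p : MvPolynomial (Fin n ⊕ Unit) (convergentSeries (Fin n) K)) :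
    (D.toTotal (D.polyEval p) : MvPowerSeries (Fin 2) K) =
      reesHom D.curveRing (D.polyToRees p) := by
  have h : (D.totalRing.val.toRingHom.comp D.toTotal.toRingHom).comp D.polyEval =
      (reesHom D.curveRing).comp D.polyToRees := by
    apply MvPolynomial.ringHom_ext
    · intro h
      change (D.toTotal (D.polyEval (MvPolynomial.C h)) : MvPowerSeries (Fin 2) K) =
        reesHom D.curveRing (D.polyToRees (MvPolynomial.C h))
      rw [polyEval_C, coe_toTotal_substScaled, polyToRees, MvPolynomial.eval₂Hom_C]
      rfl
    · intro k
      change (D.toTotal (D.polyEval (MvPolynomial.X k)) : MvPowerSeries (Fin 2) K) =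
        reesHom D.curveRing (D.polyToRees (MvPolynomial.X k))
      rw [polyEval_X, coe_toTotal_X, polyToRees, MvPolynomial.eval₂Hom_X', reesHom_reesGen]
  exact congrArg (fun F : _ →+* MvPowerSeries (Fin 2) K => F p) h

/-- A series `h` of weighted order at least `k` gives an element `s^(-k) h(s^ℓ x)` of the image
of `K{y}[x, s]`. -/
theorem exists_X_pow_mul_polyEval_eq (k : ℕ) : ∀ h : convergentSeries (Fin n) K,
    (∀ β, coeff β h.1 ≠ 0 → k ≤ Finsupp.weight D.ell β) →
    ∃ p, convergentX (Sum.inr ()) ^ k * D.polyEval p = D.substScaled h := by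
  classical
  induction k using Nat.strong_induction_on with
  | _ k ih =>
    intro h hk
    rcases Nat.eq_zero_or_pos k with rfl | hpos
    · exact ⟨MvPolynomial.C h, by rw [pow_zero, one_mul, polyEval_C]⟩
    let c : (Fin n →₀ ℕ) → Option (Fin n) := fun α =>
      if h : ∃ i, α i ≠ 0 then some h.choose else none
    let e : Option (Fin n) → Fin n →₀ ℕ := fun o => o.elim 0 fun i => Finsupp.single i 1
    have he : ∀ α, e (c α) ≤ α := by
      intro α
      by_cases h : ∃ i, α i ≠ 0
      · have : c α = some h.choose := dif_pos h
        rw [this]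
        exact Finsupp.single_le_iff.2 (Nat.one_le_iff_ne_zero.2 h.choose_spec)
      · have : c α = none := dif_neg h
        rw [this]
        exact zero_le
    let g : Option (Fin n) → convergentSeries (Fin n) K := fun o =>
      ⟨divPart (e o) {α | c α = o} h.1, h.2.divPart _ _⟩
    have hnone : g none = 0 := by
      refine Subtype.ext (MvPowerSeries.ext fun α => ?_)
      change coeff α (divPart (e none) {α | c α = none} h.1) = 0
      rw [coeff_divPart]
      split_ifs with hα
      · have h1 : α + e none = 0 := by
          by_contra hne
          have h2 : ∃ i, (α + e none) i ≠ 0 := by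
            by_contra hall
            push Not at hall
            exact hne (Finsupp.ext hall)
          have h3 : c (α + e none) = some h2.choose := dif_pos h2
          rw [Set.mem_ofPred_eq, h3] at hα
          exact Option.some_ne_none _ hα
        by_contra hne
        have := hk _ hne
        rw [h1, map_zero] at this
        omega
      · rfl
    have hsplit : h = ∑ i, convergentX i * g (some i) := by
      apply Subtype.ext
      have h1 := eq_sum_monomial_mul_divPart c e he h.1
      rw [Fintype.sum_option] at h1
      rw [AddSubmonoidClass.coe_finsetSum]
      refine h1.trans ?_
      have h2 : divPart (e none) {α | c α = none} h.1 = 0 := congrArg Subtype.val hnone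
      rw [h2, mul_zero, zero_add]
      rfl
    have hg : ∀ i β, coeff β (g (some i)).1 ≠ 0 → k ≤ D.ell i + Finsupp.weight D.ell β := by
      intro i β hβ
      have h1 : coeff β (divPart (e (some i)) {α | c α = some i} h.1) ≠ 0 := hβ
      rw [coeff_divPart] at h1
      split_ifs at h1 with h2
      · have h3 := hk _ h1
        have h4 : Finsupp.weight D.ell (e (some i)) = D.ell i := by
          simp [e, Finsupp.weight_single]
        rw [map_add, h4] at h3
        omega
      · exact absurd rfl h1
    have hterm : ∀ i, ∃ p, convergentX (Sum.inr ()) ^ k * D.polyEval p =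
        D.substScaled (convergentX i * g (some i)) := by
      intro i
      have hmul : D.substScaled (convergentX i * g (some i)) =
          convergentX (Sum.inr ()) ^ D.ell i * convergentX (Sum.inl i) *
            D.substScaled (g (some i)) := by
        rw [map_mul]
        exact congrArg (· * _) (convergentSubst_X _ _ i)
      -- A term x_i g_i becomes s^(ℓ_i) x_i times the rescaled g_i. If ℓ_i ≤ k, the missing power of
      -- s is taken from g_i by induction; otherwise a power of s is left over.
      rcases le_total (D.ell i) k with hle | hle
      · obtain ⟨p, hp⟩ := ih (k - D.ell i) (by have := D.ell_pos i; omega) (g (some i))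
          (fun β hβ => by have := hg i β hβ; omega)
        refine ⟨MvPolynomial.X (Sum.inl i) * p, ?_⟩
        rw [hmul, ← hp, map_mul, polyEval_X]
        conv_lhs => rw [← Nat.add_sub_cancel' hle, pow_add]
        ring
      · refine ⟨MvPolynomial.X (Sum.inr ()) ^ (D.ell i - k) * MvPolynomial.X (Sum.inl i) *
          MvPolynomial.C (g (some i)), ?_⟩
        rw [hmul, map_mul, map_mul, map_pow, polyEval_X, polyEval_X, polyEval_C]
        conv_rhs => rw [← Nat.add_sub_cancel' hle, pow_add]
        ring
    choose p hp using hterm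
    refine ⟨∑ i, p i, ?_⟩
    rw [map_sum, Finset.mul_sum]
    conv_rhs => rw [hsplit, map_sum]
    exact Finset.sum_congr rfl fun i _ => hp i

/-- In degree i the coefficient of s^i has order at least -i, so it lifts to a series of that
weighted order, from which s^(-i) can be divided out inside K{y}[x, s]. This is where Γ' = Γ enters.
-/
theorem polyToRees_surjective [CompleteSpace K] (hgcd : Finset.univ.gcd D.ell = 1)
    (hΓ : D.valueSemigroup = (D.semigroup : Set ℕ)) : Function.Surjective D.polyToRees := by
  intro a
  have key : ∀ i : ℤ, ∃ p, reesHom D.curveRing (D.polyToRees p) =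
      laurentToSeries (AddMonoidAlgebra.single i (a.1.coeff i)) := by
    intro i
    obtain ⟨h, hh, hw⟩ := D.exists_lift_of_le_order hgcd hΓ (-i).toNat (a.1.coeff i) (a.2 i).1
      fun k hk => PowerSeries.coeff_of_lt_order k
        (lt_of_lt_of_le (by exact_mod_cast hk) (a.2 i).2)
    obtain ⟨p, hp⟩ := exists_X_pow_mul_polyEval_eq (D := D) _ h hw
    refine ⟨MvPolynomial.X (Sum.inr ()) ^ i.toNat * p, ?_⟩
    refine mul_left_cancel₀ (X_one_pow_ne_zero (-i).toNat) ?_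
    rw [X_pow_mul_laurentToSeries_single (a.2 i).2, ← hh, coe_substOne, ← subst_xiS_scaledX,
      ← coe_substScaled, ← coe_toTotal, ← hp, map_mul, map_pow, map_mul, map_pow,
      ← coe_toTotal_polyEval, ← coe_toTotal_polyEval, polyEval_X, coe_toTotal_s, map_mul, map_pow,
      Subalgebra.coe_mul, Subalgebra.coe_pow, coe_toTotal_s]
    exact mul_left_comm _ _ _
  choose p hp using key
  refine ⟨∑ i ∈ a.1.coeff.support, p i, reesHom_injective _ ?_⟩
  rw [map_sum, map_sum, reesHom_eq_sum]
  exact Finset.sum_congr rfl fun i _ => hp i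

theorem exists_isPresentation [CompleteSpace K] (hgcd : Finset.univ.gcd D.ell = 1)
    (hΓ : D.valueSemigroup = (D.semigroup : Set ℕ)) :
    ∃ (N : ℕ) (a : Fin N → orderRees D.curveRing), D.IsPresentation a := by
  let e := Fintype.equivFin (Fin n ⊕ Unit)
  refine ⟨_, D.reesGen ∘ e.symm, fun i => reesGen_mem_vertexIdeal _, fun a => ?_⟩
  obtain ⟨p, rfl⟩ := polyToRees_surjective hgcd hΓ a
  refine ⟨MvPolynomial.rename e p, ?_⟩
  rw [presentation, MvPolynomial.eval₂Hom_rename, Function.comp_assoc, Equiv.symm_comp_self]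
  rfl

end Rees

end Deformation

end CurveDeformation

end

noncomputable section

namespace CurveDeformation

open MvPowerSeries

namespace Deformation

/-! ### The analytic stalk at the vertex -/

section Stalk

variable {K : Type*} [NontriviallyNormedField K] {n m N : ℕ} {D : Deformation K n}
  {f : Fin m → MvPolynomial (Fin n) K} {d : Fin m → ℕ}

theorem polyToSeries_C (h : convergentSeries (Fin n) K) :
    polyToSeries K n N (MvPolynomial.C h) = convergentRename Function.Embedding.inl h :=
  MvPolynomial.eval₂Hom_C _ _ _

theorem polyToSeries_X (i : Fin N) :
    polyToSeries K n N (MvPolynomial.X i) = convergentX (Sum.inr i) :=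
  MvPolynomial.eval₂Hom_X' _ _ _

theorem convergentRename_X {σ τ : Type*} (e : σ ↪ τ) (i : σ) :
    convergentRename e (convergentX i : convergentSeries σ K) = convergentX (e i) :=
  Subtype.ext (rename_X e i)

theorem coe_toTotal_convergentSubst {σ : Type*} [Finite σ]
    {b : σ → convergentSeries (Fin n ⊕ Unit) K} (hb : ∀ i, constantCoeff (b i).1 = 0)
    {c : σ → MvPowerSeries (Fin 2) K}
    (hc : ∀ i, (D.toTotal (b i) : MvPowerSeries (Fin 2) K) = c i) (g : convergentSeries σ K) :
    (D.toTotal (convergentSubst b hb g) : MvPowerSeries (Fin 2) K) = subst c g.1 := by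
  rw [coe_toTotal, coe_convergentSubst,
    subst_comp_subst_apply (hasSubst_of_constantCoeff_zero hb) D.hasSubst_xiS]
  congr 1
  funext i
  rw [← hc i, coe_toTotal]

theorem constantCoeff_toTotal (g : convergentSeries (Fin n ⊕ Unit) K) :
    constantCoeff (D.toTotal g : MvPowerSeries (Fin 2) K) = constantCoeff g.1 := by
  rw [coe_toTotal]
  exact constantCoeff_subst_eq D.constantCoeff_xiS g.1

variable {b : Fin N → convergentSeries (Fin n ⊕ Unit) K}

theorem constantCoeff_stalkFamily (hb : ∀ i, constantCoeff (b i).1 = 0) (k : Fin n ⊕ Fin N) :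
    constantCoeff (Sum.elim D.scaledXC b k).1 = 0 := by
  rcases k with j | i
  · exact D.constantCoeff_scaledXC j
  · exact hb i

/-- The substitution `y_j ↦ s^(ℓ_j) x_j`, `X_i ↦ b_i`. -/
def stalkSubst (D : Deformation K n) (hb : ∀ i, constantCoeff (b i).1 = 0) :
    convergentSeries (Fin n ⊕ Fin N) K →ₐ[K] convergentSeries (Fin n ⊕ Unit) K :=
  convergentSubst (Sum.elim D.scaledXC b) (constantCoeff_stalkFamily hb)

theorem coe_toTotal_stalkSubst (hb : ∀ i, constantCoeff (b i).1 = 0)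
    {a : Fin N → orderRees D.curveRing}
    (hab : ∀ i, (D.toTotal (b i) : MvPowerSeries (Fin 2) K) = reesHom D.curveRing (a i))
    (q : MvPolynomial (Fin N) (convergentSeries (Fin n) K)) :
    (D.toTotal (D.stalkSubst hb (polyToSeries K n N q)) : MvPowerSeries (Fin 2) K) =
      reesHom D.curveRing (D.presentation a q) := by
  have h : (D.totalRing.val.toRingHom.comp (D.toTotal.toRingHom.comp
      (D.stalkSubst hb).toRingHom)).comp (polyToSeries K n N) =
      (reesHom D.curveRing).comp (D.presentation a) := by
    apply MvPolynomial.ringHom_ext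
    · intro h
      change (D.toTotal (D.stalkSubst hb (polyToSeries K n N (MvPolynomial.C h))) :
        MvPowerSeries (Fin 2) K) = reesHom D.curveRing (D.presentation a (MvPolynomial.C h))
      rw [polyToSeries_C, stalkSubst, convergentSubst_rename, presentation,
        MvPolynomial.eval₂Hom_C]
      exact coe_toTotal_substScaled h
    · intro i
      change (D.toTotal (D.stalkSubst hb (polyToSeries K n N (MvPolynomial.X i))) :
        MvPowerSeries (Fin 2) K) = reesHom D.curveRing (D.presentation a (MvPolynomial.X i))
      rw [polyToSeries_X, stalkSubst, convergentSubst_X, presentation, MvPolynomial.eval₂Hom_X']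
      exact hab i
  exact congrArg (fun F : _ →+* MvPowerSeries (Fin 2) K => F q) h

theorem reesS_pow_mul_reesXi (j : Fin n) : reesS D.curveRing ^ D.ell j * D.reesXi j =
    toRees D.curveRing (D.toCurveRing (convergentX j)) := by
  apply reesHom_injective
  rw [map_mul, map_pow, reesHom_reesS, reesHom_reesXi, ← diag_xiOne, reesHom_toRees]
  exact congrArg diag (substAlgHom_X D.hasSubst_xiOne j).symm

/-- Substitution of preimages of generators of the Rees algebra in a polynomial. -/
theorem presentation_eval₂ {a : Fin N → orderRees D.curveRing}
    {q : Fin n ⊕ Unit → MvPolynomial (Fin N) (convergentSeries (Fin n) K)}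
    (hq : ∀ k, D.presentation a (q k) = D.reesGen k)
    (p : MvPolynomial (Fin n ⊕ Unit) (convergentSeries (Fin n) K)) :
    D.presentation a (MvPolynomial.eval₂Hom MvPolynomial.C q p) = D.polyToRees p := by
  have h : (D.presentation a).comp (MvPolynomial.eval₂Hom MvPolynomial.C q) = D.polyToRees := by
    apply MvPolynomial.ringHom_ext
    · intro h
      rw [RingHom.comp_apply, MvPolynomial.eval₂Hom_C, presentation, polyToRees,
        MvPolynomial.eval₂Hom_C, MvPolynomial.eval₂Hom_C]
    · intro k
      rw [RingHom.comp_apply, MvPolynomial.eval₂Hom_X', hq, polyToRees,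
        MvPolynomial.eval₂Hom_X']
  exact congrArg (fun F : _ →+* orderRees D.curveRing => F p) h

section Congruence

variable {B : Type*} [CommRing B] {φ : convergentSeries (Fin n ⊕ Fin N) K →+* B}
  {a : Fin N → orderRees D.curveRing}
  {q : Fin n ⊕ Unit → MvPolynomial (Fin N) (convergentSeries (Fin n) K)}

theorem map_polyToSeries_congr
    (hφ : (RingHom.ker (D.presentation a)).map (polyToSeries K n N) ≤ RingHom.ker φ)
    {q q' : MvPolynomial (Fin N) (convergentSeries (Fin n) K)}
    (h : D.presentation a q = D.presentation a q') :
    φ (polyToSeries K n N q) = φ (polyToSeries K n N q') := by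
  have h1 : q - q' ∈ RingHom.ker (D.presentation a) := by
    rw [RingHom.mem_ker, map_sub, h, sub_self]
  have h2 : φ (polyToSeries K n N (q - q')) = 0 := hφ (Ideal.mem_map_of_mem _ h1)
  rwa [map_sub, map_sub, sub_eq_zero] at h2

theorem map_convergentSubst_scaledXC
    (hφ : (RingHom.ker (D.presentation a)).map (polyToSeries K n N) ≤ RingHom.ker φ)
    (hq : ∀ k, D.presentation a (q k) = D.reesGen k)
    (hq0 : ∀ k, constantCoeff (polyToSeries K n N (q k)).1 = 0) (j : Fin n) :
    φ (convergentSubst (fun k => polyToSeries K n N (q k)) hq0 (D.scaledXC j)) =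
      φ (convergentX (Sum.inl j)) := by
  have h1 : (convergentX (Sum.inl j) : convergentSeries (Fin n ⊕ Fin N) K) =
      polyToSeries K n N (MvPolynomial.C (convergentX j)) := by
    rw [polyToSeries_C]
    exact (convergentRename_X Function.Embedding.inl j).symm
  rw [scaledXC, map_mul, map_pow, convergentSubst_X, convergentSubst_X, ← map_pow, ← map_mul, h1]
  refine map_polyToSeries_congr hφ ?_
  rw [map_mul, map_pow, hq, hq]
  refine (reesS_pow_mul_reesXi j).trans ?_
  rw [presentation, MvPolynomial.eval₂Hom_C]
  rfl

/-- The images of y_j agree only modulo the ideal, by the relation s^(ℓ_j) · ξ'_j s^(-ℓ_j) = ξ'_j.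
For coefficients that are power series in y, this congruence is transported by
`map_convergentSubst_congr`. -/
theorem map_convergentSubst_polyEval
    (hφ : (RingHom.ker (D.presentation a)).map (polyToSeries K n N) ≤ RingHom.ker φ)
    (hq : ∀ k, D.presentation a (q k) = D.reesGen k)
    (hq0 : ∀ k, constantCoeff (polyToSeries K n N (q k)).1 = 0)
    (p : MvPolynomial (Fin n ⊕ Unit) (convergentSeries (Fin n) K)) :
    φ (convergentSubst (fun k => polyToSeries K n N (q k)) hq0 (D.polyEval p)) =
      φ (polyToSeries K n N (MvPolynomial.eval₂Hom MvPolynomial.C q p)) := by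
  have h : (φ.comp (convergentSubst (fun k => polyToSeries K n N (q k)) hq0).toRingHom).comp
      D.polyEval =
      (φ.comp (polyToSeries K n N)).comp (MvPolynomial.eval₂Hom MvPolynomial.C q) := by
    apply MvPolynomial.ringHom_ext
    · intro h
      change φ (convergentSubst (fun k => polyToSeries K n N (q k)) hq0
        (D.polyEval (MvPolynomial.C h))) =
        φ (polyToSeries K n N (MvPolynomial.eval₂Hom MvPolynomial.C q (MvPolynomial.C h)))
      have hc : ∀ j, constantCoeff (convergentSubst (fun k => polyToSeries K n N (q k)) hq0
          (D.scaledXC j)).1 = 0 := fun j => by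
        rw [coe_convergentSubst, constantCoeff_subst_eq hq0, D.constantCoeff_scaledXC]
      rw [polyEval_C, MvPolynomial.eval₂Hom_C, polyToSeries_C, substScaled,
        convergentSubst_comp D.constantCoeff_scaledXC hq0 hc fun _ => rfl,
        map_convergentSubst_congr φ hc (v := fun j => convergentX (Sum.inl j))
          (fun j => constantCoeff_convergentX _) (map_convergentSubst_scaledXC hφ hq hq0)]
      congr 1
      rw [← convergentSubst_X_eq (convergentRename _ h), convergentSubst_rename]
      rfl
    · intro k
      change φ (convergentSubst (fun k => polyToSeries K n N (q k)) hq0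
        (D.polyEval (MvPolynomial.X k))) =
        φ (polyToSeries K n N (MvPolynomial.eval₂Hom MvPolynomial.C q (MvPolynomial.X k)))
      rw [polyEval_X, convergentSubst_X, MvPolynomial.eval₂Hom_X']
  exact congrArg (fun F : _ →+* B => F p) h

/-- The round trip K{y, X} → K{x, s} → K{y, X} is the identity modulo the presentation ideal; by
congruence of substitutions this need only be checked on the variables. -/
theorem map_convergentSubst_stalkSubst
    (hφ : (RingHom.ker (D.presentation a)).map (polyToSeries K n N) ≤ RingHom.ker φ)
    (hq : ∀ k, D.presentation a (q k) = D.reesGen k)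
    (hq0 : ∀ k, constantCoeff (polyToSeries K n N (q k)).1 = 0)
    {p : Fin N → MvPolynomial (Fin n ⊕ Unit) (convergentSeries (Fin n) K)}
    (hp : ∀ i, D.polyToRees (p i) = a i) (hb : ∀ i, constantCoeff (D.polyEval (p i)).1 = 0)
    (g : convergentSeries (Fin n ⊕ Fin N) K) :
    φ (convergentSubst (fun k => polyToSeries K n N (q k)) hq0 (D.stalkSubst hb g)) = φ g := by
  have hc : ∀ k, constantCoeff (convergentSubst (fun k => polyToSeries K n N (q k)) hq0
      (Sum.elim D.scaledXC (fun i => D.polyEval (p i)) k)).1 = 0 := fun k => by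
    rw [coe_convergentSubst, constantCoeff_subst_eq hq0, constantCoeff_stalkFamily hb]
  rw [stalkSubst, convergentSubst_comp (constantCoeff_stalkFamily hb) hq0 hc fun _ => rfl,
    map_convergentSubst_congr φ hc constantCoeff_convergentX, convergentSubst_X_eq]
  rintro (j | i)
  · exact map_convergentSubst_scaledXC hφ hq hq0 j
  · rw [Sum.elim_inr, map_convergentSubst_polyEval hφ hq hq0, ← polyToSeries_X]
    refine map_polyToSeries_congr hφ ?_
    rw [presentation_eval₂ hq, hp, presentation, MvPolynomial.eval₂Hom_X']

end Congruence

theorem exists_polyEval_eq_polyXS (p : MvPolynomial (Fin n) K) :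
    ∃ P, D.polyEval P = polyXS p := by
  induction p using MvPolynomial.induction_on with
  | C c =>
    refine ⟨MvPolynomial.C (algebraMap K _ c), ?_⟩
    rw [polyEval_C, AlgHom.commutes]
    exact (polyXS.commutes c).symm
  | add p q hp hq =>
    obtain ⟨P, hP⟩ := hp
    obtain ⟨Q, hQ⟩ := hq
    exact ⟨P + Q, by rw [map_add, map_add, hP, hQ]⟩
  | mul_X p j hp =>
    obtain ⟨P, hP⟩ := hp
    refine ⟨P * MvPolynomial.X (Sum.inl j), ?_⟩
    rw [map_mul, map_mul, hP, polyEval_X]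
    exact congrArg (polyXS p * ·) (MvPolynomial.aeval_X (fun j => convergentX (Sum.inl j)) j).symm

/-- Both series become the rescaled h after multiplication by s^e, and s^e cancels. -/
theorem exists_polyEval_eq_homogenize {e : ℕ} {h : convergentSeries (Fin n) K}
    (hh : ∀ β, coeff β h.1 ≠ 0 → e ≤ Finsupp.weight D.ell β) :
    ∃ P, D.polyEval P = D.homogenize e h := by
  obtain ⟨p, hp⟩ := exists_X_pow_mul_polyEval_eq (D := D) e h hh
  refine ⟨p, ?_⟩
  have h1 := (isHomogeneous_homogenize (D := D) e h).X_pow_mul_eq (a := e) (b := 0) (by simp)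
  rw [atOne_homogenize hh, pow_zero, one_mul, ← coe_substScaled, ← hp] at h1
  have h2 : IsDomain (MvPowerSeries (Fin n ⊕ Unit) K) := NoZeroDivisors.to_isDomain _
  have h3 : (X (Sum.inr ()) : MvPowerSeries (Fin n ⊕ Unit) K) ≠ 0 :=
    fun h => convergentX_ne_zero (Sum.inr ()) (Subtype.ext h)
  exact Subtype.ext (mul_left_cancel₀ (pow_ne_zero e h3) h1).symm

/-- The a_i are written through the standard generators by p_i, and the standard generators through
the a_i by q_k. Substituting p_i gives the map from K{y, X} onto K{ξ, s}; substituting q_k shows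
that its kernel is no larger than the presentation ideal. -/
theorem exists_stalk_algEquiv [CompleteSpace K] (hgcd : Finset.univ.gcd D.ell = 1)
    (hf : ∀ i, ∃ α β : Fin n →₀ ℕ, α ≠ β ∧
      Finsupp.weight D.ell α = d i ∧ Finsupp.weight D.ell β = d i ∧
      f i = MvPolynomial.monomial α 1 - MvPolynomial.monomial β 1)
    (hI : Ideal.span (Set.range f) = D.monomialIdeal)
    (hΓ : D.valueSemigroup = (D.semigroup : Set ℕ))
    {a : Fin N → orderRees D.curveRing} (ha : D.IsPresentation a) :
    ∃ Φ : D.AnalyticStalk a ≃ₐ[K] D.totalRing,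
      ∀ q : MvPolynomial (Fin N) (convergentSeries (Fin n) K),
        (Φ (Ideal.Quotient.mk _ (polyToSeries K n N q)) : MvPowerSeries (Fin 2) K) =
          reesToSeries D.curveRing (D.presentation a q) := by
  choose p hp using fun i => polyToRees_surjective hgcd hΓ (a i)
  choose q hq using fun k => ha.2 (D.reesGen k)
  have hab : ∀ i, (D.toTotal (D.polyEval (p i)) : MvPowerSeries (Fin 2) K) =
      reesHom D.curveRing (a i) := fun i => by rw [coe_toTotal_polyEval, hp]
  have hb : ∀ i, constantCoeff (D.polyEval (p i)).1 = 0 := fun i => by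
    rw [← constantCoeff_toTotal, hab]
    exact constantCoeff_reesHom_of_mem _ (ha.1 i)
  have hΘ := coe_toTotal_stalkSubst hb hab
  -- Substitution of series without constant terms preserves the constant term, and `q k` is carried
  -- to ξ_k or s; so the q_k may themselves be substituted.
  have hq0 : ∀ k, constantCoeff (polyToSeries K n N (q k)).1 = 0 := fun k => by
    rw [← constantCoeff_subst_eq (constantCoeff_stalkFamily (D := D) hb),
      ← coe_convergentSubst _ (constantCoeff_stalkFamily (D := D) hb), ← constantCoeff_toTotal]
    refine (congrArg constantCoeff (hΘ (q k))).trans ?_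
    rw [hq]
    exact constantCoeff_reesHom_of_mem _ (reesGen_mem_vertexIdeal k)
  have hsurj : Function.Surjective (D.toTotal.comp (D.stalkSubst hb)) := by
    intro y
    obtain ⟨g, rfl⟩ := D.toTotal_surjective y
    refine ⟨convergentSubst _ hq0 g, Subtype.ext ?_⟩
    have hd : ∀ k, constantCoeff (D.stalkSubst hb (polyToSeries K n N (q k))).1 = 0 := fun k => by
      rw [← constantCoeff_toTotal, hΘ, hq]
      exact constantCoeff_reesHom_of_mem _ (reesGen_mem_vertexIdeal k)
    change (D.toTotal (D.stalkSubst hb (convergentSubst _ hq0 g)) : MvPowerSeries (Fin 2) K) = _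
    rw [stalkSubst, convergentSubst_comp hq0 (constantCoeff_stalkFamily hb) hd fun _ => rfl,
      coe_toTotal_convergentSubst hd (c := D.xiS) fun k => by rw [hΘ, hq, reesHom_reesGen],
      coe_toTotal]
  have hker : (RingHom.ker (D.presentation a)).map (polyToSeries K n N) =
      RingHom.ker (D.toTotal.comp (D.stalkSubst hb)) := by
    apply le_antisymm
    · rw [Ideal.map_le_iff_le_comap]
      intro r hr
      change D.toTotal (D.stalkSubst hb (polyToSeries K n N r)) = 0
      apply Subtype.ext
      rw [hΘ, RingHom.mem_ker.1 hr]
      exact map_zero _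
    · obtain ⟨B, _, φ, -, hφ⟩ :=
        exists_surjective_ker_eq ((RingHom.ker (D.presentation a)).map (polyToSeries K n N))
      -- These liftings are chosen so that each F_i is the image of some P in K{y}[x, s]. As P
      -- vanishes in the Rees algebra, substituting the q_k in it gives an element of the kernel of
      -- the presentation.
      obtain ⟨h, hh, hL⟩ := exists_isLifting_homogenize hgcd hf hΓ
      have hzero : totalIdeal f (fun i => D.homogenize (d i + 1) (h i)) ≤
          RingHom.ker (φ.comp (convergentSubst _ hq0).toRingHom) := by
        have hle := hL.totalIdeal_le
        rw [totalIdeal_eq, Ideal.span_le] at hle ⊢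
        rintro _ ⟨i, rfl⟩
        obtain ⟨P₁, hP₁⟩ := exists_polyEval_eq_polyXS (D := D) (f i)
        obtain ⟨P₂, hP₂⟩ := exists_polyEval_eq_homogenize (hh i)
        obtain ⟨P, hP⟩ : ∃ P, D.polyEval P =
            polyXS (f i) - D.homogenize (d i + 1) (h i) * convergentX (Sum.inr ()) :=
          ⟨P₁ - P₂ * MvPolynomial.X (Sum.inr ()), by
            rw [map_sub, map_mul, hP₁, hP₂, polyEval_X]⟩
        have h1 : D.toTotal (D.polyEval P) = 0 := by
          rw [hP]
          exact hle ⟨i, rfl⟩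
        have h2 : D.polyToRees P = 0 := by
          apply reesHom_injective
          rw [← coe_toTotal_polyEval, h1, map_zero]
          rfl
        change φ (convergentSubst _ hq0 (polyXS (f i) -
          D.homogenize (d i + 1) (h i) * convergentX (Sum.inr ()))) = 0
        rw [← hP, map_convergentSubst_polyEval hφ.ge hq hq0,
          map_polyToSeries_congr hφ.ge (q' := 0) (by rw [presentation_eval₂ hq, h2, map_zero]),
          map_zero, map_zero]
      intro g hg
      -- By the round trip, g may be replaced by the image of its counterpart in K{x, s}, which
      -- vanishes at (ξ, s) and so lies in the ideal of the F_i.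
      rw [← hφ, RingHom.mem_ker, ← map_convergentSubst_stalkSubst hφ.ge hq hq0 hp hb]
      refine hzero ?_
      rw [← hL.ker_toTotal hgcd hI]
      exact hg
  refine ⟨(Ideal.quotientEquivAlgOfEq K hker).trans
    (Ideal.quotientKerAlgEquivOfSurjective hsurj), fun r => hΘ r⟩

end Stalk

end Deformation

end CurveDeformation

end

/-! ### The theorem -/

open CurveDeformation in
theorem proposition3p5 {K : Type*} [NontriviallyNormedField K] [CompleteSpace K] [IsAlgClosed K]
    {n m : ℕ} (D : Deformation K n) (hgcd : Finset.univ.gcd D.ell = 1)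
    (f : Fin m → MvPolynomial (Fin n) K) (d : Fin m → ℕ)
    (hf : ∀ i, ∃ α β : Fin n →₀ ℕ, α ≠ β ∧
      Finsupp.weight D.ell α = d i ∧ Finsupp.weight D.ell β = d i ∧
      f i = MvPolynomial.monomial α 1 - MvPolynomial.monomial β 1)
    (hI : Ideal.span (Set.range f) = D.monomialIdeal) :
    (D.valueSemigroup = (D.semigroup : Set ℕ) ↔
      ∃ f' : Fin m → convergentSeries (Fin n ⊕ Unit) K, D.IsLifting f d f') ∧
    ∀ f' : Fin m → convergentSeries (Fin n ⊕ Unit) K, D.IsLifting f d f' →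
      RingHom.Flat (R := convergentSeries Unit K)
        (S := convergentSeries (Fin n ⊕ Unit) K ⧸ Deformation.totalIdeal f f')
        (Deformation.structureMap f f') ∧
      (∃ Ψ : (convergentSeries (Fin n ⊕ Unit) K ⧸ Deformation.totalIdeal f f') ≃ₐ[K] D.totalRing,
        ∀ h : convergentSeries (Fin n ⊕ Unit) K,
          (Ψ (Ideal.Quotient.mk _ h) : MvPowerSeries (Fin 2) K) =
            MvPowerSeries.subst D.xiS (h : MvPowerSeries (Fin n ⊕ Unit) K)) ∧
      (∃ (N : ℕ) (a : Fin N → orderRees D.curveRing), D.IsPresentation a) ∧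
      ∀ (N : ℕ) (a : Fin N → orderRees D.curveRing), D.IsPresentation a →
        ∃ Φ : D.AnalyticStalk a ≃ₐ[K] D.totalRing,
          ∀ q : MvPolynomial (Fin N) (convergentSeries (Fin n) K),
            (Φ (Ideal.Quotient.mk _ (Deformation.polyToSeries K n N q)) :
              MvPowerSeries (Fin 2) K) = reesToSeries D.curveRing (D.presentation a q) := by
  refine ⟨⟨fun hΓ => ?_, fun ⟨f', hL⟩ => hL.valueSemigroup_eq hf hI⟩, fun f' hL => ?_⟩
  · obtain ⟨h, -, hL⟩ := Deformation.exists_isLifting_homogenize hgcd hf hΓ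
    exact ⟨_, hL⟩
  · have hΓ := hL.valueSemigroup_eq hf hI
    exact ⟨hL.flat_structureMap hgcd hI, hL.exists_algEquiv hgcd hI,
      Deformation.exists_isPresentation hgcd hΓ,
      fun N a ha => Deformation.exists_stalk_algEquiv hgcd hf hI hΓ ha⟩
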